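/- **Notation.** Let $d\in\mathbb N$ and let $m\in[2,\infty)$. Let $\kappa_{m,d}$ be the best constant of the discrete Burkholder–Davis–Gundy inequality: the least $\kappa\ge 0$ such that for every probability space, every filtration $(\mathcal G_n)_{n\ge 1}$ and all $\mathbb R^d$-valued $X_n\in L_m$, with $X_n$ $\mathcal G_n$-measurable for $n\ge1$ and $\mathbb E[X_n\mid\mathcal G_{n-1}]=0$ for $n\ge 2$, one has $$\Big\|\sum_{n=1}^N X_n\Big\|_{L_m}\le \kappa\,\Big\|\sum_{n=1}^N |X_n|^2\Big\|_{L_{m/2}}^{1/2}\quad\text{for all } N .$$ We write $A\lesssim_{a,b,\dots}B$ if $A\le c\,B$ with a constant $c\ge0$ that depends only on $a,b,\dots$. For a partition $\pi$ of an interval, $|\pi|$ denotes the maximal length of its subintervals. Put $\delta A_{s,u,t}=A_{s,t}-A_{s,u}-A_{u,t}$. **Statement.** Let $T\ge 0$, let $(\mathcal F_t)_{t\in[0,T]}$ be a filtration on a probability space $(\Omega,\mathcal A_\Omega,\mathbb P)$, and let $(A_{s,t})_{0\le s\le t\le T}$ be $\mathbb R^d$-valued random variables such that $A_{s,s}=0$,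 $A_{s,t}$ is $\mathcal F_t$-measurable and $A_{s,t}\in L_m(\mathbb P)$. Let $$\Gamma_1,\Gamma_2,\Gamma_3,M,\alpha,\beta_1,\beta_2,\beta_3,\gamma_1,\gamma_2\in[0,\infty)$$ satisfy $$\beta_1>1,\quad \beta_2>\tfrac12,\quad \beta_1-\alpha>\tfrac12,\quad \gamma_1,\gamma_2<\tfrac12,\quad \beta_3>0,$$ and suppose that for all $0\le t_0<t_1<t_2<t_3\le T$ $$\|\mathbb E[\delta A_{t_1,t_2,t_3}\mid\mathcal F_{t_0}]\|_{L_m}\le \Gamma_1\, t_1^{-\gamma_1}(t_1-t_0)^{-\alpha}(t_3-t_1)^{\beta_1}\quad\text{if } M(t_3-t_1)\le t_1-t_0,$$ and that for all $0\le t_0<t_1<t_2\le T$ $$\|\delta A_{t_0,t_1,t_2}\|_{L_m}\le \Gamma_2\, t_0^{-\gamma_2}(t_2-t_0)^{\beta_2}\quad\text{if } t_0>0,\qquad \|\delta A_{t_0,t_1,t_2}\|_{L_m}\le \Gamma_3\,(t_2-t_0)^{\beta_3}.$$ Then there exists a unique, up to modifications, $\mathbb R^d$-valued process $(\mathcal A_t)_{t\in[0,T]}$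 with the following properties: * $\mathcal A_0=0$ almost surely, $\mathcal A_t$ is $\mathcal F_t$-measurable and $\mathcal A_t\in L_m(\mathbb P)$ for every $t\in[0,T]$; * there are constants $C_1,\dots,C_6\ge0$ such that $$\|\mathbb E[\mathcal A_{t_2}-\mathcal A_{t_1}-A_{t_1,t_2}\mid\mathcal F_{t_0}]\|_{L_m}\le C_1\,t_1^{-\gamma_1}(t_1-t_0)^{-\alpha}(t_2-t_1)^{\beta_1}$$ for all $0\le t_0<t_1<t_2\le T$ with $M(t_2-t_1)\le t_1-t_0$, $$\|\mathcal A_{t_2}-\mathcal A_{t_1}-A_{t_1,t_2}\|_{L_m}\le C_2\,t_1^{-\gamma_1}(t_2-t_1)^{\beta_1-\alpha}+C_3\,t_1^{-\gamma_2}(t_2-t_1)^{\beta_2}$$ for all $0<t_1<t_2\le T$, and $$\|\mathcal A_{t_2}-\mathcal A_{t_1}-A_{t_1,t_2}\|_{L_m}\le C_4\,(t_2-t_1)^{\beta_1-\alpha-\gamma_1}+C_5\,(t_2-t_1)^{\beta_2-\gamma_2}+C_6\,(t_2-t_1)^{\beta_3}$$ for all $0\le t_1<t_2\le T$. Moreover,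 $C_1,\dots,C_6$ can be chosen such that $$C_1\lesssim_{\beta_1}\Gamma_1,\quad C_2\lesssim_{\alpha,\beta_1,\beta_2,M}\kappa_{m,d}\Gamma_1,\quad C_3\lesssim_{\alpha,\beta_1,\beta_2,M}\kappa_{m,d}\Gamma_2,$$ $$C_4\lesssim_{\alpha,\beta_1,\gamma_1,M}\kappa_{m,d}\Gamma_1,\quad C_5\lesssim_{\beta_2,\gamma_2,M}\kappa_{m,d}\Gamma_2,\quad C_6\lesssim_{\beta_3,M}\kappa_{m,d}\Gamma_3 .$$ Finally, for every $\tau\in[0,T]$, the sums $A^\pi_\tau=\sum_{[s,t]\in\pi}A_{s,t}$ over partitions $\pi$ of $[0,\tau]$ converge to $\mathcal A_\tau$ in $L_m(\mathbb P)$ as $|\pi|\to0$. -/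

import Mathlib

open MeasureTheory Filter Topology
open scoped NNReal ENNReal

universe u

/-- `K` is a constant for the discrete Burkholder-Davis-Gundy inequality in `L_m` for `ℝ^d`-valued
martingale differences `X 0, X 1, …` (the first one need not be centred), over all probability
spaces. It is stated for all finite partial sums, which is equivalent to the version for infinite
series. If some `X n` were not in `L_m`, the right-hand side would be infinite. -/
def IsBDGConstant (m : ℝ) (d : ℕ) (K : ℝ) : Prop :=
  0 ≤ K ∧
  ∀ (Ω : Type u) (mΩ : MeasurableSpace Ω) (P : Measure Ω) (_ : IsProbabilityMeasure P)
    (𝓖 : Filtration ℕ mΩ) (X : ℕ → Ω → EuclideanSpace ℝ (Fin d)),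
    (∀ n, StronglyMeasurable[𝓖 n] (X n)) →
    (∀ n, MemLp (X n) (ENNReal.ofReal m) P) →
    (∀ n, P[X (n + 1) | 𝓖 n] =ᵐ[P] 0) →
    ∀ N : ℕ,
      eLpNorm (fun ω => ∑ n ∈ Finset.range N, X n ω) (ENNReal.ofReal m) P ≤
        ENNReal.ofReal K *
          (eLpNorm (fun ω => ∑ n ∈ Finset.range N, ‖X n ω‖ ^ 2) (ENNReal.ofReal (m / 2)) P)
            ^ (1 / 2 : ℝ)

/-- `κ_{m,d}`: the best constant of the discrete Burkholder-Davis-Gundy inequality. -/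
noncomputable def bdgConst (m : ℝ) (d : ℕ) : ℝ :=
  sInf {K : ℝ | IsBDGConstant.{u} m d K}

theorem bdgConst_nonneg (m : ℝ) (d : ℕ) : 0 ≤ bdgConst.{u} m d :=
  Real.sInf_nonneg fun _ hK => hK.1

/-- `δA_{s,u,t} = A_{s,t} - A_{s,u} - A_{u,t}`. -/
def germDelta {Ω E : Type*} [AddCommGroup E] (A : ℝ → ℝ → Ω → E) (s u t : ℝ) : Ω → E :=
  fun ω => A s t ω - A s u ω - A u t ω

/-- A partition `a = pt 0 < pt 1 < ⋯ < pt n = b` of `[a, b]`. -/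
structure IntervalPartition (a b : ℝ) where
  n : ℕ
  pt : Fin (n + 1) → ℝ
  strictMono : StrictMono pt
  left : pt 0 = a
  right : pt (Fin.last n) = b

/-- `|π|`, the maximal length of an interval of the partition (`0` if there is none, i.e. `a = b`). -/
noncomputable def IntervalPartition.mesh {a b : ℝ} (π : IntervalPartition a b) : ℝ :=
  ⨆ i : Fin π.n, (π.pt i.succ - π.pt i.castSucc)

/-- `A^π = ∑_{[s,t] ∈ π} A_{s,t}`. -/
def riemannSum {Ω E : Type*} [AddCommGroup E] (A : ℝ → ℝ → Ω → E) {a b : ℝ}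
    (π : IntervalPartition a b) : Ω → E :=
  fun ω => ∑ i : Fin π.n, A (π.pt i.castSucc) (π.pt i.succ) ω

/-- The properties that characterize the process `𝒜` associated with the germ `A`, with given
constants `C₁, …, C₆`. Only the times in `[0, T]` matter. -/
structure IsSingularSewing {Ω : Type*} {mΩ : MeasurableSpace Ω} (P : Measure Ω)
    (𝓕 : Filtration ℝ mΩ) {d : ℕ} (T m M α β₁ β₂ β₃ γ₁ γ₂ : ℝ)
    (A : ℝ → ℝ → Ω → EuclideanSpace ℝ (Fin d)) (C₁ C₂ C₃ C₄ C₅ C₆ : ℝ)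
    (𝒜 : ℝ → Ω → EuclideanSpace ℝ (Fin d)) : Prop where
  zero : 𝒜 0 =ᵐ[P] 0
  adapted : ∀ t, 0 ≤ t → t ≤ T → StronglyMeasurable[𝓕 t] (𝒜 t)
  memLp : ∀ t, 0 ≤ t → t ≤ T → MemLp (𝒜 t) (ENNReal.ofReal m) P
  condExp_bound : ∀ t₀ t₁ t₂, 0 ≤ t₀ → t₀ < t₁ → t₁ < t₂ → t₂ ≤ T → M * (t₂ - t₁) ≤ t₁ - t₀ →
    eLpNorm (P[fun ω => 𝒜 t₂ ω - 𝒜 t₁ ω - A t₁ t₂ ω | 𝓕 t₀]) (ENNReal.ofReal m) P ≤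
      ENNReal.ofReal (C₁ * t₁ ^ (-γ₁) * (t₁ - t₀) ^ (-α) * (t₂ - t₁) ^ β₁)
  weighted_bound : ∀ t₁ t₂, 0 < t₁ → t₁ < t₂ → t₂ ≤ T →
    eLpNorm (fun ω => 𝒜 t₂ ω - 𝒜 t₁ ω - A t₁ t₂ ω) (ENNReal.ofReal m) P ≤
      ENNReal.ofReal (C₂ * t₁ ^ (-γ₁) * (t₂ - t₁) ^ (β₁ - α)
        + C₃ * t₁ ^ (-γ₂) * (t₂ - t₁) ^ β₂)
  continuity_bound : ∀ t₁ t₂, 0 ≤ t₁ → t₁ < t₂ → t₂ ≤ T →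
    eLpNorm (fun ω => 𝒜 t₂ ω - 𝒜 t₁ ω - A t₁ t₂ ω) (ENNReal.ofReal m) P ≤
      ENNReal.ofReal (C₄ * (t₂ - t₁) ^ (β₁ - α - γ₁) + C₅ * (t₂ - t₁) ^ (β₂ - γ₂)
        + C₆ * (t₂ - t₁) ^ β₃)

/-! The process is the `L_m` limit of Riemann sums along the grids of mesh `h = H / 2^n`. Halving
the mesh changes the sum over `[s, t]` by minus the sum of `δA` over the cells. The triangle
inequality is too weak here, as a single `δA` is only of order `h^β₂` with `β₂ > 1/2`, so
cancellation has to come from the conditional bound.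

Cells are grouped into blocks of length `Λh` with `Λ ≥ M`, so that the conditional bound applies to
a block given the start of any earlier one. A block sum splits into finitely many martingale
differences and a predictable remainder. By Burkholder-Davis-Gundy the former add up in square mean.
With weights `i^(-γ)`, `γ < 1/2`, and about `1/h` blocks this gives `h^(β₂ - 1/2)`, which is
summable over dyadic `h`.

The remainders are again too large to be added by the triangle inequality. Neighbours are paired and
the splitting is repeated at the coarser scale (`lpBound_sum_of_condExp_decay`). Each pairing
doubles the time lag, so the size of the predictable terms changes by the factor `2^(1 - γ - α)`,
while every scale contributes one martingale. Summability over all levels is then exactly `β₁ - α >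
1/2` (martingales) and `β₁ > 1` (recursion), see `summable_blockGrowth`. The first block, which may
touch the singularity at time zero, is bounded by the unweighted hypothesis alone.

For the estimate on `[s, t]` the refinement starts at a mesh comparable to `t - s`. The weighted
estimate is the same argument on `[s, T]` with the weights frozen at `s`. The conditional estimate
needs no martingales, as conditionally each `δA` is of order `h^β₁` with `β₁ > 1`.

The block estimate `lpBound_sum_cells` does not require a grid. Applied to the remainders `𝒜_t - 𝒜_s
- A_{s,t}` over the intervals of comparable length of an arbitrary partition, it shows that any
process with the stated bounds is the limit of the Riemann sums. This yields both the convergence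
and the uniqueness.

For the constants to be multiples of `κ`, the optimal Burkholder-Davis-Gundy constant has to be
finite, attained, and at least one for `d ≠ 0`. Finiteness follows from a pathwise inequality whose
martingale terms have zero mean. -/

/-! ### Pathwise Doob and Burkholder-Davis-Gundy inequalities -/

section Pathwise

/-- Convexity of the power function: Bernoulli's inequality for `s / u`, scaled by `u ^ c`. -/
theorem rpow_sub_rpow_le_mul_sub {c u s : ℝ} (hc : 1 ≤ c) (hu : 0 ≤ u) (hs : 0 ≤ s) :
    u ^ c - s ^ c ≤ c * u ^ (c - 1) * (u - s) := by
  rcases hu.eq_or_lt with rfl | hu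
  · rcases hc.eq_or_lt with rfl | hc
    · simp
    · rw [Real.zero_rpow (by linarith), Real.zero_rpow (by linarith)]
      have := Real.rpow_nonneg hs c
      linarith
  · have h := one_add_mul_self_le_rpow_one_add (s := s / u - 1)
      (by have := div_nonneg hs hu.le; linarith) hc
    have h2 : (1 + (s / u - 1)) ^ c = s ^ c / u ^ c := by
      rw [← Real.div_rpow hs hu.le]; ring_nf
    have hupos : 0 < u ^ c := Real.rpow_pos_of_pos hu c
    rw [h2, le_div_iff₀ hupos] at h
    have h3 : u ^ (c - 1) * u = u ^ c := by
      rw [Real.rpow_sub_one hu.ne', div_mul_cancel₀ _ hu.ne']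
    have h4 : u ^ c * (s / u) = u ^ (c - 1) * s := by
      rw [← h3]; field_simp
    nlinarith

/-- Young's inequality with an unspecified constant. -/
theorem exists_rpow_mul_rpow_le {q r ε : ℝ} (hq : 0 ≤ q) (hr : 0 < r) (hε : 0 < ε) :
    ∃ C : ℝ, 0 ≤ C ∧ ∀ u v : ℝ, 0 ≤ u → 0 ≤ v →
      u ^ q * v ^ r ≤ ε * u ^ (q + r) + C * v ^ (q + r) := by
  -- Either `v ≤ δ u`, and then `v ^ r ≤ ε u ^ r`, or `u ≤ v / δ`, and then the second term
  -- dominates.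
  set δ := ε ^ (1 / r) with hδ
  have hδ0 : 0 < δ := Real.rpow_pos_of_pos hε _
  have hδr : δ ^ r = ε := by
    rw [hδ, ← Real.rpow_mul hε.le, one_div_mul_cancel hr.ne', Real.rpow_one]
  refine ⟨(1 / δ) ^ q, by positivity, fun u v hu hv => ?_⟩
  rw [Real.rpow_add_of_nonneg hu hq hr.le, Real.rpow_add_of_nonneg hv hq hr.le]
  rcases le_total v (δ * u) with h | h
  · have : v ^ r ≤ ε * u ^ r := by
      rw [← hδr, ← Real.mul_rpow hδ0.le hu]
      exact Real.rpow_le_rpow hv h hr.le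
    have h2 := mul_le_mul_of_nonneg_left this (Real.rpow_nonneg hu q)
    have h3 : 0 ≤ (1 / δ) ^ q * (v ^ q * v ^ r) := by positivity
    linarith
  · have : u ^ q ≤ (1 / δ) ^ q * v ^ q := by
      rw [← Real.mul_rpow (by positivity) hv]
      refine Real.rpow_le_rpow hu ?_ hq
      rw [one_div, ← div_eq_inv_mul, le_div_iff₀ hδ0]; linarith
    have h2 := mul_le_mul_of_nonneg_right this (Real.rpow_nonneg hv r)
    have h3 : 0 ≤ ε * (u ^ q * u ^ r) := by positivity
    linarith

/-- For `q < 1` the power `v ^ q` is not convex. The factor `u + s ≤ 2u` of `u² - s²` repairs this: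
`u (u^q - s^q) ≤ u^(q+1) - s^(q+1)`, to which convexity applies. -/
theorem rpow_taylor_aux {q u s : ℝ} (hq : 0 ≤ q) (hs : 0 ≤ s) (h : s ≤ u) :
    (u ^ q - s ^ q) * (u ^ 2 - s ^ 2) ≤ 2 * (q + 1) * u ^ q * (u - s) ^ 2 := by
  have hu : 0 ≤ u := hs.trans h
  have h1 := rpow_sub_rpow_le_mul_sub (c := q + 1) (by linarith) hu hs
  rw [add_sub_cancel_right, Real.rpow_add_one' hu (by linarith),
    Real.rpow_add_one' hs (by linarith)] at h1
  have hmono : s ^ q ≤ u ^ q := Real.rpow_le_rpow hs h hq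
  have h2 : u * (u ^ q - s ^ q) ≤ (q + 1) * u ^ q * (u - s) := by
    nlinarith [Real.rpow_nonneg hs q]
  have h3 : (u ^ q - s ^ q) * (u + s) ≤ 2 * (u * (u ^ q - s ^ q)) := by nlinarith
  have : (u ^ q - s ^ q) * (u ^ 2 - s ^ 2) = ((u ^ q - s ^ q) * (u + s)) * (u - s) := by ring
  rw [this]
  nlinarith

/-- The power is regarded as a convex function of `v²`, because squared norms are what an inner
product expands. Convexity gives the slope at `u`; moving it to `s` costs the quadratic error of
`rpow_taylor_aux`. -/
theorem rpow_taylor {q u s : ℝ} (hq : 0 ≤ q) (hs : 0 ≤ s) (hu : 0 ≤ u) :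
    u ^ (q + 2) - s ^ (q + 2) - (q + 2) / 2 * s ^ q * (u ^ 2 - s ^ 2) ≤
      (q + 2) * (q + 1) * (max s u) ^ q * (u - s) ^ 2 := by
  have h1 := rpow_sub_rpow_le_mul_sub (c := (q + 2) / 2) (u := u ^ 2) (s := s ^ 2)
    (by linarith) (by positivity) (by positivity)
  have e : ∀ v : ℝ, 0 ≤ v → (v ^ 2) ^ ((q + 2) / 2) = v ^ (q + 2) := fun v hv => by
    rw [← Real.rpow_natCast, ← Real.rpow_mul hv]; congr 1; push_cast; ring
  have e' : ∀ v : ℝ, 0 ≤ v → (v ^ 2) ^ ((q + 2) / 2 - 1) = v ^ q := fun v hv => by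
    rw [← Real.rpow_natCast, ← Real.rpow_mul hv]; congr 1; push_cast; ring
  rw [e u hu, e s hs, e' u hu] at h1
  have h2 : (u ^ q - s ^ q) * (u ^ 2 - s ^ 2) ≤ 2 * (q + 1) * (max s u) ^ q * (u - s) ^ 2 := by
    rcases le_total s u with h | h
    · rw [max_eq_right h]; exact rpow_taylor_aux hq hs h
    · rw [max_eq_left h]; have := rpow_taylor_aux hq hu h; nlinarith
  nlinarith

variable {V : Type*} [NormedAddCommGroup V]

/-- The running maximum of the norms of a sequence. -/
noncomputable def runMax (S : ℕ → V) : ℕ → ℝ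
  | 0 => ‖S 0‖
  | n + 1 => max (runMax S n) ‖S (n + 1)‖

theorem norm_le_runMax (S : ℕ → V) (n : ℕ) : ‖S n‖ ≤ runMax S n := by
  cases n with
  | zero => exact le_rfl
  | succ n => exact le_max_right _ _

theorem runMax_nonneg (S : ℕ → V) (n : ℕ) : 0 ≤ runMax S n :=
  (norm_nonneg _).trans (norm_le_runMax S n)

theorem runMax_mono (S : ℕ → V) : Monotone (runMax S) :=
  monotone_nat_of_le_succ fun _ => le_max_left _ _

/-- A pathwise form of Doob's maximal inequality. -/
theorem doob_pathwise {p : ℝ} (hp : 1 < p) (S : ℕ → V) (N : ℕ) :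
    (p - 1) * runMax S N ^ p ≤ p * (runMax S N ^ (p - 1) * ‖S N‖)
      - p * ∑ i ∈ Finset.range N, runMax S i ^ (p - 1) * (‖S (i + 1)‖ - ‖S i‖) := by
  induction N with
  | zero =>
    have : ‖S 0‖ ^ (p - 1) * ‖S 0‖ = ‖S 0‖ ^ p := by
      rw [← Real.rpow_add_one' (norm_nonneg _) (by linarith), sub_add_cancel]
    simp only [runMax, Finset.range_zero, Finset.sum_empty, mul_zero, sub_zero, this]
    nlinarith [Real.rpow_nonneg (norm_nonneg (S 0)) p]
  | succ n ih =>
    rw [Finset.sum_range_succ]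
    set a := runMax S n with ha
    have ha0 : 0 ≤ a := runMax_nonneg S n
    set t := ‖S (n + 1)‖ with ht
    have ht0 : 0 ≤ t := norm_nonneg _
    have hr : runMax S (n + 1) = max a t := rfl
    rw [hr]
    -- If the maximum does not move, neither side changes. If it rises to `t`, the claim is the
    -- tangent inequality `a^p - t^p ≤ p a^(p-1) (a - t)`.
    rcases le_total t a with h | h
    · rw [max_eq_left h]
      linarith
    · rw [max_eq_right h]
      have h1 := rpow_sub_rpow_le_mul_sub (c := p) hp.le ha0 ht0
      have e : ∀ v : ℝ, 0 ≤ v → v ^ (p - 1) * v = v ^ p := fun v hv => by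
        rw [← Real.rpow_add_one' hv (by linarith), sub_add_cancel]
      have e1 := e a ha0
      have e2 := e t ht0
      rw [e2]
      nlinarith

variable [InnerProductSpace ℝ V]

/-- Second-order expansion with exponent `p = q + 2`. Along a martingale the term linear in `y` has
zero mean, and the last one feeds the square function. -/
theorem norm_add_rpow_le {q : ℝ} (hq : 0 ≤ q) (x y : V) :
    ‖x + y‖ ^ (q + 2) ≤ ‖x‖ ^ (q + 2) + (q + 2) * (‖x‖ ^ q * inner ℝ x y)
      + (q + 2) ^ 2 * (max ‖x‖ ‖x + y‖) ^ q * ‖y‖ ^ 2 := by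
  have h := rpow_taylor hq (norm_nonneg x) (norm_nonneg (x + y))
  have h1 : ‖x + y‖ ^ 2 - ‖x‖ ^ 2 = 2 * inner ℝ x y + ‖y‖ ^ 2 := by
    rw [norm_add_sq_real]; ring
  rw [h1] at h
  have h2 : (‖x + y‖ - ‖x‖) ^ 2 ≤ ‖y‖ ^ 2 := by
    apply sq_le_sq'
    · have := norm_sub_le (x + y) y
      rw [add_sub_cancel_right] at this; linarith
    · linarith [norm_add_le x y]
  have h3 : ‖x‖ ^ q ≤ (max ‖x‖ ‖x + y‖) ^ q :=
    Real.rpow_le_rpow (norm_nonneg x) (le_max_left _ _) hq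
  have h4 : 0 ≤ (max ‖x‖ ‖x + y‖) ^ q := by positivity
  have h5 := mul_le_mul_of_nonneg_left h2 (by positivity :
    0 ≤ (q + 2) * (q + 1) * (max ‖x‖ ‖x + y‖) ^ q)
  have h6 := mul_le_mul_of_nonneg_right h3 (by positivity : 0 ≤ (q + 2) / 2 * ‖y‖ ^ 2)
  have h7 : 0 ≤ (max ‖x‖ ‖x + y‖) ^ q * ‖y‖ ^ 2 := by positivity
  nlinarith

/-- Subgradient inequality for the norm; the convention `0⁻¹ = 0` covers `x = 0`. -/
theorem norm_sub_norm_ge (x y : V) : inner ℝ (‖x‖⁻¹ • x) y ≤ ‖x + y‖ - ‖x‖ := by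
  rcases eq_or_ne x 0 with rfl | hx
  · simp
  · have hx' : 0 < ‖x‖ := norm_pos_iff.2 hx
    have h1 : inner ℝ (‖x‖⁻¹ • x) (x + y) ≤ ‖x + y‖ := by
      refine (real_inner_le_norm _ _).trans ?_
      rw [norm_smul, norm_inv, norm_norm, inv_mul_cancel₀ hx'.ne', one_mul]
    rw [inner_add_right, real_inner_smul_left, real_inner_self_eq_norm_sq] at h1
    have : ‖x‖⁻¹ * ‖x‖ ^ 2 = ‖x‖ := by field_simp
    linarith

/-- The integrand in the pathwise Burkholder-Davis-Gundy inequality. -/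
noncomputable def bdgIntegrand (p a b : ℝ) (S : ℕ → V) (i : ℕ) : V :=
  (a * ‖S i‖ ^ (p - 2) - b * (runMax S i ^ (p - 1) * ‖S i‖⁻¹)) • S i

theorem norm_bdgIntegrand_le {p a b : ℝ} (hp : 2 ≤ p) (ha : 0 ≤ a) (hb : 0 ≤ b) (S : ℕ → V)
    (i : ℕ) : ‖bdgIntegrand p a b S i‖ ≤ (a + b) * runMax S i ^ (p - 1) := by
  have h0 := runMax_nonneg S i
  have h1 := norm_le_runMax S i
  have h2 : ‖S i‖ ^ (p - 2) * ‖S i‖ ≤ runMax S i ^ (p - 1) := by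
    rw [← Real.rpow_add_one' (norm_nonneg _) (by linarith)]
    calc _ ≤ runMax S i ^ (p - 2 + 1) := Real.rpow_le_rpow (norm_nonneg _) h1 (by linarith)
      _ = _ := by congr 1; ring
  have h3 : ‖S i‖⁻¹ * ‖S i‖ ≤ 1 := inv_mul_le_one
  have h4 : 0 ≤ runMax S i ^ (p - 1) := Real.rpow_nonneg h0 _
  have h5 : 0 ≤ ‖S i‖ ^ (p - 2) := Real.rpow_nonneg (norm_nonneg _) _
  rw [bdgIntegrand, norm_smul]
  calc _ ≤ (a * ‖S i‖ ^ (p - 2) + b * (runMax S i ^ (p - 1) * ‖S i‖⁻¹)) * ‖S i‖ := by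
        gcongr
        refine (norm_sub_le _ _).trans (le_of_eq ?_)
        rw [Real.norm_of_nonneg (by positivity), Real.norm_of_nonneg (by positivity)]
    _ = a * (‖S i‖ ^ (p - 2) * ‖S i‖) + b * (runMax S i ^ (p - 1) * (‖S i‖⁻¹ * ‖S i‖)) := by ring
    _ ≤ a * runMax S i ^ (p - 1) + b * (runMax S i ^ (p - 1) * 1) := by gcongr
    _ = _ := by ring

/-- A pathwise form of the Burkholder-Davis-Gundy inequality. -/
theorem bdg_pathwise {p : ℝ} (hp : 2 ≤ p) : ∃ C a b : ℝ, 0 ≤ C ∧ 0 ≤ a ∧ 0 ≤ b ∧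
    ∀ (x : ℕ → V) (N : ℕ),
      runMax (fun n => ∑ i ∈ Finset.range n, x i) N ^ p ≤
        C * (∑ i ∈ Finset.range N, ‖x i‖ ^ 2) ^ (p / 2)
        + ∑ i ∈ Finset.range N,
          inner ℝ (bdgIntegrand p a b (fun n => ∑ i ∈ Finset.range n, x i) i) (x i) := by
  have hp0 : 0 < p := by linarith
  obtain ⟨C1, hC1, hY1⟩ := exists_rpow_mul_rpow_le (q := p - 1) (r := 1) (ε := 1 / (2 * p))
    (by linarith) one_pos (by positivity)
  obtain ⟨C2, hC2, hY2⟩ := exists_rpow_mul_rpow_le (q := p - 2) (r := 2)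
    (ε := 1 / (4 * (p ^ 3 * C1 + 1))) (by linarith) two_pos (by positivity)
  -- Doob's inequality leaves `p R^(p-1) ‖S_N‖`. Young's inequality bounds it by `R^p / 2` plus a
  -- multiple of `‖S_N‖^p`; the Taylor expansion turns the latter into `R^(p-2) Q`, which costs
  -- another `R^p / 4`. Absorbing both leaves `R^p / 4` on the left, hence the factors 4.
  refine ⟨4 * (p ^ 3 * C1) * C2, 4 * p ^ 2 * C1, 4 * p, by positivity, by positivity,
    by positivity, fun x N => ?_⟩
  set S : ℕ → V := fun n => ∑ i ∈ Finset.range n, x i with hS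
  have hSs : ∀ n, S (n + 1) = S n + x n := fun n => Finset.sum_range_succ _ _
  set R := runMax S N with hR
  have hR0 : 0 ≤ R := runMax_nonneg S N
  set Q := ∑ i ∈ Finset.range N, ‖x i‖ ^ 2 with hQ
  have hQ0 : 0 ≤ Q := Finset.sum_nonneg fun _ _ => by positivity
  have htay : ‖S N‖ ^ p ≤ p * ∑ i ∈ Finset.range N, ‖S i‖ ^ (p - 2) * inner ℝ (S i) (x i)
      + p ^ 2 * R ^ (p - 2) * Q := by
    have step : ∀ i ∈ Finset.range N, ‖S (i + 1)‖ ^ p - ‖S i‖ ^ p ≤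
        p * (‖S i‖ ^ (p - 2) * inner ℝ (S i) (x i)) + p ^ 2 * R ^ (p - 2) * ‖x i‖ ^ 2 := by
      intro i hi
      have h := norm_add_rpow_le (q := p - 2) (by linarith) (S i) (x i)
      rw [← hSs, sub_add_cancel] at h
      have hm : max ‖S i‖ ‖S (i + 1)‖ ≤ R :=
        max_le ((norm_le_runMax S i).trans (runMax_mono S (Finset.mem_range.1 hi).le))
          ((norm_le_runMax S (i + 1)).trans (runMax_mono S (Finset.mem_range.1 hi)))
      have hm' : (max ‖S i‖ ‖S (i + 1)‖) ^ (p - 2) ≤ R ^ (p - 2) :=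
        Real.rpow_le_rpow (by positivity) hm (by linarith)
      have := mul_le_mul_of_nonneg_right hm' (by positivity : 0 ≤ p ^ 2 * ‖x i‖ ^ 2)
      linarith
    have := Finset.sum_le_sum step
    rw [Finset.sum_range_sub (fun i => ‖S i‖ ^ p), Finset.sum_add_distrib, ← Finset.mul_sum,
      ← Finset.mul_sum] at this
    have h0 : ‖S 0‖ ^ p = 0 := by simp [hS, Real.zero_rpow hp0.ne']
    linarith
  have hdoob := doob_pathwise (p := p) (by linarith) S N
  have hD : ∑ i ∈ Finset.range N, runMax S i ^ (p - 1) * (‖S i‖⁻¹ * inner ℝ (S i) (x i)) ≤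
      ∑ i ∈ Finset.range N, runMax S i ^ (p - 1) * (‖S (i + 1)‖ - ‖S i‖) := by
    refine Finset.sum_le_sum fun i _ => mul_le_mul_of_nonneg_left ?_
      (Real.rpow_nonneg (runMax_nonneg S i) _)
    have := norm_sub_norm_ge (S i) (x i)
    rwa [real_inner_smul_left, ← hSs] at this
  have y1 := hY1 R ‖S N‖ hR0 (norm_nonneg _)
  have y2 := hY2 R (Real.sqrt Q) hR0 (Real.sqrt_nonneg _)
  rw [Real.rpow_one, sub_add_cancel] at y1
  rw [sub_add_cancel, Real.rpow_two, Real.sq_sqrt hQ0, Real.sqrt_eq_rpow,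
    ← Real.rpow_mul hQ0, show 1 / 2 * p = p / 2 by ring] at y2
  have hsum : ∑ i ∈ Finset.range N, inner ℝ (bdgIntegrand p (4 * p ^ 2 * C1) (4 * p) S i) (x i)
      = 4 * p ^ 2 * C1 * ∑ i ∈ Finset.range N, ‖S i‖ ^ (p - 2) * inner ℝ (S i) (x i)
        - 4 * p * ∑ i ∈ Finset.range N,
          runMax S i ^ (p - 1) * (‖S i‖⁻¹ * inner ℝ (S i) (x i)) := by
    rw [Finset.mul_sum, Finset.mul_sum, ← Finset.sum_sub_distrib]
    refine Finset.sum_congr rfl fun i _ => ?_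
    rw [bdgIntegrand, real_inner_smul_left]; ring
  rw [hsum]
  set A := ∑ i ∈ Finset.range N, ‖S i‖ ^ (p - 2) * inner ℝ (S i) (x i)
  set B := ∑ i ∈ Finset.range N, runMax S i ^ (p - 1) * (‖S i‖⁻¹ * inner ℝ (S i) (x i))
  have hRp : 0 ≤ R ^ p := Real.rpow_nonneg hR0 p
  have z1 : p * (R ^ (p - 1) * ‖S N‖) ≤ 1 / 2 * R ^ p + p * C1 * ‖S N‖ ^ p := by
    have := mul_le_mul_of_nonneg_left y1 hp0.le
    have e : p * (1 / (2 * p) * R ^ p) = 1 / 2 * R ^ p := by field_simp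
    linarith
  have z2 : p ^ 3 * C1 * (R ^ (p - 2) * Q) ≤ 1 / 4 * R ^ p + p ^ 3 * C1 * C2 * Q ^ (p / 2) := by
    have := mul_le_mul_of_nonneg_left y2 (by positivity : 0 ≤ p ^ 3 * C1)
    have e : p ^ 3 * C1 * (1 / (4 * (p ^ 3 * C1 + 1)) * R ^ p) ≤ 1 / 4 * R ^ p := by
      rw [← mul_assoc]
      refine mul_le_mul_of_nonneg_right ?_ hRp
      rw [mul_one_div, div_le_div_iff₀ (by positivity) (by norm_num)]
      linarith
    linarith
  have z3 := mul_le_mul_of_nonneg_left htay (by positivity : 0 ≤ p * C1)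
  have z4 : (p - 1) * R ^ p ≥ 1 * R ^ p := mul_le_mul_of_nonneg_right (by linarith) hRp
  nlinarith

end Pathwise

/-! ### The optimal Burkholder-Davis-Gundy constant -/

section BDG

theorem ofReal_ne_zero_of_two_le {m : ℝ} (hm : 2 ≤ m) : ENNReal.ofReal m ≠ 0 :=
  (ENNReal.ofReal_pos.2 (by linarith)).ne'

theorem one_le_ofReal_of_two_le {m : ℝ} (hm : 2 ≤ m) : 1 ≤ ENNReal.ofReal m := by
  rw [← ENNReal.ofReal_one]; exact ENNReal.ofReal_le_ofReal (by linarith)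

theorem stronglyMeasurable_runMax {Ω V : Type*} [MeasurableSpace Ω] [NormedAddCommGroup V]
    {S : ℕ → Ω → V} {n : ℕ} (h : ∀ k ≤ n, StronglyMeasurable (S k)) :
    StronglyMeasurable (fun ω => runMax (fun k => S k ω) n) := by
  induction n with
  | zero => exact (h 0 le_rfl).norm
  | succ n ih =>
    exact (ih fun k hk => h k (hk.trans n.le_succ)).sup (h (n + 1) le_rfl).norm

theorem stronglyMeasurable_bdgIntegrand {Ω V : Type*} [MeasurableSpace Ω] [NormedAddCommGroup V]
    [InnerProductSpace ℝ V] {p a b : ℝ}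
    {S : ℕ → Ω → V} {n : ℕ} (h : ∀ k ≤ n, StronglyMeasurable (S k)) :
    StronglyMeasurable (fun ω => bdgIntegrand p a b (fun k => S k ω) n) := by
  have h1 := (stronglyMeasurable_runMax h).measurable
  have h2 := (h n le_rfl).norm.measurable
  exact (((h2.pow_const _).const_mul a).sub
    (((h1.pow_const _).mul h2.inv).const_mul b)).stronglyMeasurable.smul (h n le_rfl)

variable {Ω : Type*} {mΩ : MeasurableSpace Ω} {P : Measure Ω}
  {V : Type*} [NormedAddCommGroup V]

theorem eLpNorm_norm_sq {m : ℝ} (f : Ω → V) :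
    eLpNorm (fun ω => ‖f ω‖ ^ 2) (ENNReal.ofReal (m / 2)) P =
      eLpNorm f (ENNReal.ofReal m) P ^ 2 := by
  have h := eLpNorm_norm_rpow (p := ENNReal.ofReal (m / 2)) (μ := P) f (q := 2) two_pos
  rw [← ENNReal.ofReal_mul' (by norm_num), div_mul_cancel₀ _ (by norm_num)] at h
  simpa using h

theorem memLp_norm_sq {m : ℝ} {f : Ω → V} (hf : MemLp f (ENNReal.ofReal m) P) :
    MemLp (fun ω => ‖f ω‖ ^ 2) (ENNReal.ofReal (m / 2)) P := by
  refine ⟨hf.1.norm.pow 2, ?_⟩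
  rw [eLpNorm_norm_sq]
  exact ENNReal.pow_lt_top hf.2

variable [IsProbabilityMeasure P]

theorem integral_inner_eq_zero_of_condExp_eq_zero [InnerProductSpace ℝ V] [CompleteSpace V]
    {𝓗 : MeasurableSpace Ω} (h𝓗 : 𝓗 ≤ mΩ) {H X : Ω → V} (hH : StronglyMeasurable[𝓗] H)
    (hX : Integrable X P) (hHX : Integrable (fun ω => inner ℝ (H ω) (X ω)) P)
    (h0 : P[X | 𝓗] =ᵐ[P] 0) : ∫ ω, inner ℝ (H ω) (X ω) ∂P = 0 := by
  have h : P[fun ω => inner ℝ (H ω) (X ω) | 𝓗] =ᵐ[P] fun ω => inner ℝ (H ω) (P[X | 𝓗] ω) :=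
    condExp_bilin_of_stronglyMeasurable_left (innerSL ℝ (E := V)) hH hHX hX
  rw [← integral_condExp h𝓗, integral_congr_ae h, integral_eq_zero_of_ae]
  filter_upwards [h0] with ω hω
  simp [hω]

theorem runMax_partialSum_le (x : ℕ → V) {n N : ℕ} (h : n ≤ N) :
    runMax (fun n => ∑ i ∈ Finset.range n, x i) n ≤ ∑ i ∈ Finset.range N, ‖x i‖ := by
  have key : ∀ n ≤ N, ‖∑ i ∈ Finset.range n, x i‖ ≤ ∑ i ∈ Finset.range N, ‖x i‖ := fun n hn =>
    (norm_sum_le _ _).trans (Finset.sum_le_sum_of_subset_of_nonneg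
      (Finset.range_subset_range.2 hn) fun _ _ _ => norm_nonneg _)
  induction n with
  | zero => exact key 0 h
  | succ n ih => exact max_le (ih (by omega)) (key _ h)

/-- Integration of `bdg_pathwise`. The integrand at `i` depends only on `X 0, …, X (i - 1)`, so its
products with `X i` have zero mean; they are integrable, being dominated by a multiple of `(∑ ‖X i‖)
^ m`. -/
theorem exists_isBDGConstant {m : ℝ} (hm : 2 ≤ m) (d : ℕ) : ∃ K, IsBDGConstant.{u} m d K := by
  obtain ⟨C, a, b, hC, ha, hb, hpath⟩ := bdg_pathwise (V := EuclideanSpace ℝ (Fin d)) hm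
  refine ⟨C ^ (1 / m), by positivity, fun Ω mΩ P _ 𝓖 X hX hXm h0 N => ?_⟩
  have hp0 := ofReal_ne_zero_of_two_le hm
  have hpt : ENNReal.ofReal m ≠ ∞ := ENNReal.ofReal_ne_top
  have hm0 : 0 < m := by linarith
  have hq0 : ENNReal.ofReal (m / 2) ≠ 0 := (ENNReal.ofReal_pos.2 (by linarith)).ne'
  set S : ℕ → Ω → EuclideanSpace ℝ (Fin d) := fun n ω => ∑ i ∈ Finset.range n, X i ω with hS
  set Q : Ω → ℝ := fun ω => ∑ n ∈ Finset.range N, ‖X n ω‖ ^ 2 with hQ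
  have hQ0 : ∀ ω, 0 ≤ Q ω := fun ω => Finset.sum_nonneg fun _ _ => by positivity
  have hQm : MemLp Q (ENNReal.ofReal (m / 2)) P :=
    memLp_finsetSum _ fun n _ => memLp_norm_sq (hXm n)
  have hSm : MemLp (S N) (ENNReal.ofReal m) P := memLp_finsetSum _ fun n _ => hXm n
  set B : Ω → ℝ := fun ω => ∑ i ∈ Finset.range N, ‖X i ω‖ with hB
  have hB0 : ∀ ω, 0 ≤ B ω := fun ω => Finset.sum_nonneg fun _ _ => norm_nonneg _
  have hBm : MemLp B (ENNReal.ofReal m) P := memLp_finsetSum _ fun n _ => (hXm n).norm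
  have hBi : Integrable (fun ω => B ω ^ m) P := by
    have := (integrable_norm_rpow_iff hBm.1 hp0 hpt).2 hBm
    rw [ENNReal.toReal_ofReal hm0.le] at this
    exact this.congr (ae_of_all _ fun ω => by simp only [Real.norm_of_nonneg (hB0 ω)])
  have hQi : Integrable (fun ω => Q ω ^ (m / 2)) P := by
    have := (integrable_norm_rpow_iff hQm.1 hq0 ENNReal.ofReal_ne_top).2 hQm
    rw [ENNReal.toReal_ofReal (by positivity)] at this
    exact this.congr (ae_of_all _ fun ω => by simp only [Real.norm_of_nonneg (hQ0 ω)])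
  have hSi : Integrable (fun ω => ‖S N ω‖ ^ m) P := by
    have := (integrable_norm_rpow_iff hSm.1 hp0 hpt).2 hSm
    rwa [ENNReal.toReal_ofReal hm0.le] at this
  have hSmeas : ∀ n k, k ≤ n + 1 → StronglyMeasurable[𝓖 n] (S k) := fun n k hk =>
    Finset.stronglyMeasurable_fun_sum _ fun i hi =>
      (hX i).mono (𝓖.mono (by have := Finset.mem_range.1 hi; omega))
  set I : ℕ → Ω → ℝ := fun i ω => inner ℝ (bdgIntegrand m a b (fun n => S n ω) i) (X i ω) with hI
  have hImeas : ∀ i, StronglyMeasurable (fun ω => bdgIntegrand m a b (fun n => S n ω) i) :=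
    fun i => stronglyMeasurable_bdgIntegrand fun k hk =>
      (hSmeas i k (by omega)).mono (𝓖.le i)
  have hIi : ∀ i ∈ Finset.range N, Integrable (I i) P := fun i hi => by
    refine (hBi.const_mul (a + b)).mono'
      ((hImeas i).aestronglyMeasurable.inner (hXm i).1) (ae_of_all _ fun ω => ?_)
    have h1 := norm_bdgIntegrand_le hm ha hb (fun n => S n ω) i
    have h2 : runMax (fun n => S n ω) i ≤ B ω :=
      runMax_partialSum_le (fun i => X i ω) (Finset.mem_range.1 hi).le
    have h3 : ‖X i ω‖ ≤ B ω :=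
      Finset.single_le_sum (f := fun i => ‖X i ω‖) (fun _ _ => norm_nonneg _) hi
    have h4 : runMax (fun n => S n ω) i ^ (m - 1) ≤ B ω ^ (m - 1) :=
      Real.rpow_le_rpow (runMax_nonneg _ _) h2 (by linarith)
    calc ‖I i ω‖ ≤ ‖bdgIntegrand m a b (fun n => S n ω) i‖ * ‖X i ω‖ := norm_inner_le_norm _ _
      _ ≤ ((a + b) * B ω ^ (m - 1)) * B ω := by
          refine mul_le_mul (h1.trans ?_) h3 (norm_nonneg _)
            (mul_nonneg (by positivity) (Real.rpow_nonneg (hB0 ω) _))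
          gcongr
      _ = (a + b) * B ω ^ m := by
          rw [mul_assoc, ← Real.rpow_add_one' (hB0 ω) (by linarith), sub_add_cancel]
  have hI0 : ∀ i ∈ Finset.range N, ∫ ω, I i ω ∂P = 0 := fun i hi => by
    cases i with
    -- The empty partial sum makes the first integrand vanish, which is why `X 0` need not be
    -- centred.
    | zero => simp [hI, bdgIntegrand, hS]
    | succ i =>
      refine integral_inner_eq_zero_of_condExp_eq_zero (𝓖.le i) ?_
        ((hXm (i + 1)).integrable (one_le_ofReal_of_two_le hm)) (hIi _ hi) (h0 i)
      exact @stronglyMeasurable_bdgIntegrand _ _ (𝓖 i) _ _ _ _ _ _ _ (hSmeas i)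
  have hmain : ∫ ω, ‖S N ω‖ ^ m ∂P ≤ C * ∫ ω, Q ω ^ (m / 2) ∂P := by
    calc ∫ ω, ‖S N ω‖ ^ m ∂P
        ≤ ∫ ω, (C * Q ω ^ (m / 2) + ∑ i ∈ Finset.range N, I i ω) ∂P := by
          refine integral_mono hSi ((hQi.const_mul C).add (integrable_finsetSum _ hIi))
            fun ω => ?_
          exact (Real.rpow_le_rpow (norm_nonneg _)
            (norm_le_runMax (fun n => S n ω) N) hm0.le).trans (hpath (fun i => X i ω) N)
      _ = C * ∫ ω, Q ω ^ (m / 2) ∂P := by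
          rw [integral_add (hQi.const_mul C) (integrable_finsetSum _ hIi),
            integral_finsetSum _ hIi, Finset.sum_eq_zero hI0, add_zero, integral_const_mul]
  change eLpNorm (S N) _ P ≤ _
  rw [← ofReal_lpNorm hSm, ← ofReal_lpNorm hQm,
    ENNReal.ofReal_rpow_of_nonneg lpNorm_nonneg (by norm_num), ← ENNReal.ofReal_mul (by positivity)]
  refine ENNReal.ofReal_le_ofReal ?_
  rw [lpNorm_eq_integral_norm_rpow_toReal hp0 hpt hSm.1,
    lpNorm_eq_integral_norm_rpow_toReal hq0 ENNReal.ofReal_ne_top hQm.1,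
    ENNReal.toReal_ofReal hm0.le, ENNReal.toReal_ofReal (by positivity)]
  simp only [Real.norm_of_nonneg (hQ0 _)]
  have hQint : 0 ≤ ∫ ω, Q ω ^ (m / 2) ∂P :=
    integral_nonneg fun ω => Real.rpow_nonneg (hQ0 ω) _
  rw [← Real.rpow_mul hQint, show (m / 2)⁻¹ * (1 / 2) = 1 / m by field_simp,
    ← Real.mul_rpow hC hQint, ← one_div]
  exact Real.rpow_le_rpow (integral_nonneg fun ω => by positivity) hmain (by positivity)

/-- The infimum is attained: the square function has finite norm, so the inequality passes to the
limit along a minimizing sequence of constants. -/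
theorem isBDGConstant_bdgConst {m : ℝ} (hm : 2 ≤ m) (d : ℕ) :
    IsBDGConstant.{u} m d (bdgConst.{u} m d) := by
  refine ⟨bdgConst_nonneg m d, fun Ω mΩ P hP 𝓖 X hX hXm h0 N => ?_⟩
  obtain ⟨v, -, hv, hvm⟩ := exists_seq_tendsto_sInf (S := {K : ℝ | IsBDGConstant.{u} m d K})
    (exists_isBDGConstant hm d) ⟨0, fun K hK => hK.1⟩
  have hQm : MemLp (fun ω => ∑ n ∈ Finset.range N, ‖X n ω‖ ^ 2) (ENNReal.ofReal (m / 2)) P :=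
    memLp_finsetSum _ fun n _ => memLp_norm_sq (hXm n)
  refine ge_of_tendsto' (ENNReal.Tendsto.mul_const (ENNReal.tendsto_ofReal hv) (Or.inr ?_))
    fun n => (hvm n).2 Ω mΩ P hP 𝓖 X hX hXm h0 N
  exact ENNReal.rpow_ne_top_of_nonneg (by norm_num) hQm.2.ne

/-- Tested on one deterministic unit vector. This allows a factor `κ` in front of terms that are
estimated without martingales. -/
theorem one_le_bdgConst {m : ℝ} (hm : 2 ≤ m) {d : ℕ} (hd : d ≠ 0) {Ω : Type u}
    {mΩ : MeasurableSpace Ω} (P : Measure Ω) [IsProbabilityMeasure P] :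
    1 ≤ bdgConst.{u} m d := by
  have : Nonempty (Fin d) := ⟨⟨0, Nat.pos_of_ne_zero hd⟩⟩
  obtain ⟨e, he⟩ := exists_norm_eq (EuclideanSpace ℝ (Fin d)) zero_le_one
  have h := (isBDGConstant_bdgConst hm d).2 Ω mΩ P inferInstance
    (Filtration.const ℕ mΩ le_rfl) (fun n _ => if n = 0 then e else 0)
    (fun n => stronglyMeasurable_const) (fun n => memLp_const _)
    (fun n => by simp only [Nat.add_eq_zero_iff, one_ne_zero, and_false, if_false]; exact (condExp_zero (E := EuclideanSpace ℝ (Fin d))).eventuallyEq) 1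
  have hP : P ≠ 0 := IsProbabilityMeasure.ne_zero P
  have he' : ‖e‖ₑ = 1 := by rw [← ofReal_norm, he, ENNReal.ofReal_one]
  have hq0 : ENNReal.ofReal (m / 2) ≠ 0 := (ENNReal.ofReal_pos.2 (by linarith)).ne'
  simp only [Finset.range_one, Finset.sum_singleton, if_true] at h
  rw [eLpNorm_const _ (ofReal_ne_zero_of_two_le hm) hP, eLpNorm_const _ hq0 hP, he', he] at h
  simpa using h

end BDG

/-! ### Sums of variables with decaying conditional expectations -/

section LpBound

/-- `‖f‖_{L_m} ≤ a`, for a measurable function `f` and a nonnegative real number `a`. -/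
structure LpBound {Ω V : Type*} {mΩ : MeasurableSpace Ω} [NormedAddCommGroup V] (P : Measure Ω)
    (m : ℝ) (f : Ω → V) (a : ℝ) : Prop where
  aestronglyMeasurable : AEStronglyMeasurable f P
  nonneg : 0 ≤ a
  le : eLpNorm f (ENNReal.ofReal m) P ≤ ENNReal.ofReal a

namespace LpBound

variable {Ω V : Type*} {mΩ : MeasurableSpace Ω} [NormedAddCommGroup V] {P : Measure Ω} {m : ℝ}
  {f g : Ω → V} {a b : ℝ}

theorem memLp (h : LpBound P m f a) : MemLp f (ENNReal.ofReal m) P :=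
  ⟨h.1, h.3.trans_lt ENNReal.ofReal_lt_top⟩

theorem mono (h : LpBound P m f a) (hab : a ≤ b) : LpBound P m f b :=
  ⟨h.1, h.2.trans hab, h.3.trans (ENNReal.ofReal_le_ofReal hab)⟩

theorem congr (h : LpBound P m f a) (hfg : f =ᵐ[P] g) : LpBound P m g a :=
  ⟨h.1.congr hfg, h.2, (eLpNorm_congr_ae hfg).symm.le.trans h.3⟩

theorem of_ae_eq_zero (h : f =ᵐ[P] 0) (ha : 0 ≤ a) : LpBound P m f a :=
  LpBound.congr (f := 0) ⟨aestronglyMeasurable_zero, ha, by simp⟩ h.symm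

theorem add (hm : 2 ≤ m) (hf : LpBound P m f a) (hg : LpBound P m g b) :
    LpBound P m (fun ω => f ω + g ω) (a + b) := by
  refine ⟨hf.1.add hg.1, add_nonneg hf.2 hg.2, ?_⟩
  rw [ENNReal.ofReal_add hf.2 hg.2]
  exact (eLpNorm_add_le hf.1 hg.1 (one_le_ofReal_of_two_le hm)).trans (add_le_add hf.3 hg.3)

theorem neg (hf : LpBound P m f a) : LpBound P m (fun ω => -f ω) a :=
  ⟨hf.1.neg, hf.2, (eLpNorm_neg f _ P).le.trans hf.3⟩

theorem sub (hm : 2 ≤ m) (hf : LpBound P m f a) (hg : LpBound P m g b) :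
    LpBound P m (fun ω => f ω - g ω) (a + b) := by
  simp only [sub_eq_add_neg]; exact hf.add hm hg.neg

theorem sum (hm : 2 ≤ m) {ι : Type*} {s : Finset ι} {F : ι → Ω → V} {c : ι → ℝ}
    (h : ∀ i ∈ s, LpBound P m (F i) (c i)) :
    LpBound P m (fun ω => ∑ i ∈ s, F i ω) (∑ i ∈ s, c i) := by
  classical
  induction s using Finset.induction_on with
  | empty => simpa using of_ae_eq_zero (P := P) (m := m) (f := fun _ => (0 : V)) (by rfl) le_rfl
  | insert i s hi ih =>
    simp only [Finset.sum_insert hi]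
    exact (h i (by simp)).add hm (ih fun j hj => h j (by simp [hj]))

theorem condExp (hm : 2 ≤ m) [NormedSpace ℝ V] [CompleteSpace V] {𝓗 : MeasurableSpace Ω}
    (h : LpBound P m f a) : LpBound P m (P[f | 𝓗]) a :=
  ⟨integrable_condExp.1, h.2,
    (eLpNorm_condExp_le_eLpNorm f (one_le_ofReal_of_two_le hm)).trans h.3⟩

end LpBound

/-- The filtration `i ↦ 𝓖 (f i)`. -/
def reindexFiltration {Ω ι ι' : Type*} [Preorder ι] [Preorder ι'] {mΩ : MeasurableSpace Ω}
    (𝓖 : Filtration ι mΩ) (f : ι' → ι) (hf : Monotone f) : Filtration ι' mΩ where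
  seq i := 𝓖 (f i)
  mono' _ _ h := 𝓖.mono (hf h)
  le' _ := 𝓖.le _

variable {Ω : Type u} {mΩ : MeasurableSpace Ω} {P : Measure Ω} [IsProbabilityMeasure P]
  {m : ℝ} {d : ℕ} {κ : ℝ}

/-- The summands are martingale differences for the filtration shifted by one. After
Burkholder-Davis-Gundy, Minkowski's inequality in `L_{m/2}`, available since `m ≥ 2`, gives the sum
of squares. The factor 2 comes from estimating both conditional expectations by contractivity. -/
theorem lpBound_sum_condExp_sub (hm : 2 ≤ m) (hκ : IsBDGConstant.{u} m d κ) (𝓖 : Filtration ℕ mΩ)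
    {U : ℕ → Ω → EuclideanSpace ℝ (Fin d)} {v : ℕ → ℝ} (hU : ∀ j, LpBound P m (U j) (v j))
    (N : ℕ) :
    LpBound P m (fun ω => ∑ j ∈ Finset.range N, (P[U j | 𝓖 (j + 1)] ω - P[U j | 𝓖 j] ω))
      (2 * κ * √(∑ j ∈ Finset.range N, v j ^ 2)) := by
  set D : ℕ → Ω → EuclideanSpace ℝ (Fin d) := fun j ω => P[U j | 𝓖 (j + 1)] ω - P[U j | 𝓖 j] ω
    with hD
  have hDb : ∀ j, LpBound P m (D j) (2 * v j) := fun j =>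
    (((hU j).condExp hm).sub hm ((hU j).condExp hm)).mono (by linarith)
  have hbdg := hκ.2 Ω mΩ P inferInstance
    (reindexFiltration 𝓖 (fun j => j + 1) fun _ _ h => Nat.add_le_add_right h 1) D
    (fun j => stronglyMeasurable_condExp.sub
      (stronglyMeasurable_condExp.mono (𝓖.mono j.le_succ)))
    (fun j => (hDb j).memLp) (fun j => by
      have hi := (hU (j + 1)).memLp.integrable (one_le_ofReal_of_two_le hm)
      change P[P[U (j + 1) | 𝓖 (j + 1 + 1)] - P[U (j + 1) | 𝓖 (j + 1)] | 𝓖 (j + 1)] =ᵐ[P] 0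
      filter_upwards [condExp_sub (m := 𝓖 (j + 1)) (integrable_condExp (μ := P) (f := U (j + 1))
          (m := 𝓖 (j + 1 + 1))) (integrable_condExp (μ := P) (f := U (j + 1)) (m := 𝓖 (j + 1))),
        condExp_condExp_of_le (μ := P) (f := U (j + 1)) (𝓖.mono (j + 1).le_succ)
          (𝓖.le (j + 1 + 1)),
        condExp_condExp_of_le (μ := P) (f := U (j + 1)) (le_refl (𝓖 (j + 1))) (𝓖.le (j + 1))]
        with ω h1 h2 h3
      rw [h1, Pi.sub_apply, h2, h3, sub_self, Pi.zero_apply]) N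
  refine ⟨(memLp_finsetSum _ fun j _ => (hDb j).memLp).1,
    mul_nonneg (mul_nonneg two_pos.le hκ.1) (Real.sqrt_nonneg _), hbdg.trans ?_⟩
  have hsq : eLpNorm (fun ω => ∑ n ∈ Finset.range N, ‖D n ω‖ ^ 2) (ENNReal.ofReal (m / 2)) P ≤
      ENNReal.ofReal (∑ j ∈ Finset.range N, (2 * v j) ^ 2) := by
    have h1 : (1 : ℝ≥0∞) ≤ ENNReal.ofReal (m / 2) := by
      rw [← ENNReal.ofReal_one]; exact ENNReal.ofReal_le_ofReal (by linarith)
    have h2 := eLpNorm_sum_le (s := Finset.range N) (f := fun n ω => ‖D n ω‖ ^ 2)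
      (fun n _ => (memLp_norm_sq (hDb n).memLp).1) h1
    have e : (∑ n ∈ Finset.range N, fun ω => ‖D n ω‖ ^ 2) =
        fun ω => ∑ n ∈ Finset.range N, ‖D n ω‖ ^ 2 := by ext ω; simp
    rw [e] at h2
    refine h2.trans ?_
    rw [ENNReal.ofReal_sum_of_nonneg fun _ _ => by positivity]
    refine Finset.sum_le_sum fun n _ => ?_
    rw [eLpNorm_norm_sq, ENNReal.ofReal_pow (hDb n).2]
    exact pow_le_pow_left' (hDb n).3 2
  calc _ ≤ ENNReal.ofReal κ * ENNReal.ofReal (∑ j ∈ Finset.range N, (2 * v j) ^ 2) ^ (1 / 2 : ℝ) := by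
        gcongr
    _ = ENNReal.ofReal (2 * κ * √(∑ j ∈ Finset.range N, v j ^ 2)) := by
        rw [ENNReal.ofReal_rpow_of_nonneg (Finset.sum_nonneg fun _ _ => by positivity)
          (by norm_num), ← ENNReal.ofReal_mul hκ.1, ← Real.sqrt_eq_rpow]
        congr 1
        have : ∑ j ∈ Finset.range N, (2 * v j) ^ 2 = 2 ^ 2 * ∑ j ∈ Finset.range N, v j ^ 2 := by
          rw [Finset.mul_sum]; exact Finset.sum_congr rfl fun _ _ => by ring
        rw [this, Real.sqrt_mul (by positivity), Real.sqrt_sq two_pos.le]; ring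

/-- A bound for `(∑_{i < 2^K} (i + 1)^{-2γ})^{1/2}`. -/
noncomputable def blockWeight (γ : ℝ) (K : ℕ) : ℝ := ((2 : ℝ) ^ (1 / 2 - γ)) ^ K / √(1 - 2 * γ)

theorem blockWeight_nonneg (γ : ℝ) (K : ℕ) : 0 ≤ blockWeight γ K := by
  unfold blockWeight; positivity

/-- Telescoping of `(1 - c)(n+1)^(-c) ≤ (n+1)^(1-c) - n^(1-c)`, which is Bernoulli's inequality for
the concave power `1 - c`. -/
theorem sum_rpow_neg_le {c : ℝ} (hc0 : 0 ≤ c) (hc : c < 1) (N : ℕ) :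
    ∑ i ∈ Finset.range N, ((i : ℝ) + 1) ^ (-c) ≤ (N : ℝ) ^ (1 - c) / (1 - c) := by
  have hc1 : 0 < 1 - c := by linarith
  induction N with
  | zero => simp [Real.zero_rpow hc1.ne']
  | succ n ih =>
    rw [Finset.sum_range_succ]
    have hn : (0 : ℝ) < n + 1 := by positivity
    have h := rpow_one_add_le_one_add_mul_self (s := -1 / ((n : ℝ) + 1)) (p := 1 - c)
      (by rw [le_div_iff₀ hn]; linarith [(Nat.cast_nonneg n : (0 : ℝ) ≤ n)]) hc1.le (by linarith)
    have e : 1 + -1 / ((n : ℝ) + 1) = n / (n + 1) := by field_simp; ring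
    rw [e, Real.div_rpow (by positivity) hn.le, div_le_iff₀ (by positivity)] at h
    have e2 : ((n : ℝ) + 1) ^ (1 - c) = (n + 1) * (n + 1) ^ (-c) := by
      rw [sub_eq_add_neg, Real.rpow_add hn, Real.rpow_one]
    have e3 : (1 + (1 - c) * (-1 / ((n : ℝ) + 1))) * ((n : ℝ) + 1) ^ (1 - c) =
        (n + 1) ^ (1 - c) - (1 - c) * (n + 1) ^ (-c) := by
      rw [e2]; field_simp; ring
    rw [e3] at h
    rw [le_div_iff₀ hc1] at ih ⊢
    push_cast
    nlinarith

theorem sqrt_sum_le_blockWeight {γ : ℝ} (hγ0 : 0 ≤ γ) (hγ : γ < 1 / 2) {N K : ℕ} (hN : N ≤ 2 ^ K) :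
    √(∑ i ∈ Finset.range N, (((i : ℝ) + 1) ^ (-γ)) ^ 2) ≤ blockWeight γ K := by
  have h1 : 0 < 1 - 2 * γ := by linarith
  have e : ∀ i : ℕ, (((i : ℝ) + 1) ^ (-γ)) ^ 2 = ((i : ℝ) + 1) ^ (-(2 * γ)) := fun i => by
    rw [← Real.rpow_natCast, ← Real.rpow_mul (by positivity)]; congr 1; push_cast; ring
  simp only [e]
  rw [blockWeight, ← Real.rpow_natCast, ← Real.rpow_mul two_pos.le]
  refine Real.sqrt_le_iff.2 ⟨by positivity,
    (sum_rpow_neg_le (c := 2 * γ) (by linarith) (by linarith) N).trans ?_⟩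
  rw [div_pow, Real.sq_sqrt h1.le]
  gcongr
  rw [← Real.rpow_natCast, ← Real.rpow_mul two_pos.le]
  calc (N : ℝ) ^ (1 - 2 * γ) ≤ ((2 : ℝ) ^ (K : ℝ)) ^ (1 - 2 * γ) := by
        gcongr
        rw [Real.rpow_natCast]; exact_mod_cast hN
    _ = _ := by rw [← Real.rpow_mul two_pos.le]; congr 1; push_cast; ring

/-- The constants in `lpBound_sum_of_condExp_decay`. -/
noncomputable def blockGrowth (α γ : ℝ) : ℕ → ℝ
  | 0 => 0
  | K + 1 => 1 + 4 * blockWeight γ K + 2 ^ (1 - γ - α) * blockGrowth α γ K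

theorem blockGrowth_nonneg (α γ : ℝ) (K : ℕ) : 0 ≤ blockGrowth α γ K := by
  induction K with
  | zero => exact le_rfl
  | succ K ih =>
    have := blockWeight_nonneg γ K
    rw [blockGrowth]; positivity

theorem sum_range_two_mul_add_one {V : Type*} [AddCommMonoid V] (f : ℕ → V) (n : ℕ) :
    ∑ i ∈ Finset.range (2 * n + 1), f i =
      f 0 + ∑ i ∈ Finset.range n, (f (2 * i + 1) + f (2 * i + 2)) := by
  induction n with
  | zero => simp
  | succ n ih =>
    rw [show 2 * (n + 1) + 1 = 2 * n + 1 + 1 + 1 by ring, Finset.sum_range_succ,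
      Finset.sum_range_succ, ih, Finset.sum_range_succ]
    simp only [add_assoc]

/-- If conditional expectations of the `Y i` decay with the time lag, then the sum of the
(predictable) `Y i` is controlled at all dyadic scales by the Burkholder-Davis-Gundy inequality. -/
theorem lpBound_sum_of_condExp_decay (hm : 2 ≤ m) (hκ : IsBDGConstant.{u} m d κ) (hκ1 : 1 ≤ κ)
    {α γ : ℝ} (hα : 0 ≤ α) (hγ0 : 0 ≤ γ) (hγ : γ < 1 / 2) (K : ℕ) :
    ∀ (𝓖 : Filtration ℕ mΩ) (Y : ℕ → Ω → EuclideanSpace ℝ (Fin d)) (a : ℝ), 0 ≤ a →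
      (∀ i, StronglyMeasurable[𝓖 i] (Y i)) → (∀ i, MemLp (Y i) (ENNReal.ofReal m) P) →
      (∀ i p : ℕ, p ≤ i → LpBound P m (P[Y i | 𝓖 p])
        (a * ((i : ℝ) + 1) ^ (-γ) * ((i : ℝ) + 1 - p) ^ (-α))) →
      LpBound P m (fun ω => ∑ i ∈ Finset.range (2 ^ K - 1), Y i ω) (a * κ * blockGrowth α γ K) := by
  induction K with
  | zero =>
    intro 𝓖 Y a _ _ _ _
    refine LpBound.of_ae_eq_zero ?_ (by simp [blockGrowth])
    simp only [pow_zero, le_refl, tsub_eq_zero_of_le, Finset.range_zero, Finset.sum_empty]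
    rfl
  | succ K ih =>
    intro 𝓖 Y a ha hmeas hmem hY
    have hYi : ∀ i, Integrable (Y i) P := fun i =>
      (hmem i).integrable (one_le_ofReal_of_two_le hm)
    -- `Y 0` is set aside and the other terms are paired. Each pair `U i` is known at time `2(i +
    -- 1)`, so subtracting its conditional expectation `Y' i` at time `2i` leaves a martingale
    -- difference for `𝓖'`; the `Y' i` are predictable for `𝓖'` and enter the induction.
    set U : ℕ → Ω → EuclideanSpace ℝ (Fin d) := fun i => Y (2 * i + 1) + Y (2 * i + 2) with hU
    set Y' : ℕ → Ω → EuclideanSpace ℝ (Fin d) := fun i => P[U i | 𝓖 (2 * i)] with hY'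
    set 𝓖' : Filtration ℕ mΩ :=
      reindexFiltration 𝓖 (fun i => 2 * i) (fun i j h => by dsimp; omega) with h𝓖'
    have hYb : ∀ i : ℕ, LpBound P m (Y i) (a * ((i : ℝ) + 1) ^ (-γ)) := fun i => by
      have h := hY i i le_rfl
      rw [condExp_of_stronglyMeasurable (𝓖.le i) (hmeas i) (hYi i)] at h
      simpa using h
    have hlow : ∀ i k : ℕ, i ≤ k → a * ((k : ℝ) + 1) ^ (-γ) ≤ a * ((i : ℝ) + 1) ^ (-γ) :=
      fun i k hik => mul_le_mul_of_nonneg_left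
        (Real.rpow_le_rpow_of_nonpos (by positivity) (by exact_mod_cast Nat.succ_le_succ hik)
          (by linarith)) ha
    have hUb : ∀ i : ℕ, LpBound P m (U i) (2 * a * ((i : ℝ) + 1) ^ (-γ)) := fun i => by
      refine ((hYb (2 * i + 1)).add hm (hYb (2 * i + 2))).mono ?_
      linarith [hlow i (2 * i + 1) (by omega), hlow i (2 * i + 2) (by omega)]
    have hUi : ∀ i, Integrable (U i) P := fun i => (hYi _).add (hYi _)
    have hUmeas : ∀ i, StronglyMeasurable[𝓖 (2 * (i + 1))] (U i) := fun i =>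
      ((hmeas (2 * i + 1)).mono (𝓖.mono (by omega))).add (hmeas (2 * i + 2))
    -- The weights use `i + 1` rather than `i`, so that `2i + 2` and `2i + 2 - 2p` are exact
    -- doubles. Each of the two terms gains `2^(-γ) 2^(-α)`, whence the factor `2^(1-γ-α)`.
    have hrec := ih 𝓖' Y' (a * 2 ^ (1 - γ - α)) (by positivity)
      (fun i => stronglyMeasurable_condExp)
      (fun i => ((hUb i).condExp hm).memLp) (fun i p hp => by
        have hpi : (p : ℝ) ≤ i := by exact_mod_cast hp
        have h1 := hY (2 * i + 1) (2 * p) (by omega)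
        have h2 := hY (2 * i + 2) (2 * p) (by omega)
        refine ((h1.add hm h2).congr ?_).mono ?_
        · filter_upwards [condExp_add (m := 𝓖 (2 * p)) (hYi (2 * i + 1)) (hYi (2 * i + 2)),
            condExp_condExp_of_le (μ := P) (f := U i) (𝓖.mono (by omega : 2 * p ≤ 2 * i))
              (𝓖.le (2 * i))] with ω h3 h4
          exact h3.symm.trans h4.symm
        · push_cast
          have b1 : (2 * (i : ℝ) + 1 + 1) ^ (-γ) = 2 ^ (-γ) * ((i : ℝ) + 1) ^ (-γ) := by
            rw [← Real.mul_rpow two_pos.le (by positivity)]; congr 1; ring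
          have b2 : (2 * (i : ℝ) + 1 + 1 - 2 * p) ^ (-α) =
              2 ^ (-α) * ((i : ℝ) + 1 - p) ^ (-α) := by
            rw [← Real.mul_rpow two_pos.le (by linarith)]; congr 1; ring
          have b3 : (2 * (i : ℝ) + 2 + 1) ^ (-γ) ≤ (2 * (i : ℝ) + 1 + 1) ^ (-γ) :=
            Real.rpow_le_rpow_of_nonpos (by positivity) (by linarith) (by linarith)
          have b4 : (2 * (i : ℝ) + 2 + 1 - 2 * p) ^ (-α) ≤ (2 * (i : ℝ) + 1 + 1 - 2 * p) ^ (-α) :=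
            Real.rpow_le_rpow_of_nonpos (by linarith) (by linarith) (by linarith)
          have b5 : (2 : ℝ) ^ (1 - γ - α) = 2 * (2 ^ (-γ) * 2 ^ (-α)) := by
            rw [show 1 - γ - α = 1 + (-γ + -α) by ring, Real.rpow_add two_pos,
              Real.rpow_add two_pos, Real.rpow_one]
          have b6 : a * (2 * (i : ℝ) + 2 + 1) ^ (-γ) * (2 * (i : ℝ) + 2 + 1 - 2 * p) ^ (-α) ≤
              a * (2 * (i : ℝ) + 1 + 1) ^ (-γ) * (2 * (i : ℝ) + 1 + 1 - 2 * p) ^ (-α) := by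
            have : 0 ≤ (2 * (i : ℝ) + 2 + 1 - 2 * p) ^ (-α) := Real.rpow_nonneg (by linarith) _
            gcongr
          refine (add_le_add_right b6 _).trans (le_of_eq ?_)
          rw [b1, b2, b5]; ring)
    have hmart := lpBound_sum_condExp_sub hm hκ 𝓖' hUb (2 ^ K - 1)
    have hN : 2 ^ (K + 1) - 1 = 2 * (2 ^ K - 1) + 1 := by
      have := Nat.one_le_two_pow (n := K); rw [pow_succ]; omega
    have hfin := ((hYb 0).add hm hmart).add hm hrec
    refine (hfin.congr (ae_of_all _ fun ω => ?_)).mono ?_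
    · simp only [hN, sum_range_two_mul_add_one]
      rw [add_assoc, ← Finset.sum_add_distrib]
      congr 1
      refine Finset.sum_congr rfl fun i _ => ?_
      have : P[U i | 𝓖' (i + 1)] = U i :=
        condExp_of_stronglyMeasurable (𝓖'.le _) (hUmeas i) (hUi i)
      rw [this]
      change U i ω - Y' i ω + Y' i ω = U i ω
      abel
    · have hs : √(∑ j ∈ Finset.range (2 ^ K - 1), (2 * a * ((j : ℝ) + 1) ^ (-γ)) ^ 2) ≤
          2 * a * blockWeight γ K := by
        have e : ∑ j ∈ Finset.range (2 ^ K - 1), (2 * a * ((j : ℝ) + 1) ^ (-γ)) ^ 2 =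
            (2 * a) ^ 2 * ∑ j ∈ Finset.range (2 ^ K - 1), (((j : ℝ) + 1) ^ (-γ)) ^ 2 := by
          rw [Finset.mul_sum]; exact Finset.sum_congr rfl fun _ _ => by ring
        rw [e, Real.sqrt_mul (by positivity), Real.sqrt_sq (by positivity)]
        exact mul_le_mul_of_nonneg_left
          (sqrt_sum_le_blockWeight hγ0 hγ (Nat.sub_le _ _)) (by positivity)
      have h0 : (((0 : ℕ) : ℝ) + 1) ^ (-γ) = 1 := by simp
      rw [h0, blockGrowth]
      have h1 := mul_le_mul_of_nonneg_left hs (by positivity : 0 ≤ 2 * κ)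
      have h2 := mul_le_mul_of_nonneg_left hκ1 ha
      linarith

theorem sqrt_sum_add_sq_le (N : ℕ) {p q : ℕ → ℝ} :
    √(∑ i ∈ Finset.range N, (p i + q i) ^ 2) ≤
      √(∑ i ∈ Finset.range N, p i ^ 2) + √(∑ i ∈ Finset.range N, q i ^ 2) := by
  refine Real.sqrt_le_iff.2 ⟨by positivity, ?_⟩
  have h := Real.sum_mul_le_sqrt_mul_sqrt (Finset.range N) p q
  have hp : 0 ≤ ∑ i ∈ Finset.range N, p i ^ 2 := Finset.sum_nonneg fun _ _ => sq_nonneg _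
  have hq : 0 ≤ ∑ i ∈ Finset.range N, q i ^ 2 := Finset.sum_nonneg fun _ _ => sq_nonneg _
  have e : ∑ i ∈ Finset.range N, (p i + q i) ^ 2 = ∑ i ∈ Finset.range N, p i ^ 2
      + 2 * ∑ i ∈ Finset.range N, p i * q i + ∑ i ∈ Finset.range N, q i ^ 2 := by
    rw [Finset.mul_sum, ← Finset.sum_add_distrib, ← Finset.sum_add_distrib]
    exact Finset.sum_congr rfl fun _ _ => by ring
  rw [e, add_sq, Real.sq_sqrt hp, Real.sq_sqrt hq]
  linarith

/-- `Y i` may look three steps ahead. Conditioning on `𝓖 (i+2)`, `𝓖 (i+1)`, `𝓖 i` in turn splits off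
three martingale differences, each with the factor 2 of `lpBound_sum_condExp_sub`; this explains the
6. The last conditional expectation is predictable. -/
theorem lpBound_sum_of_condExp_decay_of_bound (hm : 2 ≤ m) (hκ : IsBDGConstant.{u} m d κ)
    (hκ1 : 1 ≤ κ) {α γ γ' a x y : ℝ} (hα : 0 ≤ α) (hγ0 : 0 ≤ γ) (hγ : γ < 1 / 2) (hγ'0 : 0 ≤ γ')
    (hγ' : γ' < 1 / 2) (ha : 0 ≤ a) (hx : 0 ≤ x) (hy : 0 ≤ y) (K : ℕ)
    (𝓖 : Filtration ℕ mΩ) (Y : ℕ → Ω → EuclideanSpace ℝ (Fin d))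
    (hmeas : ∀ i, StronglyMeasurable[𝓖 (i + 3)] (Y i))
    (hYb : ∀ i : ℕ, LpBound P m (Y i) (x * ((i : ℝ) + 1) ^ (-γ) + y * ((i : ℝ) + 1) ^ (-γ')))
    (hY : ∀ i p : ℕ, p ≤ i → LpBound P m (P[Y i | 𝓖 p])
        (a * ((i : ℝ) + 1) ^ (-γ) * ((i : ℝ) + 1 - p) ^ (-α))) :
    LpBound P m (fun ω => ∑ i ∈ Finset.range (2 ^ K - 1), Y i ω)
      (κ * (6 * (x * blockWeight γ K + y * blockWeight γ' K) + a * blockGrowth α γ K)) := by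
  have hYi : ∀ i, Integrable (Y i) P := fun i =>
    (hYb i).memLp.integrable (one_le_ofReal_of_two_le hm)
  have hs : √(∑ i ∈ Finset.range (2 ^ K - 1),
      (x * ((i : ℝ) + 1) ^ (-γ) + y * ((i : ℝ) + 1) ^ (-γ')) ^ 2) ≤
        x * blockWeight γ K + y * blockWeight γ' K := by
    refine (sqrt_sum_add_sq_le _).trans ?_
    simp only [mul_pow, ← Finset.mul_sum]
    rw [Real.sqrt_mul (by positivity), Real.sqrt_sq hx, Real.sqrt_mul (by positivity),
      Real.sqrt_sq hy]
    have h1 := sqrt_sum_le_blockWeight hγ0 hγ (Nat.sub_le (2 ^ K) 1)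
    have h2 := sqrt_sum_le_blockWeight hγ'0 hγ' (Nat.sub_le (2 ^ K) 1)
    gcongr
  have hmart := fun r : ℕ => (lpBound_sum_condExp_sub hm hκ
    (reindexFiltration 𝓖 (fun j => j + r) fun _ _ h => Nat.add_le_add_right h r) hYb
      (2 ^ K - 1)).mono (mul_le_mul_of_nonneg_left hs (by positivity))
  have hpred := lpBound_sum_of_condExp_decay hm hκ hκ1 hα hγ0 hγ K 𝓖 (fun i => P[Y i | 𝓖 i]) a
    ha (fun i => stronglyMeasurable_condExp) (fun i => ((hYb i).condExp hm).memLp)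
    (fun i p hp => (hY i p hp).congr
      (condExp_condExp_of_le (𝓖.mono hp) (𝓖.le i)).symm)
  refine (((((hmart 2).add hm (hmart 1)).add hm (hmart 0)).add hm hpred).congr
    (ae_of_all _ fun ω => ?_)).mono (le_of_eq (by ring))
  simp only [← Finset.sum_add_distrib]
  refine Finset.sum_congr rfl fun i _ => ?_
  have e3 : P[Y i | 𝓖 (i + 3)] = Y i :=
    condExp_of_stronglyMeasurable (𝓖.le _) (hmeas i) (hYi i)
  change P[Y i | 𝓖 (i + 1 + 2)] ω - P[Y i | 𝓖 (i + 2)] ω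
    + (P[Y i | 𝓖 (i + 1 + 1)] ω - P[Y i | 𝓖 (i + 1)] ω)
    + (P[Y i | 𝓖 (i + 1 + 0)] ω - P[Y i | 𝓖 (i + 0)] ω) + P[Y i | 𝓖 i] ω = Y i ω
  simp only [add_assoc, Nat.reduceAdd, e3, add_zero]
  abel

end LpBound

/-! ### The block estimate for families of cells -/

section Cells

theorem LpBound.sum_card_le {Ω V : Type*} {mΩ : MeasurableSpace Ω} [NormedAddCommGroup V]
    {P : Measure Ω} {m : ℝ} (hm : 2 ≤ m) {ι : Type*} {s : Finset ι} {F : ι → Ω → V} {a : ℝ} {B : ℕ}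
    (ha : 0 ≤ a) (hB : s.card ≤ B) (h : ∀ i ∈ s, LpBound P m (F i) a) :
    LpBound P m (fun ω => ∑ i ∈ s, F i ω) (B * a) := by
  refine (LpBound.sum hm h).mono ?_
  rw [Finset.sum_const, nsmul_eq_mul]
  gcongr

theorem condExp_finsetSum_fun {Ω : Type*} {mΩ : MeasurableSpace Ω} {P : Measure Ω} {ι V : Type*} [NormedAddCommGroup V] [NormedSpace ℝ V]
    [CompleteSpace V] {𝓗 : MeasurableSpace Ω} {s : Finset ι} {F : ι → Ω → V}
    (h : ∀ i ∈ s, Integrable (F i) P) :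
    (fun ω => ∑ i ∈ s, (P[F i | 𝓗]) ω) =ᵐ[P] P[fun ω => ∑ i ∈ s, F i ω | 𝓗] := by
  have h1 := condExp_finsetSum h 𝓗
  have e : (∑ i ∈ s, F i) = fun ω => ∑ i ∈ s, F i ω := by ext ω; simp
  rw [e] at h1
  filter_upwards [h1] with ω hω
  rw [hω, Finset.sum_apply]

variable {Ω : Type u} {mΩ : MeasurableSpace Ω} {P : Measure Ω} [IsProbabilityMeasure P]
  {m : ℝ} {d : ℕ} {κ : ℝ}

/-- A bound for sums of random variables associated with cells of width at most `h`, grouped into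
blocks of length `Λ h` such that each block contains the left endpoints of at most `B` cells. -/
theorem lpBound_sum_cells (hm : 2 ≤ m) (hκ : IsBDGConstant.{u} m d κ) (hκ1 : 1 ≤ κ)
    (𝓕 : Filtration ℝ mΩ) {M α γ γ' g x y z h c : ℝ} (hα : 0 ≤ α)
    (hγ0 : 0 ≤ γ) (hγ : γ < 1 / 2) (hγ'0 : 0 ≤ γ') (hγ' : γ' < 1 / 2) (hg : 0 ≤ g) (hx : 0 ≤ x)
    (hy : 0 ≤ y) (hz : 0 ≤ z) (hh : 0 < h) (hc : 0 ≤ c) {ι : Type*} (I : Finset ι) (l : ι → ℝ)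
    (blk : ι → ℕ) {Λ B K : ℕ} (hΛ : M ≤ Λ) (hΛ1 : 1 ≤ Λ) (Z : ι → Ω → EuclideanSpace ℝ (Fin d))
    (hmeas : ∀ i ∈ I, StronglyMeasurable[𝓕 (l i + h)] (Z i))
    (hblk : ∀ i ∈ I, c + blk i * (Λ * h) ≤ l i)
    (hblk' : ∀ i ∈ I, l i < c + (blk i + 1) * (Λ * h)) (hK : ∀ i ∈ I, blk i < 2 ^ K)
    (hcard : ∀ j, (I.filter fun i => blk i = j).card ≤ B)
    (hZ0 : ∀ i ∈ I, LpBound P m (Z i) z)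
    (hZ : ∀ i ∈ I, 0 < l i → LpBound P m (Z i) (x * l i ^ (-γ) + y * l i ^ (-γ')))
    (hcond : ∀ i ∈ I, ∀ v, 0 ≤ v → v < l i → M * h ≤ l i - v →
      LpBound P m (P[Z i | 𝓕 v]) (g * l i ^ (-γ) * (l i - v) ^ (-α))) :
    LpBound P m (fun ω => ∑ i ∈ I, Z i ω)
      (B * z + κ * (B * (6 * (x * h ^ (-γ) * blockWeight γ K + y * h ^ (-γ') * blockWeight γ' K)
        + g * h ^ (-γ) * h ^ (-α) * blockGrowth α γ K))) := by
  have hΛr : (1 : ℝ) ≤ Λ := by exact_mod_cast hΛ1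
  set lam : ℝ := Λ * h with hlam
  have hlamh : h ≤ lam := by nlinarith
  have hlam0 : 0 < lam := hh.trans_le hlamh
  set 𝓖 : Filtration ℕ mΩ := reindexFiltration 𝓕 (fun j : ℕ => c + j * lam)
    (fun i j hij => by
      have : (i : ℝ) ≤ j := by exact_mod_cast hij
      dsimp; gcongr) with h𝓖
  set Y : ℕ → Ω → EuclideanSpace ℝ (Fin d) :=
    fun j ω => ∑ i ∈ I.filter fun i => blk i = j, Z i ω with hY
  have hZi : ∀ i ∈ I, Integrable (Z i) P := fun i hi =>
    (hZ0 i hi).memLp.integrable (one_le_ofReal_of_two_le hm)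
  have hl : ∀ i ∈ I, ∀ j : ℕ, blk i = j + 1 → ((j : ℝ) + 1) * lam ≤ l i := fun i hi j hj => by
    have := hblk i hi
    rw [hj] at this
    push_cast at this
    linarith
  have hw : ∀ (j : ℕ) (t e : ℝ), 0 ≤ e → ((j : ℝ) + 1) * lam ≤ t →
      t ^ (-e) ≤ h ^ (-e) * ((j : ℝ) + 1) ^ (-e) := fun j t e he ht => by
    rw [← Real.mul_rpow hh.le (by positivity)]
    refine Real.rpow_le_rpow_of_nonpos (by positivity) (le_trans ?_ ht) (by linarith)
    rw [mul_comm]; gcongr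
  -- Block 0 is left out: it may touch the singularity and has no earlier block to condition on. The
  -- shift by one also keeps block `j + 1` a full block length away from the time of `𝓖 j`.
  have hmain : LpBound P m (fun ω => ∑ j ∈ Finset.range (2 ^ K - 1), Y (j + 1) ω) _ := lpBound_sum_of_condExp_decay_of_bound hm hκ hκ1 hα hγ0 hγ hγ'0 hγ'
    (a := B * (g * h ^ (-γ) * h ^ (-α))) (x := B * (x * h ^ (-γ))) (y := B * (y * h ^ (-γ')))
    (by positivity) (by positivity) (by positivity) K 𝓖 (fun j => Y (j + 1))
    -- Left endpoints in block `j + 1` lie before `c + (j + 2) lam`, and a cell extends by at most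
    -- `h ≤ lam`. Hence everything is known at the time of `𝓖 (j + 3)`.
    (fun j => Finset.stronglyMeasurable_fun_sum _ fun i hi => by
      obtain ⟨hiI, hij⟩ := Finset.mem_filter.1 hi
      refine (hmeas i hiI).mono (𝓕.mono ?_)
      have := hblk' i hiI
      rw [hij] at this
      push_cast at this ⊢
      linarith)
    (fun j => by
      have hpos : (0 : ℝ) < (j + 1) * lam := by positivity
      refine (LpBound.sum_card_le (P := P) hm (a := x * (h ^ (-γ) * ((j : ℝ) + 1) ^ (-γ))
        + y * (h ^ (-γ') * ((j : ℝ) + 1) ^ (-γ'))) (by positivity) (hcard (j + 1))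
        fun i hi => ?_).mono (le_of_eq (by ring))
      obtain ⟨hiI, hij⟩ := Finset.mem_filter.1 hi
      have hli := hl i hiI j hij
      refine (hZ i hiI (hpos.trans_le hli)).mono ?_
      have h1 := hw j (l i) γ hγ0 hli
      have h2 := hw j (l i) γ' hγ'0 hli
      gcongr)
    (fun j p hp => by
      have hpj : (p : ℝ) ≤ j := by exact_mod_cast hp
      have hpos : (0 : ℝ) < j + 1 - p := by linarith
      refine ((LpBound.sum_card_le hm (a := g * (h ^ (-γ) * ((j : ℝ) + 1) ^ (-γ)) *
        (h ^ (-α) * ((j : ℝ) + 1 - p) ^ (-α))) (by positivity) (hcard (j + 1))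
        fun i hi => ?_).congr (condExp_finsetSum_fun fun i hi =>
          hZi i (Finset.mem_filter.1 hi).1)).mono (le_of_eq (by ring))
      obtain ⟨hiI, hij⟩ := Finset.mem_filter.1 hi
      have hli := hl i hiI j hij
      have hb := hblk i hiI
      rw [hij] at hb
      push_cast at hb
      -- For `p ≤ j` the lag is at least `lam = Λ h ≥ M h`, as the conditional hypothesis demands.
      have hlag : ((j : ℝ) + 1 - p) * lam ≤ l i - (c + p * lam) := by linarith
      have hlag1 : lam ≤ ((j : ℝ) + 1 - p) * lam := by nlinarith
      refine (hcond i hiI (c + p * lam) (by positivity) (by linarith) ?_).mono ?_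
      · refine le_trans ?_ (hlag1.trans hlag)
        rw [hlam]; gcongr
      · have h1 := hw j (l i) γ hγ0 hli
        have h2 : (l i - (c + p * lam)) ^ (-α) ≤ h ^ (-α) * ((j : ℝ) + 1 - p) ^ (-α) := by
          rw [← Real.mul_rpow hh.le hpos.le]
          refine Real.rpow_le_rpow_of_nonpos (by positivity) (le_trans ?_ hlag) (by linarith)
          rw [mul_comm]; gcongr
        have h3 : 0 ≤ l i ^ (-γ) := Real.rpow_nonneg
          (le_trans (by positivity : (0 : ℝ) ≤ (j + 1) * lam) hli) _
        have h4 : 0 ≤ (l i - (c + p * lam)) ^ (-α) := Real.rpow_nonneg (by linarith) _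
        gcongr)
  have hY0 : LpBound P m (Y 0) (B * z) := LpBound.sum_card_le hm hz (hcard 0) fun i hi =>
    hZ0 i (Finset.mem_filter.1 hi).1
  refine ((hY0.add hm hmain).congr (ae_of_all _ fun ω => ?_)).mono (le_of_eq (by ring))
  rw [← Finset.sum_fiberwise_of_maps_to (s := I) (t := Finset.range (2 ^ K)) (g := blk)
    (fun i hi => Finset.mem_range.2 (hK i hi)) (fun i => Z i ω)]
  obtain ⟨n, hn⟩ := Nat.exists_eq_succ_of_ne_zero (by positivity : 2 ^ K ≠ 0)
  rw [hn, Finset.sum_range_succ', add_comm]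
  rfl

end Cells

/-! ### Summability over the dyadic levels -/

section Constants

/-- Summing the recursion bounds a partial sum by `a 0 + ∑ s` plus `q` times itself, and `q < 1`. -/
theorem summable_of_succ_eq_add_mul {a s : ℕ → ℝ} {q : ℝ} (ha : ∀ n, 0 ≤ a n) (hs : ∀ n, 0 ≤ s n)
    (hss : Summable s) (hq : q < 1) (hq0 : 0 ≤ q) (h : ∀ n, a (n + 1) = s n + q * a n) :
    Summable a := by
  refine summable_of_sum_range_le (c := (a 0 + ∑' n, s n) / (1 - q)) ha fun n => ?_
  rw [le_div_iff₀ (by linarith)]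
  have h1 : ∑ i ∈ Finset.range n, a i ≤ a 0 + ∑' n, s n + q * ∑ i ∈ Finset.range n, a i := by
    cases n with
    | zero =>
      have : 0 ≤ ∑' n, s n := tsum_nonneg hs
      simpa using add_nonneg (ha 0) this
    | succ n =>
      have h2 : ∑ i ∈ Finset.range n, s i ≤ ∑' n, s n := hss.sum_le_tsum _ fun i _ => hs i
      have h3 : ∑ i ∈ Finset.range n, a i ≤ ∑ i ∈ Finset.range (n + 1), a i := by
        rw [Finset.sum_range_succ]; linarith [ha n]
      have h4 := mul_le_mul_of_nonneg_left h3 hq0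
      rw [Finset.sum_range_succ' a]
      rw [Finset.sum_range_succ' a] at h4
      simp only [h, Finset.sum_add_distrib, ← Finset.mul_sum] at h4 ⊢
      linarith
  linarith

theorem summable_shift {r : ℝ} (hr : 0 < r) {F : ℕ → ℝ} (h : Summable fun n => r ^ n * F n) (k : ℕ) :
    Summable fun n => r ^ n * F (n + k) := by
  have h1 := ((summable_nat_add_iff k).2 h).mul_left ((r ^ k)⁻¹)
  refine h1.congr fun n => ?_
  rw [pow_add]; field_simp

theorem two_rpow_neg_lt_one {e : ℝ} (he : 0 < e) : (2 : ℝ) ^ (-e) < 1 :=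
  Real.rpow_lt_one_of_one_lt_of_neg one_lt_two (by linarith)

/-- The exponent `γ` cancels and a geometric series of ratio `2^(-(β - 1/2))` remains. -/
theorem summable_blockWeight {β γ : ℝ} (hβ : 1 / 2 < β) :
    Summable fun n => ((2 : ℝ) ^ (-(β - γ))) ^ n * blockWeight γ n := by
  have : (2 : ℝ) ^ (-(β - 1 / 2)) < 1 := two_rpow_neg_lt_one (by linarith)
  refine ((summable_geometric_of_lt_one (by positivity) this).mul_right
    (√(1 - 2 * γ))⁻¹).congr fun n => ?_
  rw [blockWeight, ← mul_div_assoc, ← mul_pow, ← Real.rpow_add two_pos, div_eq_mul_inv]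
  congr 3; ring

/-- After scaling, the recursion of `blockGrowth` has the factor `2^(-(β - 1))`, and its forcing is
summable by `summable_blockWeight` with `β - α` in place of `β`. -/
theorem summable_blockGrowth {α β γ : ℝ} (hβ : 1 < β) (hαβ : 1 / 2 < β - α) (hγ : γ < 1 / 2) :
    Summable fun n => ((2 : ℝ) ^ (-(β - α - γ))) ^ n * blockGrowth α γ n := by
  set r : ℝ := (2 : ℝ) ^ (-(β - α - γ)) with hr
  have hr0 : 0 < r := by positivity
  have hr1 : r < 1 := two_rpow_neg_lt_one (by linarith)
  have hq : r * 2 ^ (1 - γ - α) < 1 := by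
    rw [hr, ← Real.rpow_add two_pos, show -(β - α - γ) + (1 - γ - α) = -(β - 1) by ring]
    exact two_rpow_neg_lt_one (by linarith)
  refine summable_of_succ_eq_add_mul (s := fun n => r * (r ^ n * 1 + 4 * (r ^ n * blockWeight γ n)))
    (q := r * 2 ^ (1 - γ - α)) (fun n => mul_nonneg (by positivity) (blockGrowth_nonneg _ _ _))
    (fun n => ?_) ?_ hq (by positivity) fun n => ?_
  · have := blockWeight_nonneg γ n
    positivity
  · exact (((summable_geometric_of_lt_one hr0.le hr1).mul_right 1).add
      ((summable_blockWeight hαβ).mul_left 4)).mul_left r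
  · rw [blockGrowth, pow_succ]; ring

/-- The series in the constant of the conditional part of the sewing bound. -/
noncomputable def growthSum (α β γ : ℝ) : ℝ :=
  ∑' n, ((2 : ℝ) ^ (-(β - α - γ))) ^ n * blockGrowth α γ (n + 1)

/-- The series in the constant of the martingale part of the sewing bound. -/
noncomputable def weightSum (β γ : ℝ) : ℝ :=
  ∑' n, ((2 : ℝ) ^ (-(β - γ))) ^ n * blockWeight γ (n + 1)

/-- The geometric series `∑ 2^{-nβ}`. -/
noncomputable def geomSum (β : ℝ) : ℝ := ∑' n : ℕ, ((2 : ℝ) ^ (-β)) ^ n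

theorem growthSum_nonneg (α β γ : ℝ) : 0 ≤ growthSum α β γ :=
  tsum_nonneg fun _ => mul_nonneg (by positivity) (blockGrowth_nonneg _ _ _)

theorem weightSum_nonneg (β γ : ℝ) : 0 ≤ weightSum β γ :=
  tsum_nonneg fun _ => mul_nonneg (by positivity) (blockWeight_nonneg _ _)

theorem geomSum_nonneg (β : ℝ) : 0 ≤ geomSum β := tsum_nonneg fun _ => by positivity

theorem div_two_pow_rpow {h : ℝ} (hh : 0 < h) (n : ℕ) (e : ℝ) :
    (h / 2 ^ n) ^ e = h ^ e * ((2 : ℝ) ^ (-e)) ^ n := by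
  rw [Real.div_rpow hh.le (by positivity), ← Real.rpow_natCast 2 n, ← Real.rpow_mul two_pos.le,
    ← Real.rpow_natCast _ n, ← Real.rpow_mul two_pos.le, div_eq_mul_inv,
    ← Real.rpow_neg two_pos.le]
  congr 2; ring

end Constants

/-! ### Limits in `L_m` -/

section Limits

theorem LpBound.of_tendsto {Ω V : Type*} {mΩ : MeasurableSpace Ω} [NormedAddCommGroup V]
    {P : Measure Ω} {m a : ℝ} (hm : 2 ≤ m) {F : ℕ → Ω → V} {f : Ω → V}
    (hF : ∀ᶠ n in atTop, LpBound P m (F n) a) (hf : AEStronglyMeasurable f P)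
    (h : Tendsto (fun n => eLpNorm (fun ω => F n ω - f ω) (ENNReal.ofReal m) P) atTop (𝓝 0)) :
    LpBound P m f a := by
  obtain ⟨n, hn⟩ := hF.exists
  refine ⟨hf, hn.nonneg, ?_⟩
  have h2 : Tendsto (fun n => ENNReal.ofReal a
      + eLpNorm (fun ω => F n ω - f ω) (ENNReal.ofReal m) P) atTop (𝓝 (ENNReal.ofReal a + 0)) :=
    tendsto_const_nhds.add h
  rw [add_zero] at h2
  refine ge_of_tendsto h2 (hF.mono fun n hn => ?_)
  have e : f = F n - fun ω => F n ω - f ω := by ext ω; simp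
  calc eLpNorm f (ENNReal.ofReal m) P
      = eLpNorm (F n - fun ω => F n ω - f ω) (ENNReal.ofReal m) P := by rw [← e]
    _ ≤ _ := eLpNorm_sub_le hn.1 (hn.1.sub hf) (one_le_ofReal_of_two_le hm)
    _ ≤ _ := add_le_add_left hn.3 _

/-- A limit in `Lp` is only an equivalence class. The classes with an `𝓗`-measurable representative
form a closed set, and such a representative is chosen; this makes the process genuinely adapted. -/
theorem exists_stronglyMeasurable_lp_limit {Ω V : Type*} {𝓗 mΩ : MeasurableSpace Ω}
    [NormedAddCommGroup V] [NormedSpace ℝ V] [CompleteSpace V]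
    {P : Measure Ω} {m : ℝ} (hm : 2 ≤ m) (h𝓗 : 𝓗 ≤ mΩ) {F : ℕ → Ω → V}
    (hmeas : ∀ n, StronglyMeasurable[𝓗] (F n)) (hmem : ∀ n, MemLp (F n) (ENNReal.ofReal m) P)
    {b : ℕ → ℝ} (hb : Summable b) (h : ∀ n, LpBound P m (fun ω => F (n + 1) ω - F n ω) (b n)) :
    ∃ f : Ω → V, StronglyMeasurable[𝓗] f ∧ MemLp f (ENNReal.ofReal m) P ∧
      Tendsto (fun n => eLpNorm (fun ω => F n ω - f ω) (ENNReal.ofReal m) P) atTop (𝓝 0) := by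
  have : Fact (1 ≤ ENNReal.ofReal m) := ⟨one_le_ofReal_of_two_le hm⟩
  set G : ℕ → Lp V (ENNReal.ofReal m) P := fun n => (hmem n).toLp with hG
  have hcau : CauchySeq G := by
    refine cauchySeq_of_dist_le_of_summable b (fun n => ?_) hb
    rw [dist_comm, ← ENNReal.ofReal_le_ofReal_iff (h n).nonneg, ← edist_dist, Lp.edist_toLp_toLp]
    exact (h n).le
  obtain ⟨g, hg⟩ := cauchySeq_tendsto_of_complete hcau
  have hgm : AEStronglyMeasurable[𝓗] g P := by
    refine (isClosed_aestronglyMeasurable (F := V) (p := ENNReal.ofReal m) (μ := P) h𝓗).mem_of_tendsto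
      hg (Eventually.of_forall fun n => ?_)
    exact (hmeas n).aestronglyMeasurable.congr (hmem n).coeFn_toLp.symm
  refine ⟨hgm.mk g, hgm.stronglyMeasurable_mk, (memLp_congr_ae hgm.ae_eq_mk).1 (Lp.memLp g), ?_⟩
  have h1 := (Lp.tendsto_Lp_iff_tendsto_eLpNorm' (fi := atTop) G g).1 hg
  refine h1.congr fun n => eLpNorm_congr_ae ?_
  filter_upwards [(hmem n).coeFn_toLp, hgm.ae_eq_mk] with ω h2 h3
  rw [Pi.sub_apply, h2, h3]

end Limits

/-! ### Riemann sums along uniform grids -/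

section Grid

/-- The projection of `x` to `[s, t]`. -/
noncomputable def clip (s t x : ℝ) : ℝ := max s (min t x)

theorem clip_mem {s t : ℝ} (h : s ≤ t) (x : ℝ) : s ≤ clip s t x ∧ clip s t x ≤ t :=
  ⟨le_max_left _ _, max_le h (min_le_left _ _)⟩

theorem clip_of_le_left {s t x : ℝ} (h : x ≤ s) : clip s t x = s :=
  max_eq_left ((min_le_right _ _).trans h)

theorem clip_of_right_le {s t x : ℝ} (hst : s ≤ t) (h : t ≤ x) : clip s t x = t := by
  rw [clip, min_eq_left h, max_eq_right hst]

theorem clip_of_mem {s t x : ℝ} (hs : s ≤ x) (ht : x ≤ t) : clip s t x = x := by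
  rw [clip, min_eq_right ht, max_eq_right hs]

theorem clip_mono (s t : ℝ) : Monotone (clip s t) := fun _ _ h =>
  max_le_max le_rfl (min_le_min le_rfl h)

/-- The Riemann sum of `A` over the partition of `[s, t]` induced by the grid `h ℕ`. -/
noncomputable def gridSum {Ω E : Type*} [AddCommGroup E] (A : ℝ → ℝ → Ω → E) (h : ℝ) (N : ℕ)
    (s t : ℝ) : Ω → E :=
  fun ω => ∑ i ∈ Finset.range N, A (clip s t (i * h)) (clip s t ((i + 1 : ℕ) * h)) ω

theorem gridSum_half_sub {Ω E : Type*} [AddCommGroup E] (A : ℝ → ℝ → Ω → E) (h : ℝ) (N : ℕ)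
    (s t : ℝ) (ω : Ω) :
    gridSum A (h / 2) (2 * N) s t ω - gridSum A h N s t ω =
      -∑ i ∈ Finset.range N, germDelta A (clip s t (i * h)) (clip s t ((2 * i + 1 : ℕ) * (h / 2)))
        (clip s t ((i + 1 : ℕ) * h)) ω := by
  have e : ∀ (N : ℕ) (f : ℕ → E), ∑ i ∈ Finset.range (2 * N), f i =
      ∑ i ∈ Finset.range N, (f (2 * i) + f (2 * i + 1)) := fun N f => by
    induction N with
    | zero => simp
    | succ n ih =>
      rw [show 2 * (n + 1) = 2 * n + 1 + 1 by ring, Finset.sum_range_succ, Finset.sum_range_succ,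
        ih, Finset.sum_range_succ, add_assoc]
  rw [gridSum, gridSum, e, ← Finset.sum_sub_distrib, ← Finset.sum_neg_distrib]
  refine Finset.sum_congr rfl fun i _ => ?_
  have h1 : ((2 * i : ℕ) : ℝ) * (h / 2) = i * h := by push_cast; ring
  have h2 : ((2 * i + 1 + 1 : ℕ) : ℝ) * (h / 2) = (i + 1 : ℕ) * h := by push_cast; ring
  rw [h1, h2, germDelta]
  abel

/-- Measurability and integrability properties of a germ. -/
structure IsAdaptedGerm {Ω : Type*} {mΩ : MeasurableSpace Ω} (P : Measure Ω)
    (𝓕 : Filtration ℝ mΩ) {d : ℕ} (T m : ℝ) (A : ℝ → ℝ → Ω → EuclideanSpace ℝ (Fin d)) :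
    Prop where
  diag : ∀ s, 0 ≤ s → s ≤ T → A s s =ᵐ[P] 0
  adapted : ∀ s t, 0 ≤ s → s ≤ t → t ≤ T → StronglyMeasurable[𝓕 t] (A s t)
  memLp : ∀ s t, 0 ≤ s → s ≤ t → t ≤ T → MemLp (A s t) (ENNReal.ofReal m) P

/-- Bounds for `δA` on `[s, T]`. -/
structure HasGermBound {Ω : Type*} {mΩ : MeasurableSpace Ω} (P : Measure Ω)
    (𝓕 : Filtration ℝ mΩ) {d : ℕ} (T m M α β₁ β₂ β₃ γ γ' : ℝ)
    (A : ℝ → ℝ → Ω → EuclideanSpace ℝ (Fin d)) (s g₁ g₂ g₃ : ℝ) : Prop where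
  cond : ∀ t₀ t₁ t₂ t₃, 0 ≤ t₀ → t₀ < t₁ → s ≤ t₁ → t₁ ≤ t₂ → t₂ ≤ t₃ → t₃ ≤ T →
    M * (t₃ - t₁) ≤ t₁ - t₀ → LpBound P m (P[germDelta A t₁ t₂ t₃ | 𝓕 t₀])
      (g₁ * t₁ ^ (-γ) * (t₁ - t₀) ^ (-α) * (t₃ - t₁) ^ β₁)
  weighted : ∀ t₁ t₂ t₃, 0 < t₁ → s ≤ t₁ → t₁ ≤ t₂ → t₂ ≤ t₃ → t₃ ≤ T →
    LpBound P m (germDelta A t₁ t₂ t₃) (g₂ * t₁ ^ (-γ') * (t₃ - t₁) ^ β₂)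
  plain : ∀ t₁ t₂ t₃, s ≤ t₁ → t₁ ≤ t₂ → t₂ ≤ t₃ → t₃ ≤ T →
    LpBound P m (germDelta A t₁ t₂ t₃) (g₃ * (t₃ - t₁) ^ β₃)

variable {Ω : Type u} {mΩ : MeasurableSpace Ω} {P : Measure Ω}
  {𝓕 : Filtration ℝ mΩ} {d : ℕ} {T m : ℝ} {A : ℝ → ℝ → Ω → EuclideanSpace ℝ (Fin d)}


namespace IsAdaptedGerm

theorem stronglyMeasurable_germDelta (hA : IsAdaptedGerm P 𝓕 T m A) {a b c : ℝ} (ha : 0 ≤ a)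
    (hab : a ≤ b) (hbc : b ≤ c) (hc : c ≤ T) : StronglyMeasurable[𝓕 c] (germDelta A a b c) :=
  ((hA.adapted a c ha (hab.trans hbc) hc).sub
    ((hA.adapted a b ha hab (hbc.trans hc)).mono (𝓕.mono hbc))).sub
    (hA.adapted b c (ha.trans hab) hbc hc)

theorem memLp_germDelta (hA : IsAdaptedGerm P 𝓕 T m A) {a b c : ℝ} (ha : 0 ≤ a)
    (hab : a ≤ b) (hbc : b ≤ c) (hc : c ≤ T) : MemLp (germDelta A a b c) (ENNReal.ofReal m) P :=
  ((hA.memLp a c ha (hab.trans hbc) hc).sub (hA.memLp a b ha hab (hbc.trans hc))).sub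
    (hA.memLp b c (ha.trans hab) hbc hc)

theorem germDelta_left (hA : IsAdaptedGerm P 𝓕 T m A) {a c : ℝ} (ha : 0 ≤ a) (haT : a ≤ T) :
    germDelta A a a c =ᵐ[P] 0 := by
  filter_upwards [hA.diag a ha haT] with ω h
  simp [germDelta, h]

theorem germDelta_right (hA : IsAdaptedGerm P 𝓕 T m A) {a c : ℝ} (hc : 0 ≤ c) (hcT : c ≤ T) :
    germDelta A a c c =ᵐ[P] 0 := by
  filter_upwards [hA.diag c hc hcT] with ω h
  simp [germDelta, h]

theorem stronglyMeasurable_gridSum (hA : IsAdaptedGerm P 𝓕 T m A) (h : ℝ) (hh : 0 ≤ h) (N : ℕ)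
    {s t : ℝ} (hs : 0 ≤ s) (hst : s ≤ t) (ht : t ≤ T) :
    StronglyMeasurable[𝓕 t] (gridSum A h N s t) :=
  Finset.stronglyMeasurable_fun_sum _ fun i _ =>
    have h1 := clip_mem hst (i * h)
    have h2 := clip_mem hst ((i + 1 : ℕ) * h)
    (hA.adapted _ _ (hs.trans h1.1) (clip_mono s t (by push_cast; nlinarith))
      (h2.2.trans ht)).mono (𝓕.mono h2.2)

theorem memLp_gridSum (hA : IsAdaptedGerm P 𝓕 T m A) (h : ℝ) (hh : 0 ≤ h) (N : ℕ)
    {s t : ℝ} (hs : 0 ≤ s) (hst : s ≤ t) (ht : t ≤ T) :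
    MemLp (gridSum A h N s t) (ENNReal.ofReal m) P :=
  memLp_finsetSum _ fun i _ =>
    have h1 := clip_mem hst (i * h)
    have h2 := clip_mem hst ((i + 1 : ℕ) * h)
    hA.memLp _ _ (hs.trans h1.1) (clip_mono s t (by push_cast; nlinarith)) (h2.2.trans ht)

/-- If `[s, t]` is not longer than a grid cell, there is at most one grid point inside. -/
theorem gridSum_of_sub_le (hA : IsAdaptedGerm P 𝓕 T m A) {h : ℝ} (hh : 0 < h) {N : ℕ}
    {s t : ℝ} (hs : 0 ≤ s) (hst : s ≤ t) (ht : t ≤ T) (hN : t ≤ N * h) (hth : t - s ≤ h) :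
    ∃ g, s ≤ g ∧ g ≤ t ∧ gridSum A h N s t =ᵐ[P] fun ω => A s t ω - germDelta A s g t ω := by
  set i0 : ℕ := ⌊s / h⌋₊ with hi0
  have hlo : i0 * h ≤ s := by
    rw [← le_div_iff₀ hh]; exact Nat.floor_le (div_nonneg hs hh.le)
  have hhi : s < (i0 + 1) * h := by
    rw [← div_lt_iff₀ hh]; exact Nat.lt_floor_add_one _
  refine ⟨clip s t ((i0 + 1 : ℕ) * h), (clip_mem hst _).1, (clip_mem hst _).2, ?_⟩
  filter_upwards [hA.diag s hs (hst.trans ht), hA.diag t (hs.trans hst) ht] with ω h1 h2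
  simp only [Pi.zero_apply] at h1 h2
  set f : ℕ → EuclideanSpace ℝ (Fin d) :=
    fun i => A (clip s t (i * h)) (clip s t ((i + 1 : ℕ) * h)) ω with hf
  have hright : ∀ i : ℕ, t ≤ i * h → f i = 0 := fun i hi => by
    have hi' : t ≤ (i + 1 : ℕ) * h := by push_cast; linarith
    simp only [hf]
    rw [clip_of_right_le hst hi, clip_of_right_le hst hi', h2]
  have hleft : ∀ i : ℕ, i < i0 → f i = 0 := fun i hi => by
    have hi1 : ((i + 1 : ℕ) : ℝ) ≤ i0 := by exact_mod_cast hi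
    have hi2 : ((i + 1 : ℕ) : ℝ) * h ≤ s := (mul_le_mul_of_nonneg_right hi1 hh.le).trans hlo
    have hi3 : (i : ℝ) * h ≤ s := by push_cast at hi2; linarith
    simp only [hf]
    rw [clip_of_le_left hi2, clip_of_le_left hi3, h1]
  have hi0r : t ≤ (i0 + 1 + 1 : ℕ) * h := by push_cast; linarith
  -- The range is enlarged so that it surely contains `i0` and `i0 + 1`; the added terms are `A t
  -- t`.
  have hbig : gridSum A h N s t ω = ∑ i ∈ Finset.range (max N (i0 + 2)), f i := by
    refine Finset.sum_subset (Finset.range_subset_range.2 (le_max_left _ _)) fun i _ hi => ?_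
    have hi' : (N : ℝ) ≤ i := by exact_mod_cast (by simpa using hi : N ≤ i)
    exact hright i (hN.trans (mul_le_mul_of_nonneg_right hi' hh.le))
  have hpair : ∑ i ∈ Finset.range (max N (i0 + 2)), f i = ∑ i ∈ {i0, i0 + 1}, f i := by
    refine (Finset.sum_subset ?_ fun i _ hi => ?_).symm
    · intro i hi
      simp only [Finset.mem_insert, Finset.mem_singleton] at hi
      rw [Finset.mem_range]
      have := le_max_right N (i0 + 2)
      omega
    · simp only [Finset.mem_insert, Finset.mem_singleton, not_or] at hi
      rcases Nat.lt_or_ge i i0 with h3 | h3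
      · exact hleft i h3
      · have : ((i0 + 1 + 1 : ℕ) : ℝ) ≤ i := by exact_mod_cast (by omega : i0 + 1 + 1 ≤ i)
        exact hright i (hi0r.trans (mul_le_mul_of_nonneg_right this hh.le))
  rw [hbig, hpair, Finset.sum_pair (by omega)]
  simp only [hf]
  rw [clip_of_le_left hlo, clip_of_right_le hst hi0r, germDelta]
  abel

/-- Grid sums are additive up to a single term. -/
theorem gridSum_sub_sub (hA : IsAdaptedGerm P 𝓕 T m A) {h : ℝ} (hh : 0 < h) {N : ℕ}
    {s t : ℝ} (hs : 0 ≤ s) (hst : s ≤ t) (ht : t ≤ T) (hN : t < N * h) :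
    ∃ a b, 0 ≤ a ∧ a ≤ s ∧ s ≤ b ∧ b ≤ t ∧ b - a ≤ h ∧
      (fun ω => gridSum A h N 0 t ω - gridSum A h N 0 s ω - gridSum A h N s t ω)
        =ᵐ[P] germDelta A a s b := by
  set i0 : ℕ := ⌊s / h⌋₊ with hi0
  have ht0 : 0 ≤ t := hs.trans hst
  have hlo : i0 * h ≤ s := by
    rw [← le_div_iff₀ hh]; exact Nat.floor_le (div_nonneg hs hh.le)
  have hhi : s < (i0 + 1) * h := by
    rw [← div_lt_iff₀ hh]; exact Nat.lt_floor_add_one _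
  have hi0N : i0 < N := by
    have : (i0 : ℝ) < N := lt_of_mul_lt_mul_right (by linarith : (i0 : ℝ) * h < N * h) hh.le
    exact_mod_cast this
  have hi0nn : (0 : ℝ) ≤ i0 * h := by positivity
  -- Only the cell that contains `s` contributes; its right end is cut off at `t`.
  refine ⟨i0 * h, clip 0 t ((i0 + 1 : ℕ) * h), hi0nn, hlo, ?_, (clip_mem ht0 _).2, ?_, ?_⟩
  · exact (le_min hst (by push_cast; exact hhi.le)).trans (le_max_right _ _)
  · rw [sub_le_iff_le_add]
    refine max_le (by linarith) ((min_le_right _ _).trans ?_)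
    push_cast; linarith
  filter_upwards [hA.diag s hs (hst.trans ht)] with ω h1
  simp only [Pi.zero_apply] at h1
  rw [gridSum, gridSum, gridSum, ← Finset.sum_sub_distrib, ← Finset.sum_sub_distrib,
    Finset.sum_eq_single_of_mem i0 (Finset.mem_range.2 hi0N)]
  · have e1 : clip 0 t (i0 * h) = i0 * h := clip_of_mem hi0nn (hlo.trans hst)
    have e2 : clip 0 s (i0 * h) = i0 * h := clip_of_mem hi0nn hlo
    have e3 : clip s t (i0 * h) = s := clip_of_le_left hlo
    have e4 : clip 0 s ((i0 + 1 : ℕ) * h) = s := clip_of_right_le hs (by push_cast; exact hhi.le)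
    have e5 : clip s t ((i0 + 1 : ℕ) * h) = clip 0 t ((i0 + 1 : ℕ) * h) := by
      have h3 : s ≤ min t ((i0 + 1 : ℕ) * h) := le_min hst (by push_cast; exact hhi.le)
      rw [clip, clip, max_eq_right h3, max_eq_right (hs.trans h3)]
    rw [e1, e2, e3, e4, e5, germDelta]
  · intro i _ hi
    rcases Nat.lt_or_ge i i0 with h3 | h3
    · have hi1 : ((i + 1 : ℕ) : ℝ) ≤ i0 := by exact_mod_cast h3
      have hi2 : ((i + 1 : ℕ) : ℝ) * h ≤ s := (mul_le_mul_of_nonneg_right hi1 hh.le).trans hlo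
      have hi3 : (i : ℝ) * h ≤ s := by push_cast at hi2; linarith
      have hn : (0 : ℝ) ≤ i * h := by positivity
      have hn' : (0 : ℝ) ≤ (i + 1 : ℕ) * h := by positivity
      rw [clip_of_mem hn (hi3.trans hst), clip_of_mem hn' (hi2.trans hst), clip_of_mem hn hi3,
        clip_of_mem hn' hi2, clip_of_le_left hi2, clip_of_le_left hi3, h1]
      simp
    · have hi1 : ((i0 + 1 : ℕ) : ℝ) ≤ i := by exact_mod_cast (by omega : i0 + 1 ≤ i)
      have hi2 : s ≤ i * h := by
        have := mul_le_mul_of_nonneg_right hi1 hh.le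
        push_cast at this; linarith
      have hi3 : s ≤ (i + 1 : ℕ) * h := by push_cast; linarith
      have e : ∀ x, s ≤ x → clip 0 t x = clip s t x := fun x hx => by
        have h3 : s ≤ min t x := le_min hst hx
        rw [clip, clip, max_eq_right h3, max_eq_right (hs.trans h3)]
      rw [e _ hi2, e _ hi3, clip_of_right_le hs hi2, clip_of_right_le hs hi3, h1]
      simp

end IsAdaptedGerm

end Grid

/-! ### One refinement step -/

section Levels

/-- The indices of the grid cells that meet `[s, t)` in an interval. -/
noncomputable def activeCells (h : ℝ) (N : ℕ) (s t : ℝ) : Finset ℕ :=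
  (Finset.range N).filter fun i => ⌊s / h⌋₊ ≤ i ∧ (i : ℝ) * h < t

theorem floor_div_mul_le {s h : ℝ} (hh : 0 < h) (hs : 0 ≤ s) : ⌊s / h⌋₊ * h ≤ s := by
  rw [← le_div_iff₀ hh]; exact Nat.floor_le (div_nonneg hs hh.le)

theorem lt_floor_div_add_one_mul {s h : ℝ} (hh : 0 < h) : s < (⌊s / h⌋₊ + 1) * h := by
  rw [← div_lt_iff₀ hh]; exact Nat.lt_floor_add_one _

theorem sub_floor_le_of_mem_activeCells {h s t : ℝ} {N n i : ℕ} (hh : 0 < h)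
    (hn : t - s ≤ 2 ^ n * h) (hi : i ∈ activeCells h N s t) : i - ⌊s / h⌋₊ ≤ 2 ^ n := by
  have h2 := (Finset.mem_filter.1 hi).2.2
  have h3 := lt_floor_div_add_one_mul (s := s) hh
  have h4 : (i : ℝ) < ⌊s / h⌋₊ + 1 + 2 ^ n := by
    refine lt_of_mul_lt_mul_right ?_ hh.le
    linarith
  have h5 : i < ⌊s / h⌋₊ + 1 + 2 ^ n := by exact_mod_cast h4
  have h6 := Nat.one_le_two_pow (n := n)
  omega

theorem card_activeCells_le {h s t : ℝ} {N n : ℕ} (hh : 0 < h) (hn : t - s ≤ 2 ^ n * h) :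
    (activeCells h N s t).card ≤ 2 ^ (n + 1) := by
  calc _ ≤ (Finset.Ico ⌊s / h⌋₊ (⌊s / h⌋₊ + (2 ^ n + 1))).card := by
        refine Finset.card_le_card fun i hi => ?_
        have h1 := (Finset.mem_filter.1 hi).2.1
        have h2 := sub_floor_le_of_mem_activeCells hh hn hi
        rw [Finset.mem_Ico]; omega
    _ ≤ _ := by
        have := Nat.one_le_two_pow (n := n)
        simp only [Nat.card_Ico, pow_succ]; omega

variable {Ω : Type u} {mΩ : MeasurableSpace Ω} {P : Measure Ω}
  {𝓕 : Filtration ℝ mΩ} {d : ℕ} {T m : ℝ} {A : ℝ → ℝ → Ω → EuclideanSpace ℝ (Fin d)}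

/-- The `i`-th summand in the difference of the Riemann sums of two consecutive grids. -/
noncomputable def cellDelta (A : ℝ → ℝ → Ω → EuclideanSpace ℝ (Fin d)) (h s t : ℝ) (i : ℕ) :
    Ω → EuclideanSpace ℝ (Fin d) :=
  germDelta A (clip s t (i * h)) (clip s t ((2 * i + 1 : ℕ) * (h / 2))) (clip s t ((i + 1 : ℕ) * h))

theorem clip_cell_le {h : ℝ} (hh : 0 < h) (s t : ℝ) (i : ℕ) :
    clip s t (i * h) ≤ clip s t ((2 * i + 1 : ℕ) * (h / 2)) ∧
    clip s t ((2 * i + 1 : ℕ) * (h / 2)) ≤ clip s t ((i + 1 : ℕ) * h) :=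
  ⟨clip_mono s t (by push_cast; linarith), clip_mono s t (by push_cast; linarith)⟩

theorem clip_succ_le {h : ℝ} (hh : 0 < h) (s t : ℝ) (i : ℕ) :
    clip s t ((i + 1 : ℕ) * h) ≤ clip s t (i * h) + h := by
  refine max_le ((le_max_left s _).trans (by unfold clip; linarith)) ?_
  refine le_trans ?_ (add_le_add_left (le_max_right s _) h)
  rcases le_total t (i * h) with h1 | h1
  · rw [min_eq_left h1]; linarith [min_le_left t ((i + 1 : ℕ) * h)]
  · rw [min_eq_right h1]; refine (min_le_right _ _).trans ?_; push_cast; linarith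

theorem IsAdaptedGerm.gridSum_sub_ae_eq (hA : IsAdaptedGerm P 𝓕 T m A) {h : ℝ} (hh : 0 < h)
    (N : ℕ) {s t : ℝ} (hs : 0 ≤ s) (hst : s ≤ t) (ht : t ≤ T) :
    (fun ω => -∑ i ∈ activeCells h N s t, cellDelta A h s t i ω) =ᵐ[P]
      fun ω => gridSum A (h / 2) (2 * N) s t ω - gridSum A h N s t ω := by
  filter_upwards [hA.germDelta_left (c := s) hs (hst.trans ht),
    hA.germDelta_left (c := t) (hs.trans hst) ht] with ω h1 h2
  rw [gridSum_half_sub]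
  congr 1
  refine Finset.sum_subset (Finset.filter_subset _ _) fun i hi hi' => ?_
  simp only [activeCells, Finset.mem_filter, hi, true_and, not_and, not_lt] at hi'
  rcases Nat.lt_or_ge i ⌊s / h⌋₊ with h3 | h3
  · have h4 : ((i + 1 : ℕ) : ℝ) ≤ ⌊s / h⌋₊ := by exact_mod_cast h3
    have h5 : ((i + 1 : ℕ) : ℝ) * h ≤ s :=
      (mul_le_mul_of_nonneg_right h4 hh.le).trans (floor_div_mul_le hh hs)
    rw [cellDelta, clip_of_le_left h5, clip_of_le_left (by push_cast at h5 ⊢; linarith),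
      clip_of_le_left (by push_cast at h5 ⊢; linarith)]
    exact h1
  · have h5 := hi' h3
    rw [cellDelta, clip_of_right_le hst h5, clip_of_right_le hst (by push_cast; linarith),
      clip_of_right_le hst (by push_cast; linarith)]
    exact h2

variable [IsProbabilityMeasure P] {κ M α β₁ β₂ β₃ γ γ' s g₁ g₂ g₃ : ℝ}

/-- The bound for the difference of the Riemann sums of two consecutive grids. -/
theorem HasGermBound.lpBound_gridSum_sub (hm : 2 ≤ m) (hκ : IsBDGConstant.{u} m d κ)
    (hκ1 : 1 ≤ κ) (hA : IsAdaptedGerm P 𝓕 T m A)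
    (hB : HasGermBound P 𝓕 T m M α β₁ β₂ β₃ γ γ' A s g₁ g₂ g₃)
    (hα : 0 ≤ α) (hγ0 : 0 ≤ γ) (hγ : γ < 1 / 2) (hγ'0 : 0 ≤ γ') (hγ' : γ' < 1 / 2)
    (hβ₁ : 0 ≤ β₁) (hβ₂ : 0 ≤ β₂) (hβ₃ : 0 ≤ β₃) (hg₁ : 0 ≤ g₁) (hg₂ : 0 ≤ g₂) (hg₃ : 0 ≤ g₃)
    {Λ : ℕ} (hΛ : M ≤ Λ) (hΛ1 : 1 ≤ Λ) (hM : 0 ≤ M) {h : ℝ} (hh : 0 < h) (N : ℕ) {n : ℕ} {t : ℝ}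
    (hs : 0 ≤ s) (hst : s ≤ t) (ht : t ≤ T) (hn : t - s ≤ 2 ^ n * h) :
    LpBound P m (fun ω => gridSum A (h / 2) (2 * N) s t ω - gridSum A h N s t ω)
      (Λ * (g₃ * h ^ β₃) + κ * (Λ * (6 * (g₂ * h ^ β₂ * h ^ (-γ') * blockWeight γ' (n + 1))
        + g₁ * h ^ β₁ * h ^ (-γ) * h ^ (-α) * blockGrowth α γ (n + 1)))) := by
  set i0 := ⌊s / h⌋₊ with hi0
  have hlo : (i0 : ℝ) * h ≤ s := floor_div_mul_le hh hs
  have hhi : s < (i0 + 1) * h := lt_floor_div_add_one_mul hh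
  have hΛr : (1 : ℝ) ≤ Λ := by exact_mod_cast hΛ1
  set l : ℕ → ℝ := fun i => clip s t (i * h) with hl
  have hsl : ∀ i, s ≤ l i := fun i => (clip_mem hst _).1
  have hwid : ∀ i, clip s t ((i + 1 : ℕ) * h) - l i ≤ h := fun i => by
    linarith [clip_succ_le hh s t i]
  have hwid0 : ∀ i, 0 ≤ clip s t ((i + 1 : ℕ) * h) - l i := fun i =>
    sub_nonneg.2 ((clip_cell_le hh s t i).1.trans (clip_cell_le hh s t i).2)
  have hrT : ∀ i : ℕ, clip s t ((i + 1 : ℕ) * h) ≤ T := fun i => (clip_mem hst _).2.trans ht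
  have hact : ∀ i ∈ activeCells h N s t, i0 ≤ i ∧ (i : ℝ) * h < t := fun i hi =>
    (Finset.mem_filter.1 hi).2
  -- A block consists of `Λ` consecutive cells, counted from the one containing `s`. At most `2^n +
  -- 1 ≤ 2^(n+1)` cells are active, which gives `K = n + 1`. The germ has a single weighted bound,
  -- hence `x = 0`.
  have key := lpBound_sum_cells hm hκ hκ1 𝓕 (M := M) (x := 0) (y := g₂ * h ^ β₂)
    (z := g₃ * h ^ β₃) (g := g₁ * h ^ β₁) (c := i0 * h) hα hγ0 hγ hγ'0 hγ' (by positivity) le_rfl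
    (by positivity) (by positivity) hh (by positivity) (activeCells h N s t) l
    (fun i => (i - i0) / Λ) (B := Λ) (K := n + 1) hΛ hΛ1 (cellDelta A h s t)
    (fun i hi => (hA.stronglyMeasurable_germDelta (hs.trans (hsl i)) (clip_cell_le hh s t i).1
      (clip_cell_le hh s t i).2 (hrT i)).mono (𝓕.mono (by linarith [hwid i])))
    (fun i hi => by
      obtain ⟨h1, h2⟩ := hact i hi
      have h3 : (i - i0) / Λ * Λ ≤ i - i0 := Nat.div_mul_le_self _ _
      have h4 : (((i - i0) / Λ * Λ + i0 : ℕ) : ℝ) ≤ i := by exact_mod_cast (by omega)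
      have h5 := mul_le_mul_of_nonneg_right h4 hh.le
      have h6 : (i : ℝ) * h ≤ l i := (le_min h2.le le_rfl).trans (le_max_right _ _)
      push_cast at h5
      linarith)
    (fun i hi => by
      obtain ⟨h1, h2⟩ := hact i hi
      have h3 : i - i0 < ((i - i0) / Λ + 1) * Λ := by
        have := Nat.lt_mul_div_succ (i - i0) (by omega : 0 < Λ)
        rwa [mul_comm] at this
      have h4 : (i : ℝ) < ((i - i0) / Λ : ℕ) * Λ + Λ + i0 := by
        have : i < ((i - i0) / Λ) * Λ + Λ + i0 := by
          rw [add_mul, one_mul] at h3; omega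
        exact_mod_cast this
      have h5 := mul_lt_mul_of_pos_right h4 hh
      have h6 : h ≤ Λ * h := le_mul_of_one_le_left hh.le hΛr
      have h7 : 0 ≤ (((i - i0) / Λ : ℕ) : ℝ) * (Λ * h) := by positivity
      refine max_lt (by linarith) ((min_le_right _ _).trans_lt ?_)
      linarith)
    (fun i hi => by
      have h1 := sub_floor_le_of_mem_activeCells hh hn hi
      have h2 : (i - i0) / Λ ≤ i - i0 := Nat.div_le_self _ _
      have h3 := Nat.one_le_two_pow (n := n)
      rw [pow_succ]; omega)
    (fun j => by
      calc _ ≤ (Finset.Ico (i0 + j * Λ) (i0 + j * Λ + Λ)).card := by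
            refine Finset.card_le_card fun i hi => ?_
            obtain ⟨h1, h2⟩ := Finset.mem_filter.1 hi
            have h3 := (hact i h1).1
            have h4 := (Nat.div_eq_iff (by omega : 0 < Λ)).1 h2
            rw [Finset.mem_Ico]; omega
        _ = Λ := by simp)
    (fun i hi => (hB.plain _ _ _ (hsl i) (clip_cell_le hh s t i).1 (clip_cell_le hh s t i).2
      (hrT i)).mono (by
        have := Real.rpow_le_rpow (hwid0 i) (hwid i) hβ₃
        gcongr))
    (fun i hi hpos => (hB.weighted _ _ _ hpos (hsl i) (clip_cell_le hh s t i).1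
      (clip_cell_le hh s t i).2 (hrT i)).mono (by
        have h1 := Real.rpow_le_rpow (hwid0 i) (hwid i) hβ₂
        have h2 : 0 ≤ l i ^ (-γ') := Real.rpow_nonneg hpos.le _
        calc _ ≤ g₂ * l i ^ (-γ') * h ^ β₂ := by gcongr
          _ = _ := by ring))
    (fun i hi v hv0 hv hlag => (hB.cond v _ _ _ hv0 hv (hsl i) (clip_cell_le hh s t i).1
      (clip_cell_le hh s t i).2 (hrT i)
      ((mul_le_mul_of_nonneg_left (hwid i) hM).trans hlag)).mono (by
        have h1 := Real.rpow_le_rpow (hwid0 i) (hwid i) hβ₁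
        have h2 : 0 ≤ l i ^ (-γ) := Real.rpow_nonneg (hv0.trans hv.le) _
        have h3 : 0 ≤ (l i - v) ^ (-α) := Real.rpow_nonneg (by linarith) _
        calc _ ≤ g₁ * l i ^ (-γ) * (l i - v) ^ (-α) * h ^ β₁ := by gcongr
          _ = _ := by ring))
  refine (key.neg.congr (hA.gridSum_sub_ae_eq hh N hs hst ht)).mono (le_of_eq ?_)
  ring

/-- The bound for conditional expectations given the distant past. -/
theorem HasGermBound.lpBound_condExp_gridSum_sub (hm : 2 ≤ m) (hA : IsAdaptedGerm P 𝓕 T m A)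
    (hB : HasGermBound P 𝓕 T m M α β₁ β₂ β₃ γ γ' A s g₁ g₂ g₃)
    (hα : 0 ≤ α) (hγ0 : 0 ≤ γ) (hβ₁ : 0 ≤ β₁) (hg₁ : 0 ≤ g₁) (hM : 0 ≤ M) {h : ℝ} (hh : 0 < h)
    (N : ℕ) {n : ℕ} {t t₀ : ℝ} (ht₀ : 0 ≤ t₀) (hts : t₀ < s) (hst : s ≤ t) (ht : t ≤ T)
    (hn : t - s ≤ 2 ^ n * h) (hlag : M * (t - s) ≤ s - t₀) :
    LpBound P m (P[fun ω => gridSum A (h / 2) (2 * N) s t ω - gridSum A h N s t ω | 𝓕 t₀])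
      (2 ^ (n + 1) * (g₁ * s ^ (-γ) * (s - t₀) ^ (-α) * h ^ β₁)) := by
  have hs0 : 0 < s := ht₀.trans_lt hts
  have hst0 : 0 < s - t₀ := sub_pos.2 hts
  have hsl : ∀ i : ℕ, s ≤ clip s t (i * h) := fun i => (clip_mem hst _).1
  -- The triangle inequality suffices: `2^(n+1)` cells of conditional size `h^β₁` are summable over
  -- the levels as `β₁ > 1`. Hence neither `κ` nor `M` enters this constant.
  have key := LpBound.sum_card_le (P := P) (s := activeCells h N s t) hm
    (F := fun i => P[cellDelta A h s t i | 𝓕 t₀])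
    (a := g₁ * s ^ (-γ) * (s - t₀) ^ (-α) * h ^ β₁) (by positivity)
    (card_activeCells_le (N := N) hh hn) (fun i hi => by
      have hw0 : 0 ≤ clip s t ((i + 1 : ℕ) * h) - clip s t (i * h) :=
        sub_nonneg.2 ((clip_cell_le hh s t i).1.trans (clip_cell_le hh s t i).2)
      have hw : clip s t ((i + 1 : ℕ) * h) - clip s t (i * h) ≤ h := by
        linarith [clip_succ_le hh s t i]
      have hrt : clip s t ((i + 1 : ℕ) * h) ≤ t := (clip_mem hst _).2
      refine (hB.cond t₀ _ _ _ ht₀ (hts.trans_le (hsl i)) (hsl i) (clip_cell_le hh s t i).1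
        (clip_cell_le hh s t i).2 (hrt.trans ht) ?_).mono ?_
      · have h1 := mul_le_mul_of_nonneg_left (by linarith [hsl i] :
          clip s t ((i + 1 : ℕ) * h) - clip s t (i * h) ≤ t - s) hM
        linarith [hsl i]
      · have h1 := Real.rpow_le_rpow hw0 hw hβ₁
        have h2 := Real.rpow_le_rpow_of_nonpos hs0 (hsl i) (by linarith : -γ ≤ 0)
        have h3 := Real.rpow_le_rpow_of_nonpos hst0
          (by linarith [hsl i] : s - t₀ ≤ clip s t (i * h) - t₀) (by linarith : -α ≤ 0)
        have h4 : 0 ≤ clip s t (i * h) - t₀ := by linarith [hsl i]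
        gcongr)
  have hint : ∀ i ∈ activeCells h N s t, Integrable (cellDelta A h s t i) P := fun i _ =>
    (hA.memLp_germDelta (hs0.le.trans (hsl i)) (clip_cell_le hh s t i).1
      (clip_cell_le hh s t i).2 ((clip_mem hst _).2.trans ht)).integrable
        (one_le_ofReal_of_two_le hm)
  refine (key.neg.congr ?_).mono (le_of_eq (by push_cast; rfl))
  filter_upwards [condExp_finsetSum_fun (𝓗 := 𝓕 t₀) hint,
    condExp_neg (μ := P) (fun ω => ∑ i ∈ activeCells h N s t, cellDelta A h s t i ω) (𝓕 t₀),
    condExp_congr_ae (m := 𝓕 t₀) (hA.gridSum_sub_ae_eq hh N hs0.le hst ht)] with ω h1 h2 h3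
  rw [h1, ← h3]
  exact h2.symm

end Levels

/-! ### Summation over the levels and existence of the limit -/

section Existence

/-- The bound for the `k`-th refinement of a grid of width `h`. -/
noncomputable def levelBound (κ : ℝ) (Λ : ℕ) (α β₁ β₂ β₃ γ γ' g₁ g₂ g₃ h : ℝ) (k : ℕ) : ℝ :=
  Λ * (g₃ * h ^ β₃) * ((2 : ℝ) ^ (-β₃)) ^ k
  + (κ * (6 * Λ * (g₂ * h ^ (β₂ - γ'))) *
      (((2 : ℝ) ^ (-(β₂ - γ'))) ^ k * blockWeight γ' (k + 1))
    + κ * (Λ * (g₁ * h ^ (β₁ - α - γ))) *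
      (((2 : ℝ) ^ (-(β₁ - α - γ))) ^ k * blockGrowth α γ (k + 1)))

theorem hasSum_levelBound (κ : ℝ) (Λ : ℕ) {α β₁ β₂ β₃ γ γ' : ℝ} (g₁ g₂ g₃ h : ℝ)
    (hβ₁ : 1 < β₁) (hαβ : 1 / 2 < β₁ - α) (hβ₂ : 1 / 2 < β₂) (hβ₃ : 0 < β₃) (hγ : γ < 1 / 2) :
    HasSum (levelBound κ Λ α β₁ β₂ β₃ γ γ' g₁ g₂ g₃ h)
      (Λ * (g₃ * h ^ β₃) * geomSum β₃
        + (κ * (6 * Λ * (g₂ * h ^ (β₂ - γ'))) * weightSum β₂ γ'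
          + κ * (Λ * (g₁ * h ^ (β₁ - α - γ))) * growthSum α β₁ γ)) := by
  have h3 := (summable_geometric_of_lt_one (by positivity) (two_rpow_neg_lt_one hβ₃)).hasSum
  have h2 := (summable_shift (by positivity) (summable_blockWeight (γ := γ') hβ₂) 1).hasSum
  have h1 := (summable_shift (by positivity) (summable_blockGrowth hβ₁ hαβ hγ) 1).hasSum
  exact (h3.mul_left _).add ((h2.mul_left _).add (h1.mul_left _))

variable {Ω : Type u} {mΩ : MeasurableSpace Ω} {P : Measure Ω} [IsProbabilityMeasure P]
  {𝓕 : Filtration ℝ mΩ} {d : ℕ} {T m : ℝ} {A : ℝ → ℝ → Ω → EuclideanSpace ℝ (Fin d)}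
  {κ M α β₁ β₂ β₃ γ γ' s g₁ g₂ g₃ : ℝ}

theorem HasGermBound.lpBound_gridSum_level (hm : 2 ≤ m) (hκ : IsBDGConstant.{u} m d κ)
    (hκ1 : 1 ≤ κ) (hA : IsAdaptedGerm P 𝓕 T m A)
    (hB : HasGermBound P 𝓕 T m M α β₁ β₂ β₃ γ γ' A s g₁ g₂ g₃)
    (hα : 0 ≤ α) (hγ0 : 0 ≤ γ) (hγ : γ < 1 / 2) (hγ'0 : 0 ≤ γ') (hγ' : γ' < 1 / 2)
    (hβ₁ : 0 ≤ β₁) (hβ₂ : 0 ≤ β₂) (hβ₃ : 0 ≤ β₃) (hg₁ : 0 ≤ g₁) (hg₂ : 0 ≤ g₂) (hg₃ : 0 ≤ g₃)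
    {Λ : ℕ} (hΛ : M ≤ Λ) (hΛ1 : 1 ≤ Λ) (hM : 0 ≤ M) {H : ℝ} (hH : 0 < H) (n₀ k : ℕ) {t : ℝ}
    (hs : 0 ≤ s) (hst : s ≤ t) (ht : t ≤ T) (hn : t - s ≤ H / 2 ^ n₀) :
    LpBound P m (fun ω => gridSum A (H / 2 ^ (n₀ + k + 1)) (2 ^ (n₀ + k + 1)) s t ω
        - gridSum A (H / 2 ^ (n₀ + k)) (2 ^ (n₀ + k)) s t ω)
      (levelBound κ Λ α β₁ β₂ β₃ γ γ' g₁ g₂ g₃ (H / 2 ^ n₀) k) := by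
  have hh : 0 < H / 2 ^ n₀ := by positivity
  have e : H / 2 ^ (n₀ + k) = H / 2 ^ n₀ / 2 ^ k := by rw [pow_add]; field_simp
  have e' : H / 2 ^ (n₀ + k + 1) = H / 2 ^ (n₀ + k) / 2 := by rw [pow_succ]; field_simp
  have h := hB.lpBound_gridSum_sub hm hκ hκ1 hA hα hγ0 hγ hγ'0 hγ' hβ₁ hβ₂ hβ₃ hg₁ hg₂ hg₃ hΛ
    hΛ1 hM (h := H / 2 ^ (n₀ + k)) (by positivity) (2 ^ (n₀ + k)) (n := k) hs hst ht (by
      rw [e]; refine hn.trans (le_of_eq ?_); field_simp)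
  rw [e', show 2 ^ (n₀ + k + 1) = 2 * 2 ^ (n₀ + k) by rw [pow_succ, mul_comm]]
  refine h.mono (le_of_eq ?_)
  have hk : 0 < H / 2 ^ n₀ / 2 ^ k := by positivity
  have a1 := div_two_pow_rpow hh k β₃
  have a2 : (H / 2 ^ n₀ / 2 ^ k) ^ β₂ * (H / 2 ^ n₀ / 2 ^ k) ^ (-γ') =
      (H / 2 ^ n₀) ^ (β₂ - γ') * ((2 : ℝ) ^ (-(β₂ - γ'))) ^ k := by
    rw [← Real.rpow_add hk, ← div_two_pow_rpow hh, sub_eq_add_neg]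
  have a3 : (H / 2 ^ n₀ / 2 ^ k) ^ β₁ * (H / 2 ^ n₀ / 2 ^ k) ^ (-γ) *
      (H / 2 ^ n₀ / 2 ^ k) ^ (-α) =
      (H / 2 ^ n₀) ^ (β₁ - α - γ) * ((2 : ℝ) ^ (-(β₁ - α - γ))) ^ k := by
    rw [← Real.rpow_add hk, ← Real.rpow_add hk, ← div_two_pow_rpow hh]
    congr 1; ring
  rw [e, mul_assoc g₂, a2, mul_assoc g₁, mul_assoc g₁, a3, a1, levelBound]
  ring

/-- Supplies the dyadic level comparable to a given length: the initial mesh for an interval, and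
later the length class of an interval of a partition. -/
theorem exists_pow_scale {H x : ℝ} (hx : 0 < x) (hxH : x ≤ H) :
    ∃ n : ℕ, x ≤ H / 2 ^ n ∧ H / 2 ^ n ≤ 2 * x := by
  obtain ⟨n, h1, h2⟩ := exists_nat_pow_near ((one_le_div hx).2 hxH) (one_lt_two (α := ℝ))
  refine ⟨n, ?_, ?_⟩
  · rw [le_div_iff₀ (by positivity)]
    rw [le_div_iff₀ hx] at h1; linarith
  · rw [div_le_iff₀ (by positivity)]
    rw [div_lt_iff₀ hx, pow_succ] at h2; linarith

/-- The constant for the conditional expectation part of the sewing bound. -/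
noncomputable def condConst (Λ : ℕ) (α β γ : ℝ) : ℝ :=
  Λ * 2 ^ (β - α - γ) * growthSum α β γ

/-- The constant for the martingale part of the sewing bound. -/
noncomputable def martConst (Λ : ℕ) (β γ : ℝ) : ℝ := 6 * Λ * 2 ^ (β - γ) * weightSum β γ

/-- The constant for the unweighted part of the sewing bound. -/
noncomputable def plainConst (Λ : ℕ) (β : ℝ) : ℝ := 1 + Λ * 2 ^ β * geomSum β

theorem condConst_nonneg (Λ : ℕ) (α β γ : ℝ) : 0 ≤ condConst Λ α β γ := by
  have := growthSum_nonneg α β γ; unfold condConst; positivity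

theorem martConst_nonneg (Λ : ℕ) (β γ : ℝ) : 0 ≤ martConst Λ β γ := by
  have := weightSum_nonneg β γ; unfold martConst; positivity

theorem plainConst_nonneg (Λ : ℕ) (β : ℝ) : 0 ≤ plainConst Λ β := by
  have := geomSum_nonneg β; unfold plainConst; positivity

/-- Telescoping from the level `n₀` whose mesh lies between `t - s` and `2(t - s)`. There the grid
sum differs from `A s t` by one `δA`, which accounts for the 1 in `plainConst`; the powers of 2 in
the constants come from the mesh being up to twice `t - s`. -/
theorem HasGermBound.eventually_lpBound_gridSum (hm : 2 ≤ m) (hκ : IsBDGConstant.{u} m d κ)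
    (hκ1 : 1 ≤ κ) (hA : IsAdaptedGerm P 𝓕 T m A)
    (hB : HasGermBound P 𝓕 T m M α β₁ β₂ β₃ γ γ' A s g₁ g₂ g₃)
    (hα : 0 ≤ α) (hγ0 : 0 ≤ γ) (hγ : γ < 1 / 2) (hγ'0 : 0 ≤ γ') (hγ' : γ' < 1 / 2)
    (hβ₁ : 1 < β₁) (hαβ : 1 / 2 < β₁ - α) (hβ₂ : 1 / 2 < β₂) (hβ₃ : 0 < β₃)
    (hg₁ : 0 ≤ g₁) (hg₂ : 0 ≤ g₂) (hg₃ : 0 ≤ g₃)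
    {Λ : ℕ} (hΛ : M ≤ Λ) (hΛ1 : 1 ≤ Λ) (hM : 0 ≤ M) {H : ℝ} (hTH : T ≤ H) {t : ℝ}
    (hs : 0 ≤ s) (hst : s < t) (ht : t ≤ T) :
    ∀ᶠ n in atTop, LpBound P m (fun ω => gridSum A (H / 2 ^ n) (2 ^ n) s t ω - A s t ω)
      (κ * (condConst Λ α β₁ γ * g₁ * (t - s) ^ (β₁ - α - γ)
        + martConst Λ β₂ γ' * g₂ * (t - s) ^ (β₂ - γ') + plainConst Λ β₃ * g₃ * (t - s) ^ β₃)) := by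
  have hts : 0 < t - s := sub_pos.2 hst
  obtain ⟨n₀, hn1, hn2⟩ := exists_pow_scale (H := H) hts (by linarith)
  have hH : 0 < H := by linarith
  have hh : 0 < H / 2 ^ n₀ := by positivity
  set lev := levelBound κ Λ α β₁ β₂ β₃ γ γ' g₁ g₂ g₃ (H / 2 ^ n₀) with hlev
  have hlev0 : ∀ k, LpBound P m (fun ω => gridSum A (H / 2 ^ (n₀ + k + 1)) (2 ^ (n₀ + k + 1)) s t ω
        - gridSum A (H / 2 ^ (n₀ + k)) (2 ^ (n₀ + k)) s t ω) (lev k) := fun k =>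
    hB.lpBound_gridSum_level hm hκ hκ1 hA hα hγ0 hγ hγ'0 hγ' (by linarith) (by linarith) hβ₃.le
      hg₁ hg₂ hg₃ hΛ hΛ1 hM hH n₀ k hs hst.le ht hn1
  have hsum := hasSum_levelBound κ Λ (γ' := γ') g₁ g₂ g₃ (H / 2 ^ n₀) hβ₁ hαβ hβ₂ hβ₃ hγ
  have hstep : ∀ k, LpBound P m
      (fun ω => gridSum A (H / 2 ^ (n₀ + k)) (2 ^ (n₀ + k)) s t ω - A s t ω)
      (g₃ * (t - s) ^ β₃ + ∑ i ∈ Finset.range k, lev i) := by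
    intro k
    induction k with
    | zero =>
      obtain ⟨g, hsg, hgt, hg⟩ := hA.gridSum_of_sub_le hh (N := 2 ^ n₀) hs hst.le ht (by
        push_cast; rw [mul_div_cancel₀ _ (by positivity)]; linarith) hn1
      simp only [Finset.range_zero, Finset.sum_empty, add_zero]
      refine (hB.plain s g t le_rfl hsg hgt ht).neg.congr ?_
      filter_upwards [hg] with ω hω
      rw [hω]; abel
    | succ k ih =>
      refine ((ih.add hm (hlev0 k)).congr (ae_of_all _ fun ω => ?_)).mono (le_of_eq ?_)
      · simp only [← add_assoc]; abel
      · rw [Finset.sum_range_succ]; ring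
  refine eventually_atTop.2 ⟨n₀, fun n hn => ?_⟩
  obtain ⟨k, rfl⟩ := Nat.exists_eq_add_of_le hn
  refine (hstep k).mono ?_
  have h1 : ∑ i ∈ Finset.range k, lev i ≤ _ := sum_le_hasSum _ (fun i _ => (hlev0 i).nonneg) hsum
  have hp : ∀ e : ℝ, 0 ≤ e → (H / 2 ^ n₀) ^ e ≤ 2 ^ e * (t - s) ^ e := fun e he => by
    rw [← Real.mul_rpow two_pos.le hts.le]
    exact Real.rpow_le_rpow hh.le hn2 he
  have p1 := hp (β₁ - α - γ) (by linarith)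
  have p2 := hp (β₂ - γ') (by linarith)
  have p3 := hp β₃ hβ₃.le
  have q1 := growthSum_nonneg α β₁ γ
  have q2 := weightSum_nonneg β₂ γ'
  have q3 := geomSum_nonneg β₃
  have hκ0 : 0 ≤ κ := by linarith
  calc g₃ * (t - s) ^ β₃ + ∑ i ∈ Finset.range k, lev i
      ≤ g₃ * (t - s) ^ β₃ + (Λ * (g₃ * (2 ^ β₃ * (t - s) ^ β₃)) * geomSum β₃
        + (κ * (6 * Λ * (g₂ * (2 ^ (β₂ - γ') * (t - s) ^ (β₂ - γ')))) * weightSum β₂ γ'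
          + κ * (Λ * (g₁ * (2 ^ (β₁ - α - γ) * (t - s) ^ (β₁ - α - γ)))) * growthSum α β₁ γ)) := by
        refine add_le_add_right (h1.trans ?_) _
        gcongr
    _ = κ * (condConst Λ α β₁ γ * g₁ * (t - s) ^ (β₁ - α - γ)
        + martConst Λ β₂ γ' * g₂ * (t - s) ^ (β₂ - γ'))
        + 1 * (plainConst Λ β₃ * g₃ * (t - s) ^ β₃) := by
        simp only [condConst, martConst, plainConst]; ring
    -- Here `1 ≤ κ` serves to put the unweighted part under the common factor.
    _ ≤ κ * (condConst Λ α β₁ γ * g₁ * (t - s) ^ (β₁ - α - γ)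
        + martConst Λ β₂ γ' * g₂ * (t - s) ^ (β₂ - γ'))
        + κ * (plainConst Λ β₃ * g₃ * (t - s) ^ β₃) := by
        have := plainConst_nonneg Λ β₃
        gcongr
    _ = _ := by ring

/-- The constant in the bound of the conditional expectation. -/
noncomputable def pastConst (β : ℝ) : ℝ := 1 + 2 * 2 ^ β * geomSum (β - 1)

theorem pastConst_nonneg (β : ℝ) : 0 ≤ pastConst β := by
  have := geomSum_nonneg (β - 1); unfold pastConst; positivity

/-- The same telescoping under the conditional expectation, with the triangle inequality at each
level; the level sizes form a geometric series of ratio `2^(-(β₁ - 1))`. -/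
theorem HasGermBound.eventually_lpBound_condExp_gridSum (hm : 2 ≤ m)
    (hA : IsAdaptedGerm P 𝓕 T m A)
    (hB : HasGermBound P 𝓕 T m M α β₁ β₂ β₃ γ γ' A s g₁ g₂ g₃)
    (hα : 0 ≤ α) (hγ0 : 0 ≤ γ) (hβ₁ : 1 < β₁) (hg₁ : 0 ≤ g₁) (hM : 0 ≤ M) {H : ℝ} (hTH : T ≤ H)
    {t t₀ : ℝ} (ht₀ : 0 ≤ t₀) (hts₀ : t₀ < s) (hst : s < t) (ht : t ≤ T)
    (hlag : M * (t - s) ≤ s - t₀) :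
    ∀ᶠ n in atTop, LpBound P m
      (P[fun ω => gridSum A (H / 2 ^ n) (2 ^ n) s t ω - A s t ω | 𝓕 t₀])
      (pastConst β₁ * g₁ * s ^ (-γ) * (s - t₀) ^ (-α) * (t - s) ^ β₁) := by
  have hs : 0 < s := ht₀.trans_lt hts₀
  have hts : 0 < t - s := sub_pos.2 hst
  have hst0 : 0 < s - t₀ := sub_pos.2 hts₀
  obtain ⟨n₀, hn1, hn2⟩ := exists_pow_scale (H := H) hts (by linarith)
  have hH : 0 < H := by linarith
  have hh : 0 < H / 2 ^ n₀ := by positivity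
  set w : ℝ := g₁ * s ^ (-γ) * (s - t₀) ^ (-α) with hw
  have hw0 : 0 ≤ w := by positivity
  have hint : ∀ n, Integrable (gridSum A (H / 2 ^ n) (2 ^ n) s t) P := fun n =>
    (hA.memLp_gridSum _ (by positivity) _ hs.le hst.le ht).integrable (one_le_ofReal_of_two_le hm)
  have hAi : Integrable (A s t) P :=
    (hA.memLp s t hs.le hst.le ht).integrable (one_le_ofReal_of_two_le hm)
  have hlev : ∀ k, LpBound P m (P[fun ω => gridSum A (H / 2 ^ (n₀ + k + 1)) (2 ^ (n₀ + k + 1)) s t ω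
        - gridSum A (H / 2 ^ (n₀ + k)) (2 ^ (n₀ + k)) s t ω | 𝓕 t₀])
      (w * (H / 2 ^ n₀) ^ β₁ * (2 * ((2 : ℝ) ^ (-(β₁ - 1))) ^ k)) := fun k => by
    have e : H / 2 ^ (n₀ + k) = H / 2 ^ n₀ / 2 ^ k := by rw [pow_add]; field_simp
    have e' : H / 2 ^ (n₀ + k + 1) = H / 2 ^ (n₀ + k) / 2 := by rw [pow_succ]; field_simp
    have h := hB.lpBound_condExp_gridSum_sub hm hA hα hγ0 (by linarith) hg₁ hM
      (h := H / 2 ^ (n₀ + k)) (by positivity) (2 ^ (n₀ + k)) (n := k) ht₀ hts₀ hst.le ht (by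
        rw [e]; refine hn1.trans (le_of_eq ?_); field_simp) hlag
    rw [e', show 2 ^ (n₀ + k + 1) = 2 * 2 ^ (n₀ + k) by rw [pow_succ, mul_comm]]
    refine h.mono (le_of_eq ?_)
    have e3 : (2 : ℝ) ^ (-(β₁ - 1)) = 2 * 2 ^ (-β₁) := by
      rw [show -(β₁ - 1) = 1 + -β₁ by ring, Real.rpow_add two_pos, Real.rpow_one]
    rw [e, div_two_pow_rpow hh, e3, mul_pow, pow_succ, hw]
    ring
  have hstep : ∀ k, LpBound P m
      (P[fun ω => gridSum A (H / 2 ^ (n₀ + k)) (2 ^ (n₀ + k)) s t ω - A s t ω | 𝓕 t₀])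
      (w * (t - s) ^ β₁ + ∑ i ∈ Finset.range k,
        w * (H / 2 ^ n₀) ^ β₁ * (2 * ((2 : ℝ) ^ (-(β₁ - 1))) ^ i)) := by
    intro k
    induction k with
    | zero =>
      obtain ⟨g, hsg, hgt, hg⟩ := hA.gridSum_of_sub_le hh (N := 2 ^ n₀) hs.le hst.le ht (by
        push_cast; rw [mul_div_cancel₀ _ (by positivity)]; linarith) hn1
      simp only [Finset.range_zero, Finset.sum_empty, add_zero]
      refine (hB.cond t₀ s g t ht₀ hts₀ le_rfl hsg hgt ht hlag).neg.congr ?_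
      have h1 : (fun ω => gridSum A (H / 2 ^ n₀) (2 ^ n₀) s t ω - A s t ω)
          =ᵐ[P] -germDelta A s g t := by
        filter_upwards [hg] with ω hω
        rw [hω, Pi.neg_apply]; abel
      filter_upwards [condExp_congr_ae (m := 𝓕 t₀) h1,
        condExp_neg (μ := P) (germDelta A s g t) (𝓕 t₀)] with ω h2 h3
      rw [h2, h3, Pi.neg_apply]
    | succ k ih =>
      refine ((ih.add hm (hlev k)).congr ?_).mono (le_of_eq ?_)
      · have h1 := condExp_add (m := 𝓕 t₀) ((hint (n₀ + k)).sub hAi)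
          ((hint (n₀ + k + 1)).sub (hint (n₀ + k)))
        have h2 : gridSum A (H / 2 ^ (n₀ + k)) (2 ^ (n₀ + k)) s t - A s t
          + (gridSum A (H / 2 ^ (n₀ + k + 1)) (2 ^ (n₀ + k + 1)) s t
            - gridSum A (H / 2 ^ (n₀ + k)) (2 ^ (n₀ + k)) s t) =
            fun ω => gridSum A (H / 2 ^ (n₀ + (k + 1))) (2 ^ (n₀ + (k + 1))) s t ω - A s t ω := by
          ext1 ω
          simp only [Pi.add_apply, Pi.sub_apply, ← add_assoc]
          abel
        rw [h2] at h1
        exact h1.symm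
      · rw [Finset.sum_range_succ]; ring
  refine eventually_atTop.2 ⟨n₀, fun n hn => ?_⟩
  obtain ⟨k, rfl⟩ := Nat.exists_eq_add_of_le hn
  refine (hstep k).mono ?_
  have hsum := (summable_geometric_of_lt_one (by positivity)
    (two_rpow_neg_lt_one (by linarith : 0 < β₁ - 1))).sum_le_tsum (Finset.range k)
      (fun i _ => by positivity)
  change _ ≤ geomSum (β₁ - 1) at hsum
  have p1 : (H / 2 ^ n₀) ^ β₁ ≤ 2 ^ β₁ * (t - s) ^ β₁ := by
    rw [← Real.mul_rpow two_pos.le hts.le]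
    exact Real.rpow_le_rpow hh.le hn2 (by linarith)
  have q := geomSum_nonneg (β₁ - 1)
  rw [← Finset.mul_sum, ← Finset.mul_sum]
  calc _ ≤ w * (t - s) ^ β₁ + w * (2 ^ β₁ * (t - s) ^ β₁) * (2 * geomSum (β₁ - 1)) := by gcongr
    _ = _ := by rw [pastConst, hw]; ring

/-- Existence of the limits of the Riemann sums along grids. -/
theorem HasGermBound.exists_limit (hm : 2 ≤ m) (hκ : IsBDGConstant.{u} m d κ)
    (hκ1 : 1 ≤ κ) (hA : IsAdaptedGerm P 𝓕 T m A)
    (hB : HasGermBound P 𝓕 T m M α β₁ β₂ β₃ γ γ' A 0 g₁ g₂ g₃)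
    (hα : 0 ≤ α) (hγ0 : 0 ≤ γ) (hγ : γ < 1 / 2) (hγ'0 : 0 ≤ γ') (hγ' : γ' < 1 / 2)
    (hβ₁ : 1 < β₁) (hαβ : 1 / 2 < β₁ - α) (hβ₂ : 1 / 2 < β₂) (hβ₃ : 0 < β₃)
    (hg₁ : 0 ≤ g₁) (hg₂ : 0 ≤ g₂) (hg₃ : 0 ≤ g₃) (hM : 0 ≤ M) {H : ℝ} (hH : 0 < H) (hTH : T ≤ H) :
    ∃ I : ℝ → Ω → EuclideanSpace ℝ (Fin d), ∀ t, 0 ≤ t → t ≤ T →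
      StronglyMeasurable[𝓕 t] (I t) ∧ MemLp (I t) (ENNReal.ofReal m) P ∧
      Tendsto (fun n : ℕ => eLpNorm (fun ω => gridSum A (H / 2 ^ n) (2 ^ n) 0 t ω - I t ω)
        (ENNReal.ofReal m) P) atTop (𝓝 0) := by
  have key : ∀ t : ℝ, ∃ f : Ω → EuclideanSpace ℝ (Fin d), 0 ≤ t → t ≤ T →
      StronglyMeasurable[𝓕 t] f ∧ MemLp f (ENNReal.ofReal m) P ∧
      Tendsto (fun n : ℕ => eLpNorm (fun ω => gridSum A (H / 2 ^ n) (2 ^ n) 0 t ω - f ω)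
        (ENNReal.ofReal m) P) atTop (𝓝 0) := fun t => by
    by_cases ht : 0 ≤ t ∧ t ≤ T
    · obtain ⟨f, hf⟩ := exists_stronglyMeasurable_lp_limit hm (𝓕.le t)
        (F := fun n : ℕ => gridSum A (H / 2 ^ n) (2 ^ n) 0 t)
        (fun n => hA.stronglyMeasurable_gridSum _ (by positivity) _ le_rfl ht.1 ht.2)
        (fun n => hA.memLp_gridSum _ (by positivity) _ le_rfl ht.1 ht.2)
        (hasSum_levelBound κ (⌈M⌉₊ + 1) (γ' := γ') g₁ g₂ g₃ (H / 2 ^ 0)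
          hβ₁ hαβ hβ₂ hβ₃ hγ).summable
        (fun n => by
          have := hB.lpBound_gridSum_level hm hκ hκ1 hA hα hγ0 hγ hγ'0 hγ' (by linarith)
            (by linarith) hβ₃.le hg₁ hg₂ hg₃ (Λ := ⌈M⌉₊ + 1)
            (by push_cast; linarith [Nat.le_ceil M]) (by omega) hM hH 0 n le_rfl ht.1 ht.2
            (by rw [pow_zero, div_one]; linarith [ht.2])
          simpa only [zero_add] using this)
      exact ⟨f, fun _ _ => hf⟩
    · exact ⟨0, fun h1 h2 => absurd ⟨h1, h2⟩ ht⟩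
  choose I hI using key
  exact ⟨I, hI⟩

end Existence

/-! ### Increments of the limit process -/

section Increments

variable {Ω : Type u} {mΩ : MeasurableSpace Ω} {P : Measure Ω}
  {𝓕 : Filtration ℝ mΩ} {d : ℕ} {T m : ℝ} {A : ℝ → ℝ → Ω → EuclideanSpace ℝ (Fin d)}
  {M α β₁ β₂ β₃ γ γ' g₁ g₂ g₃ : ℝ}

/-- Transfers bounds for grid sums over `[s, t]` to increments of the limit. The defect of
additivity at `s` is a single `δA` over at most one mesh width, which vanishes because `β₃ > 0`. -/
theorem HasGermBound.tendsto_gridSum_increment (hm : 2 ≤ m) (hA : IsAdaptedGerm P 𝓕 T m A)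
    (hB : HasGermBound P 𝓕 T m M α β₁ β₂ β₃ γ γ' A 0 g₁ g₂ g₃) (hβ₃ : 0 < β₃) (hg₃ : 0 ≤ g₃)
    {H : ℝ} (hH : 0 < H) (hTH : T < H) {I : ℝ → Ω → EuclideanSpace ℝ (Fin d)}
    (hI : ∀ t, 0 ≤ t → t ≤ T → StronglyMeasurable[𝓕 t] (I t) ∧ MemLp (I t) (ENNReal.ofReal m) P ∧
      Tendsto (fun n : ℕ => eLpNorm (fun ω => gridSum A (H / 2 ^ n) (2 ^ n) 0 t ω - I t ω)
        (ENNReal.ofReal m) P) atTop (𝓝 0)) {s t : ℝ} (hs : 0 ≤ s) (hst : s ≤ t) (ht : t ≤ T) :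
    Tendsto (fun n : ℕ => eLpNorm (fun ω => (gridSum A (H / 2 ^ n) (2 ^ n) s t ω - A s t ω)
        - (I t ω - I s ω - A s t ω)) (ENNReal.ofReal m) P) atTop (𝓝 0) := by
  obtain ⟨-, htm, htl⟩ := hI t (hs.trans hst) ht
  obtain ⟨-, hsm, hsl⟩ := hI s hs (hst.trans ht)
  have hmem : ∀ n : ℕ, ∀ v, 0 ≤ v → v ≤ T →
      MemLp (gridSum A (H / 2 ^ n) (2 ^ n) 0 v) (ENNReal.ofReal m) P := fun n v hv0 hv =>
    hA.memLp_gridSum _ (by positivity) _ le_rfl hv0 hv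
  have hmesh : Tendsto (fun n : ℕ => ENNReal.ofReal (g₃ * (H / 2 ^ n) ^ β₃)) atTop (𝓝 0) := by
    have h1 : Tendsto (fun n : ℕ => g₃ * (H / 2 ^ n) ^ β₃) atTop (𝓝 (g₃ * (0 : ℝ) ^ β₃)) := by
      refine Tendsto.const_mul _ (Tendsto.rpow_const ?_ (Or.inr hβ₃.le))
      exact tendsto_const_nhds.div_atTop (tendsto_pow_atTop_atTop_of_one_lt one_lt_two)
    rw [Real.zero_rpow hβ₃.ne', mul_zero] at h1
    simpa using ENNReal.tendsto_ofReal h1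
  have hlim := (htl.add hsl).add hmesh
  rw [add_zero, add_zero] at hlim
  refine tendsto_of_tendsto_of_tendsto_of_le_of_le tendsto_const_nhds hlim (fun _ => bot_le)
    fun n => ?_
  obtain ⟨a, b, ha, has, hsb, hbt, hba, hcorr⟩ := hA.gridSum_sub_sub
    (h := H / 2 ^ n) (by positivity) (N := 2 ^ n) hs hst ht (by
      push_cast; rw [mul_div_cancel₀ _ (by positivity)]; linarith)
  have hδ := (hB.plain a s b ha has hsb (hbt.trans ht)).mono
    (mul_le_mul_of_nonneg_left (Real.rpow_le_rpow (by linarith) hba hβ₃.le) hg₃)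
  have m1 := ((hmem n t (hs.trans hst) ht).sub htm).1
  have m2 := ((hmem n s hs (hst.trans ht)).sub hsm).1
  have hp := one_le_ofReal_of_two_le hm
  calc _ = eLpNorm (((fun ω => gridSum A (H / 2 ^ n) (2 ^ n) 0 t ω - I t ω)
        - (fun ω => gridSum A (H / 2 ^ n) (2 ^ n) 0 s ω - I s ω)) - germDelta A a s b)
        (ENNReal.ofReal m) P := by
        refine eLpNorm_congr_ae ?_
        filter_upwards [hcorr] with ω hω
        simp only [Pi.sub_apply, ← hω]
        abel
    _ ≤ _ := (eLpNorm_sub_le (m1.sub m2) hδ.1 hp).trans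
        (add_le_add (eLpNorm_sub_le m1 m2 hp) hδ.3)

end Increments

/-! ### Convergence of Riemann sums along arbitrary partitions -/

section Convergence

theorem IsBDGConstant.mono {m : ℝ} {d : ℕ} {K K' : ℝ} (h : IsBDGConstant.{u} m d K)
    (hK : K ≤ K') : IsBDGConstant.{u} m d K' := by
  refine ⟨h.1.trans hK, fun Ω mΩ P hP 𝓖 X hX hXm h0 N =>
    (h.2 Ω mΩ P hP 𝓖 X hX hXm h0 N).trans ?_⟩
  gcongr

/-- The bound for the contribution of the intervals of length about `2^{-n}` of a partition. -/
noncomputable def classBound (κ : ℝ) (Λ K : ℕ) (α β₁ β₂ β₃ γ₁ γ₂ c₁ c₂ c₃ c₄ c₅ c₆ : ℝ) (n : ℕ) :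
    ℝ :=
  2 * Λ * (c₄ * ((2 : ℝ) ^ (-(β₁ - α - γ₁))) ^ n + c₅ * ((2 : ℝ) ^ (-(β₂ - γ₂))) ^ n
    + c₆ * ((2 : ℝ) ^ (-β₃)) ^ n)
  + κ * (2 * Λ * (6 * (c₂ * (((2 : ℝ) ^ (-(β₁ - α - γ₁))) ^ n * blockWeight γ₁ (n + K))
      + c₃ * (((2 : ℝ) ^ (-(β₂ - γ₂))) ^ n * blockWeight γ₂ (n + K)))
    + c₁ * (((2 : ℝ) ^ (-(β₁ - α - γ₁))) ^ n * blockGrowth α γ₁ (n + K))))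

theorem summable_classBound (κ : ℝ) (Λ K : ℕ) {α β₁ β₂ β₃ γ₁ γ₂ : ℝ} (c₁ c₂ c₃ c₄ c₅ c₆ : ℝ)
    (hβ₁ : 1 < β₁) (hαβ : 1 / 2 < β₁ - α) (hβ₂ : 1 / 2 < β₂) (hβ₃ : 0 < β₃) (hγ₁ : γ₁ < 1 / 2)
    (hγ₂ : γ₂ < 1 / 2) :
    Summable (classBound κ Λ K α β₁ β₂ β₃ γ₁ γ₂ c₁ c₂ c₃ c₄ c₅ c₆) := by
  have geo : ∀ e : ℝ, 0 < e → Summable fun n : ℕ => ((2 : ℝ) ^ (-e)) ^ n := fun e he =>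
    summable_geometric_of_lt_one (by positivity) (two_rpow_neg_lt_one he)
  have s1 := geo (β₁ - α - γ₁) (by linarith)
  have s2 := geo (β₂ - γ₂) (by linarith)
  have s3 := geo β₃ hβ₃
  have w1 := summable_shift (by positivity) (summable_blockWeight (γ := γ₁) hαβ) K
  have w2 := summable_shift (by positivity) (summable_blockWeight (γ := γ₂) hβ₂) K
  have w3 := summable_shift (by positivity) (summable_blockGrowth hβ₁ hαβ hγ₁) K
  exact ((((s1.mul_left c₄).add (s2.mul_left c₅)).add (s3.mul_left c₆)).mul_left _).add
    ((((((w1.mul_left c₂).add (w2.mul_left c₃)).mul_left 6).add (w3.mul_left c₁)).mul_left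
      (2 * (Λ : ℝ))).mul_left κ)

variable {Ω : Type u} {mΩ : MeasurableSpace Ω} {P : Measure Ω} [IsProbabilityMeasure P]
  {𝓕 : Filtration ℝ mΩ} {d : ℕ} {T m : ℝ} {A : ℝ → ℝ → Ω → EuclideanSpace ℝ (Fin d)}
  {κ M α β₁ β₂ β₃ γ₁ γ₂ C₁ C₂ C₃ C₄ C₅ C₆ : ℝ} {𝒜 : ℝ → Ω → EuclideanSpace ℝ (Fin d)}

namespace IsSingularSewing

/-- The three defining bounds of the process play the role of the germ bounds in
`lpBound_sum_cells`, applied to intervals with length between `h / 2` and `h = 2^(-n)`. No sign of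
the constants is assumed, hence the absolute values. -/
theorem lpBound_class (hm : 2 ≤ m) (hκ : IsBDGConstant.{u} m d κ) (hκ1 : 1 ≤ κ)
    (hA : IsAdaptedGerm P 𝓕 T m A)
    (hS : IsSingularSewing P 𝓕 T m M α β₁ β₂ β₃ γ₁ γ₂ A C₁ C₂ C₃ C₄ C₅ C₆ 𝒜)
    (hα : 0 ≤ α) (hγ₁0 : 0 ≤ γ₁) (hγ₁ : γ₁ < 1 / 2) (hγ₂0 : 0 ≤ γ₂) (hγ₂ : γ₂ < 1 / 2)
    (hβ₁ : 1 < β₁) (hαβ : 1 / 2 < β₁ - α) (hβ₂ : 1 / 2 < β₂) (hβ₃ : 0 < β₃) (hM : 0 ≤ M)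
    {Λ K : ℕ} (hΛ : M ≤ Λ) (hΛ1 : 1 ≤ Λ) (hK : T < 2 ^ K) {τ : ℝ} (hτ : τ ≤ T)
    (π : IntervalPartition 0 τ) (n : ℕ) (I : Finset (Fin π.n))
    (hI1 : ∀ i ∈ I, π.pt i.succ - π.pt i.castSucc ≤ 1 / 2 ^ n)
    (hI2 : ∀ i ∈ I, 1 / 2 ^ n ≤ 2 * (π.pt i.succ - π.pt i.castSucc)) :
    LpBound P m (fun ω => ∑ i ∈ I, (𝒜 (π.pt i.succ) ω - 𝒜 (π.pt i.castSucc) ω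
        - A (π.pt i.castSucc) (π.pt i.succ) ω))
      (classBound κ Λ K α β₁ β₂ β₃ γ₁ γ₂ |C₁| |C₂| |C₃| |C₄| |C₅| |C₆| n) := by
  set h : ℝ := 1 / 2 ^ n with hh_def
  have hh : 0 < h := by positivity
  have hΛr : (1 : ℝ) ≤ Λ := by exact_mod_cast hΛ1
  have hlam : 0 < Λ * h := by positivity
  set l : Fin π.n → ℝ := fun i => π.pt i.castSucc with hl
  set r : Fin π.n → ℝ := fun i => π.pt i.succ with hr
  have hlr : ∀ i, l i < r i := fun i => π.strictMono Fin.castSucc_lt_succ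
  have hl0 : ∀ i, 0 ≤ l i := fun i => by
    rw [← π.left]; exact π.strictMono.monotone (Fin.zero_le _)
  have hrT : ∀ i, r i ≤ T := fun i => by
    refine le_trans ?_ hτ
    rw [← π.right]; exact π.strictMono.monotone (Fin.le_last _)
  have hpow : ∀ e : ℝ, h ^ e = ((2 : ℝ) ^ (-e)) ^ n := fun e => by
    rw [hh_def, div_two_pow_rpow one_pos, Real.one_rpow, one_mul]
  have hmeas : ∀ i, StronglyMeasurable[𝓕 (r i)]
      (fun ω => 𝒜 (r i) ω - 𝒜 (l i) ω - A (l i) (r i) ω) := fun i =>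
    ((hS.adapted _ ((hl0 i).trans (hlr i).le) (hrT i)).sub ((hS.adapted _ (hl0 i)
      ((hlr i).le.trans (hrT i))).mono (𝓕.mono (hlr i).le))).sub
      (hA.adapted _ _ (hl0 i) (hlr i).le (hrT i))
  have hwid0 : ∀ i, 0 ≤ r i - l i := fun i => sub_nonneg.2 (hlr i).le
  have hb : ∀ i ∈ I, ∀ e : ℝ, 0 ≤ e → (r i - l i) ^ e ≤ h ^ e := fun i hi e he =>
    Real.rpow_le_rpow (hwid0 i) (hI1 i hi) he
  have key := lpBound_sum_cells hm hκ hκ1 𝓕 (M := M) (x := |C₂| * h ^ (β₁ - α))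
    (y := |C₃| * h ^ β₂) (z := |C₄| * h ^ (β₁ - α - γ₁) + |C₅| * h ^ (β₂ - γ₂) + |C₆| * h ^ β₃)
    (g := |C₁| * h ^ β₁) (c := 0) hα hγ₁0 hγ₁ hγ₂0 hγ₂ (by positivity) (by positivity)
    (by positivity) (by positivity) hh le_rfl I l (fun i => ⌊l i / (Λ * h)⌋₊) (B := 2 * Λ)
    (K := n + K) hΛ hΛ1 (fun i ω => 𝒜 (r i) ω - 𝒜 (l i) ω - A (l i) (r i) ω)
    (fun i hi => (hmeas i).mono (𝓕.mono (by linarith [hI1 i hi])))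
    (fun i hi => by
      rw [zero_add, ← le_div_iff₀ hlam]; exact Nat.floor_le (div_nonneg (hl0 i) hlam.le))
    (fun i hi => by
      rw [zero_add, ← div_lt_iff₀ hlam]; exact Nat.lt_floor_add_one _)
    (fun i hi => by
      rw [Nat.floor_lt (div_nonneg (hl0 i) hlam.le), div_lt_iff₀ hlam]
      have h1 : (2 : ℝ) ^ K ≤ 2 ^ (n + K) * (Λ * h) := by
        have : (2 : ℝ) ^ (n + K) * (Λ * h) = Λ * 2 ^ K := by
          rw [hh_def, pow_add]; field_simp
        rw [this]; exact le_mul_of_one_le_left (by positivity) hΛr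
      push_cast
      linarith [hlr i, hrT i])
    (fun j => by
      have hh2 : 0 < h / 2 := by positivity
      calc _ ≤ (Finset.Ico (2 * Λ * j) (2 * Λ * (j + 1))).card := by
            -- Distinct left endpoints in the class are at least `h / 2` apart, so each half-step
            -- holds at most one of them, and a block of length `Λ h` comprises `2 Λ` half-steps.
            refine Finset.card_le_card_of_injOn (fun i => ⌊l i / (h / 2)⌋₊) (fun i hi => ?_) ?_
            · obtain ⟨-, h2⟩ := Finset.mem_filter.1 hi
              rw [Nat.floor_eq_iff (div_nonneg (hl0 i) hlam.le), le_div_iff₀ hlam,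
                div_lt_iff₀ hlam] at h2
              rw [Finset.mem_coe, Finset.mem_Ico, Nat.le_floor_iff (div_nonneg (hl0 i) hh2.le),
                Nat.floor_lt (div_nonneg (hl0 i) hh2.le), le_div_iff₀ hh2, div_lt_iff₀ hh2]
              push_cast
              constructor <;> linarith
            · have hlt : ∀ i ∈ I, ∀ k, i < k → ⌊l i / (h / 2)⌋₊ < ⌊l k / (h / 2)⌋₊ := by
                intro i hi k hik
                have h3 : r i ≤ l k := π.strictMono.monotone (by
                  rw [Fin.le_def]; simpa using Nat.succ_le_of_lt hik)
                have h4 := hI2 i hi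
                rw [← Nat.add_one_le_iff, Nat.le_floor_iff (div_nonneg (hl0 k) hh2.le)]
                push_cast
                have h5 := Nat.floor_le (div_nonneg (hl0 i) hh2.le)
                rw [le_div_iff₀ hh2] at h5 ⊢
                linarith
              intro i hi k hk hik
              have hi' : i ∈ I := (Finset.mem_filter.1 hi).1
              have hk' : k ∈ I := (Finset.mem_filter.1 hk).1
              rcases lt_trichotomy i k with h3 | h3 | h3
              · exact absurd hik (hlt i hi' k h3).ne
              · exact h3
              · exact absurd hik (hlt k hk' i h3).ne'
        _ = 2 * Λ := by
            rw [Nat.card_Ico, mul_add, mul_one]; omega)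
    (fun i hi => ⟨((hmeas i).mono (𝓕.le _)).aestronglyMeasurable, by positivity,
      (hS.continuity_bound _ _ (hl0 i) (hlr i) (hrT i)).trans (ENNReal.ofReal_le_ofReal (by
        have b1 := hb i hi (β₁ - α - γ₁) (by linarith)
        have b2 := hb i hi (β₂ - γ₂) (by linarith)
        have b3 := hb i hi β₃ hβ₃.le
        have n1 := Real.rpow_nonneg (hwid0 i) (β₁ - α - γ₁)
        have n2 := Real.rpow_nonneg (hwid0 i) (β₂ - γ₂)
        have n3 := Real.rpow_nonneg (hwid0 i) β₃
        have a4 := le_abs_self C₄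
        have a5 := le_abs_self C₅
        have a6 := le_abs_self C₆
        gcongr))⟩)
    (fun i hi hpos => ⟨((hmeas i).mono (𝓕.le _)).aestronglyMeasurable, by positivity,
      (hS.weighted_bound _ _ hpos (hlr i) (hrT i)).trans (ENNReal.ofReal_le_ofReal (by
        have b1 := hb i hi (β₁ - α) (by linarith)
        have b2 := hb i hi β₂ (by linarith)
        have n1 := Real.rpow_nonneg (hwid0 i) (β₁ - α)
        have n2 := Real.rpow_nonneg (hwid0 i) β₂
        have n3 := Real.rpow_nonneg hpos.le (-γ₁)
        have n4 := Real.rpow_nonneg hpos.le (-γ₂)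
        have a2 := le_abs_self C₂
        have a3 := le_abs_self C₃
        rw [mul_right_comm |C₂|, mul_right_comm |C₃|]
        gcongr))⟩)
    (fun i hi v hv0 hv hlag => by
      have n1 := Real.rpow_nonneg (hl0 i) (-γ₁)
      have n2 := Real.rpow_nonneg (by linarith : 0 ≤ l i - v) (-α)
      refine ⟨integrable_condExp.1, by positivity,
      (hS.condExp_bound v _ _ hv0 hv (hlr i) (hrT i)
        ((mul_le_mul_of_nonneg_left (hI1 i hi) hM).trans hlag)).trans
        (ENNReal.ofReal_le_ofReal ?_)⟩
      have b1 := hb i hi β₁ (by linarith)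
      have n3 := Real.rpow_nonneg (hwid0 i) β₁
      have a1 := le_abs_self C₁
      calc C₁ * l i ^ (-γ₁) * (l i - v) ^ (-α) * (r i - l i) ^ β₁
          ≤ |C₁| * l i ^ (-γ₁) * (l i - v) ^ (-α) * h ^ β₁ := by gcongr
        _ = _ := by ring)
  refine key.mono (le_of_eq ?_)
  have e1 : h ^ (β₁ - α) * h ^ (-γ₁) = h ^ (β₁ - α - γ₁) := by
    rw [← Real.rpow_add hh]; congr 1
  have e2 : h ^ β₂ * h ^ (-γ₂) = h ^ (β₂ - γ₂) := by
    rw [← Real.rpow_add hh]; congr 1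
  have e3 : h ^ β₁ * h ^ (-γ₁) * h ^ (-α) = h ^ (β₁ - α - γ₁) := by
    rw [← Real.rpow_add hh, ← Real.rpow_add hh]; congr 1; ring
  rw [mul_assoc |C₂|, e1, mul_assoc |C₃|, e2, mul_assoc |C₁|, mul_assoc |C₁|, e3, classBound]
  simp only [hpow]
  push_cast
  ring

theorem _root_.sum_fin_sub {V : Type*} [AddCommGroup V] {n : ℕ} (f : Fin (n + 1) → V) :
    ∑ i : Fin n, (f i.succ - f i.castSucc) = f (Fin.last n) - f 0 := by
  induction n with
  | zero => simp
  | succ n ih =>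
    rw [Fin.sum_univ_castSucc]
    have := ih (fun i => f i.castSucc)
    simp only [← Fin.succ_castSucc] at this ⊢
    rw [this]
    simp

/-- Any process with the characterizing properties is the limit of the Riemann sums. -/
theorem tendsto_riemannSum (hm : 2 ≤ m) (hA : IsAdaptedGerm P 𝓕 T m A)
    (hS : IsSingularSewing P 𝓕 T m M α β₁ β₂ β₃ γ₁ γ₂ A C₁ C₂ C₃ C₄ C₅ C₆ 𝒜)
    (hα : 0 ≤ α) (hγ₁0 : 0 ≤ γ₁) (hγ₁ : γ₁ < 1 / 2) (hγ₂0 : 0 ≤ γ₂) (hγ₂ : γ₂ < 1 / 2)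
    (hβ₁ : 1 < β₁) (hαβ : 1 / 2 < β₁ - α) (hβ₂ : 1 / 2 < β₂) (hβ₃ : 0 < β₃) (hM : 0 ≤ M)
    {τ : ℝ} (hτ : τ ≤ T) :
    Tendsto (fun π : IntervalPartition 0 τ =>
        eLpNorm (fun ω => riemannSum A π ω - 𝒜 τ ω) (ENNReal.ofReal m) P)
      (comap IntervalPartition.mesh (𝓝 0)) (𝓝 0) := by
  obtain ⟨K, hK⟩ := pow_unbounded_of_one_lt T (one_lt_two (α := ℝ))
  set Λ := ⌈M⌉₊ + 1 with hΛdef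
  have hΛ : M ≤ Λ := by rw [hΛdef]; push_cast; linarith [Nat.le_ceil M]
  have hκ : IsBDGConstant.{u} m d (max (bdgConst.{u} m d) 1) :=
    (isBDGConstant_bdgConst hm d).mono (le_max_left _ _)
  set b := classBound (max (bdgConst.{u} m d) 1) Λ K α β₁ β₂ β₃ γ₁ γ₂ |C₁| |C₂| |C₃| |C₄| |C₅| |C₆|
    with hb
  have hbs : Summable b := summable_classBound _ _ _ _ _ _ _ _ _ hβ₁ hαβ hβ₂ hβ₃ hγ₁ hγ₂
  rw [ENNReal.tendsto_nhds_zero]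
  intro ε hε
  rcases eq_or_ne ε ∞ with rfl | hε'
  · exact Eventually.of_forall fun _ => le_top
  -- A small mesh excludes all classes in the finite set `s`, so only a small remainder of the
  -- convergent series is left.
  obtain ⟨s, hs⟩ := summable_iff_vanishing_norm.1 hbs ε.toReal (ENNReal.toReal_pos hε.ne' hε')
  obtain ⟨k, hk⟩ := s.exists_nat_subset_range
  have hev : ∀ᶠ π : IntervalPartition 0 τ in comap IntervalPartition.mesh (𝓝 0),
      π.mesh < 1 / 2 ^ (k + 1) :=
    tendsto_comap.eventually (gt_mem_nhds (by positivity))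
  filter_upwards [hev] with π hπ
  have hlen : ∀ i : Fin π.n, π.pt i.succ - π.pt i.castSucc < 1 / 2 ^ (k + 1) := fun i =>
    (le_ciSup (f := fun i : Fin π.n => π.pt i.succ - π.pt i.castSucc)
      (Set.finite_range _).bddAbove i).trans_lt hπ
  have hpos : ∀ i : Fin π.n, 0 < π.pt i.succ - π.pt i.castSucc := fun i =>
    sub_pos.2 (π.strictMono Fin.castSucc_lt_succ)
  have hone : (1 : ℝ) / 2 ^ (k + 1) ≤ 1 := by
    rw [div_le_one (by positivity)]; exact one_le_pow₀ one_le_two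
  choose cls hcls1 hcls2 using fun i : Fin π.n =>
    exists_pow_scale (hpos i) ((hlen i).le.trans hone)
  have hclsk : ∀ i, k < cls i := fun i => by
    have h1 : (1 : ℝ) / 2 ^ cls i < 1 / 2 ^ k := by
      refine (hcls2 i).trans_lt ?_
      have h2 := hlen i
      rw [pow_succ, ← div_div] at h2
      linarith
    rw [one_div_lt_one_div (by positivity) (by positivity)] at h1
    exact (pow_lt_pow_iff_right₀ one_lt_two).1 h1
  -- The increments of `𝒜` telescope to `𝒜 τ`, so the error is minus the sum of all remainders,
  -- sorted by length class.
  have hsum : LpBound P m (fun ω => riemannSum A π ω - 𝒜 τ ω)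
      (∑ n ∈ Finset.univ.image cls, b n) := by
    refine (LpBound.sum hm fun n _ => hS.lpBound_class hm hκ (le_max_right _ _) hA hα hγ₁0 hγ₁ hγ₂0
      hγ₂ hβ₁ hαβ hβ₂ hβ₃ hM hΛ (by omega) hK hτ π n (Finset.univ.filter fun i => cls i = n)
      (fun i hi => by rw [← (Finset.mem_filter.1 hi).2]; exact hcls1 i)
      (fun i hi => by rw [← (Finset.mem_filter.1 hi).2]; exact hcls2 i)).neg.congr ?_
    filter_upwards [hS.zero] with ω hω
    rw [Finset.sum_fiberwise_of_maps_to (fun i _ => Finset.mem_image_of_mem cls (Finset.mem_univ i)),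
      Finset.sum_sub_distrib, sum_fin_sub (fun i => 𝒜 (π.pt i) ω), π.left, π.right, hω,
      riemannSum]
    simp
  refine hsum.le.trans ?_
  have hdisj : Disjoint (Finset.univ.image cls) s := by
    rw [Finset.disjoint_left]
    intro n hn hns
    obtain ⟨i, -, rfl⟩ := Finset.mem_image.1 hn
    have := Finset.mem_range.1 (hk hns)
    have := hclsk i
    omega
  rw [← ENNReal.ofReal_toReal hε']
  exact ENNReal.ofReal_le_ofReal ((le_abs_self _).trans (hs _ hdisj).le)

end IsSingularSewing

/-- There are partitions of arbitrarily small mesh. -/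
theorem neBot_comap_mesh {τ : ℝ} (hτ : 0 ≤ τ) :
    (comap (IntervalPartition.mesh (a := 0) (b := τ)) (𝓝 0)).NeBot := by
  rw [comap_neBot_iff]
  intro t ht
  rcases hτ.eq_or_lt with rfl | hτ
  -- For `τ = 0` the partition without intervals serves; its mesh is an empty supremum, which is `0`
  -- in `ℝ`.
  · have h0 : StrictMono fun _ : Fin (0 + 1) => (0 : ℝ) := fun i j hij => by exfalso; omega
    refine ⟨⟨0, fun _ => 0, h0, rfl, rfl⟩, ?_⟩
    have : IntervalPartition.mesh (a := 0) (b := 0) ⟨0, fun _ => 0, h0, rfl, rfl⟩ = 0 := by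
      simp [IntervalPartition.mesh]
    rw [this]
    exact mem_of_mem_nhds ht
  · have hlim : Tendsto (fun n : ℕ => τ / ((n : ℝ) + 1)) atTop (𝓝 0) :=
      tendsto_const_nhds.div_atTop (tendsto_atTop_add_const_right _ _ tendsto_natCast_atTop_atTop)
    obtain ⟨n, hn⟩ := (hlim.eventually ht).exists
    have hn0 : (0 : ℝ) < n + 1 := by positivity
    have h2 : 0 < τ / ((n : ℝ) + 1) := by positivity
    refine ⟨⟨n + 1, fun i => τ / (n + 1) * (i : ℕ), fun i j hij => ?_, by simp, ?_⟩, ?_⟩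
    · have : ((i : ℕ) : ℝ) < (j : ℕ) := by exact_mod_cast hij
      exact mul_lt_mul_of_pos_left this h2
    · simp only [Fin.val_last]; push_cast; field_simp
    · have : ∀ i : Fin (n + 1), τ / ((n : ℝ) + 1) * ((i.succ : ℕ) : ℝ)
          - τ / ((n : ℝ) + 1) * ((i.castSucc : ℕ) : ℝ) = τ / (n + 1) := fun i => by
        simp only [Fin.val_succ, Fin.val_castSucc]; push_cast; ring
      rw [IntervalPartition.mesh]
      simp only [this, ciSup_const]
      exact hn

end Convergence

/-! ### Assembly: existence, constants and uniqueness -/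

section Main

variable {Ω : Type u} {mΩ : MeasurableSpace Ω} {P : Measure Ω}
  {𝓕 : Filtration ℝ mΩ} {d : ℕ} {T m : ℝ} {A : ℝ → ℝ → Ω → EuclideanSpace ℝ (Fin d)}
  {M α β₁ β₂ β₃ γ γ' s g₁ g₂ g₃ : ℝ}

theorem HasGermBound.mono_left (hB : HasGermBound P 𝓕 T m M α β₁ β₂ β₃ γ γ' A 0 g₁ g₂ g₃)
    (hs : 0 ≤ s) : HasGermBound P 𝓕 T m M α β₁ β₂ β₃ γ γ' A s g₁ g₂ g₃ where
  cond t₀ t₁ t₂ t₃ h₀ h₁ hst := hB.cond t₀ t₁ t₂ t₃ h₀ h₁ (hs.trans hst)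
  weighted t₁ t₂ t₃ h₁ hst := hB.weighted t₁ t₂ t₃ h₁ (hs.trans hst)
  plain t₁ t₂ t₃ hst := hB.plain t₁ t₂ t₃ (hs.trans hst)

/-- Away from the singularity, the weights can be replaced by constants. -/
theorem HasGermBound.freeze_weights
    (hB : HasGermBound P 𝓕 T m M α β₁ β₂ β₃ γ γ' A 0 g₁ g₂ g₃) (hs : 0 < s) (hγ : 0 ≤ γ)
    (hγ' : 0 ≤ γ') (hg₁ : 0 ≤ g₁) (hg₂ : 0 ≤ g₂) :
    HasGermBound P 𝓕 T m M α β₁ β₂ β₂ 0 0 A s (g₁ * s ^ (-γ)) (g₂ * s ^ (-γ'))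
      (g₂ * s ^ (-γ')) where
  cond t₀ t₁ t₂ t₃ h₀ h₁ hst h₂ h₃ hT hlag := by
    refine (hB.cond t₀ t₁ t₂ t₃ h₀ h₁ (hs.le.trans hst) h₂ h₃ hT hlag).mono ?_
    have h4 := Real.rpow_le_rpow_of_nonpos hs hst (by linarith : -γ ≤ 0)
    have h5 := Real.rpow_nonneg (by linarith : 0 ≤ t₁ - t₀) (-α)
    have h6 := Real.rpow_nonneg (by linarith : 0 ≤ t₃ - t₁) β₁
    rw [neg_zero, Real.rpow_zero, mul_one]
    gcongr
  weighted t₁ t₂ t₃ h₁ hst h₂ h₃ hT := by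
    refine (hB.weighted t₁ t₂ t₃ h₁ (hs.le.trans hst) h₂ h₃ hT).mono ?_
    have h4 := Real.rpow_le_rpow_of_nonpos hs hst (by linarith : -γ' ≤ 0)
    have h6 := Real.rpow_nonneg (by linarith : 0 ≤ t₃ - t₁) β₂
    rw [neg_zero, Real.rpow_zero, mul_one]
    gcongr
  plain t₁ t₂ t₃ hst h₂ h₃ hT := by
    refine (hB.weighted t₁ t₂ t₃ (hs.trans_le hst) (hs.le.trans hst) h₂ h₃ hT).mono ?_
    have h4 := Real.rpow_le_rpow_of_nonpos hs hst (by linarith : -γ' ≤ 0)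
    have h6 := Real.rpow_nonneg (by linarith : 0 ≤ t₃ - t₁) β₂
    gcongr

/-- It suffices to check the bounds for nondegenerate intervals. -/
theorem IsAdaptedGerm.hasGermBound [IsProbabilityMeasure P] (hA : IsAdaptedGerm P 𝓕 T m A)
    (hg₁ : 0 ≤ g₁) (hg₂ : 0 ≤ g₂) (hg₃ : 0 ≤ g₃)
    (hcond : ∀ t₀ t₁ t₂ t₃, 0 ≤ t₀ → t₀ < t₁ → t₁ < t₂ → t₂ < t₃ → t₃ ≤ T →
      M * (t₃ - t₁) ≤ t₁ - t₀ →
      eLpNorm (P[germDelta A t₁ t₂ t₃ | 𝓕 t₀]) (ENNReal.ofReal m) P ≤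
        ENNReal.ofReal (g₁ * t₁ ^ (-γ) * (t₁ - t₀) ^ (-α) * (t₃ - t₁) ^ β₁))
    (hweighted : ∀ t₀ t₁ t₂, 0 < t₀ → t₀ < t₁ → t₁ < t₂ → t₂ ≤ T →
      eLpNorm (germDelta A t₀ t₁ t₂) (ENNReal.ofReal m) P ≤
        ENNReal.ofReal (g₂ * t₀ ^ (-γ') * (t₂ - t₀) ^ β₂))
    (hplain : ∀ t₀ t₁ t₂, 0 ≤ t₀ → t₀ < t₁ → t₁ < t₂ → t₂ ≤ T →
      eLpNorm (germDelta A t₀ t₁ t₂) (ENNReal.ofReal m) P ≤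
        ENNReal.ofReal (g₃ * (t₂ - t₀) ^ β₃)) :
    HasGermBound P 𝓕 T m M α β₁ β₂ β₃ γ γ' A 0 g₁ g₂ g₃ := by
  have hdeg : ∀ t₁ t₂ t₃, 0 ≤ t₁ → t₁ ≤ t₂ → t₂ ≤ t₃ → t₃ ≤ T →
      (t₁ < t₂ ∧ t₂ < t₃) ∨ germDelta A t₁ t₂ t₃ =ᵐ[P] 0 := by
    intro t₁ t₂ t₃ h₁ h₂ h₃ hT
    rcases h₂.eq_or_lt with rfl | h₂
    · exact Or.inr (hA.germDelta_left h₁ (h₃.trans hT))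
    rcases h₃.eq_or_lt with rfl | h₃
    · exact Or.inr (hA.germDelta_right (h₁.trans h₂.le) hT)
    exact Or.inl ⟨h₂, h₃⟩
  refine ⟨fun t₀ t₁ t₂ t₃ h₀ h₀₁ h₁ h₂ h₃ hT hlag => ?_, fun t₁ t₂ t₃ hpos h₁ h₂ h₃ hT => ?_,
    fun t₁ t₂ t₃ h₁ h₂ h₃ hT => ?_⟩
  · have hn : 0 ≤ g₁ * t₁ ^ (-γ) * (t₁ - t₀) ^ (-α) * (t₃ - t₁) ^ β₁ := by
      have h5 := Real.rpow_nonneg (by linarith : 0 ≤ t₁ - t₀) (-α)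
      have h6 := Real.rpow_nonneg (by linarith : 0 ≤ t₃ - t₁) β₁
      positivity
    rcases hdeg t₁ t₂ t₃ h₁ h₂ h₃ hT with h | h
    · exact ⟨integrable_condExp.1, hn, hcond t₀ t₁ t₂ t₃ h₀ h₀₁ h.1 h.2 hT hlag⟩
    · refine LpBound.of_ae_eq_zero ((condExp_congr_ae h).trans ?_) hn
      rw [condExp_zero]
  · have h6 := Real.rpow_nonneg (by linarith : 0 ≤ t₃ - t₁) β₂
    rcases hdeg t₁ t₂ t₃ h₁ h₂ h₃ hT with h | h
    · exact ⟨(hA.memLp_germDelta h₁ h₂ h₃ hT).1, by positivity,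
        hweighted t₁ t₂ t₃ hpos h.1 h.2 hT⟩
    · exact LpBound.of_ae_eq_zero h (by positivity)
  · have h6 := Real.rpow_nonneg (by linarith : 0 ≤ t₃ - t₁) β₃
    rcases hdeg t₁ t₂ t₃ h₁ h₂ h₃ hT with h | h
    · exact ⟨(hA.memLp_germDelta h₁ h₂ h₃ hT).1, by positivity, hplain t₁ t₂ t₃ h₁ h.1 h.2 hT⟩
    · exact LpBound.of_ae_eq_zero h (by positivity)

theorem tendsto_eLpNorm_condExp [IsProbabilityMeasure P] (hm : 2 ≤ m) {𝓗 : MeasurableSpace Ω}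
    {F : ℕ → Ω → EuclideanSpace ℝ (Fin d)} {f : Ω → EuclideanSpace ℝ (Fin d)}
    (hF : ∀ n, Integrable (F n) P) (hf : Integrable f P)
    (h : Tendsto (fun n => eLpNorm (fun ω => F n ω - f ω) (ENNReal.ofReal m) P) atTop (𝓝 0)) :
    Tendsto (fun n => eLpNorm (fun ω => (P[F n | 𝓗]) ω - (P[f | 𝓗]) ω) (ENNReal.ofReal m) P)
      atTop (𝓝 0) := by
  refine tendsto_of_tendsto_of_tendsto_of_le_of_le tendsto_const_nhds h (fun _ => bot_le)
    fun n => ?_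
  have h1 := condExp_sub (m := 𝓗) (hF n) hf
  calc _ = eLpNorm (P[F n - f | 𝓗]) (ENNReal.ofReal m) P := eLpNorm_congr_ae h1.symm
    _ ≤ _ := eLpNorm_condExp_le_eLpNorm _ (one_le_ofReal_of_two_le hm)

/-- Existence for the singular stochastic sewing lemma. -/
theorem HasGermBound.exists_isSingularSewing [IsProbabilityMeasure P] (hm : 2 ≤ m)
    (hA : IsAdaptedGerm P 𝓕 T m A)
    (hB : HasGermBound P 𝓕 T m M α β₁ β₂ β₃ γ γ' A 0 g₁ g₂ g₃) (hT : 0 ≤ T)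
    (hα : 0 ≤ α) (hγ0 : 0 ≤ γ) (hγ : γ < 1 / 2) (hγ'0 : 0 ≤ γ') (hγ' : γ' < 1 / 2)
    (hβ₁ : 1 < β₁) (hαβ : 1 / 2 < β₁ - α) (hβ₂ : 1 / 2 < β₂) (hβ₃ : 0 < β₃)
    (hg₁ : 0 ≤ g₁) (hg₂ : 0 ≤ g₂) (hg₃ : 0 ≤ g₃) {Λ : ℕ} (hΛ : M ≤ Λ) (hΛ1 : 1 ≤ Λ) (hM : 0 ≤ M) :
    ∃ 𝒜, IsSingularSewing P 𝓕 T m M α β₁ β₂ β₃ γ γ' A (pastConst β₁ * g₁)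
      (condConst Λ α β₁ 0 * bdgConst.{u} m d * g₁)
      ((martConst Λ β₂ 0 + plainConst Λ β₂) * bdgConst.{u} m d * g₂)
      (condConst Λ α β₁ γ * bdgConst.{u} m d * g₁)
      (martConst Λ β₂ γ' * bdgConst.{u} m d * g₂)
      (plainConst Λ β₃ * bdgConst.{u} m d * g₃) 𝒜 := by
  have hH : 0 < T + 1 := by linarith
  have hTH : T < T + 1 := by linarith
  have hκ : IsBDGConstant.{u} m d (max (bdgConst.{u} m d) 1) :=
    (isBDGConstant_bdgConst hm d).mono (le_max_left _ _)
  have hκ1 : 1 ≤ max (bdgConst.{u} m d) 1 := le_max_right _ _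
  have hκd : d ≠ 0 → max (bdgConst.{u} m d) 1 = bdgConst.{u} m d := fun hd =>
    max_eq_left (one_le_bdgConst hm hd P)
  obtain ⟨I, hI⟩ := hB.exists_limit hm hκ hκ1 hA hα hγ0 hγ hγ'0 hγ' hβ₁ hαβ hβ₂ hβ₃ hg₁ hg₂ hg₃ hM
    hH hTH.le
  have hlim := fun {s t : ℝ} (hs : 0 ≤ s) (hst : s ≤ t) (ht : t ≤ T) =>
    hB.tendsto_gridSum_increment hm hA hβ₃ hg₃ hH hTH hI hs hst ht
  have hmem : ∀ s t, 0 ≤ s → s ≤ t → t ≤ T →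
      MemLp (fun ω => I t ω - I s ω - A s t ω) (ENNReal.ofReal m) P := fun s t hs hst ht =>
    ((hI t (hs.trans hst) ht).2.1.sub (hI s hs (hst.trans ht)).2.1).sub (hA.memLp s t hs hst ht)
  have hmem' : ∀ (n : ℕ) (s t : ℝ), 0 ≤ s → s ≤ t → t ≤ T →
      MemLp (fun ω => gridSum A ((T + 1) / 2 ^ n) (2 ^ n) s t ω - A s t ω) (ENNReal.ofReal m) P :=
    fun n s t hs hst ht =>
    (hA.memLp_gridSum _ (by positivity) _ hs hst ht).sub (hA.memLp s t hs hst ht)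
  have hp := one_le_ofReal_of_two_le hm
  refine ⟨I, ?_, fun t h0 ht => (hI t h0 ht).1, fun t h0 ht => (hI t h0 ht).2.1, ?_, ?_, ?_⟩
  · have h0 : ∀ n : ℕ, gridSum A ((T + 1) / 2 ^ n) (2 ^ n) 0 0 =ᵐ[P] 0 := fun n => by
      filter_upwards [hA.diag 0 le_rfl hT] with ω hω
      refine Finset.sum_eq_zero fun i _ => ?_
      rw [clip_of_right_le le_rfl (by positivity), clip_of_right_le le_rfl (by positivity)]
      exact hω
    have h1 := LpBound.of_tendsto hm (Eventually.of_forall fun n =>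
      LpBound.of_ae_eq_zero (m := m) (h0 n) le_rfl) (hI 0 le_rfl hT).2.1.1 (hI 0 le_rfl hT).2.2
    have h2 := h1.le
    rw [ENNReal.ofReal_zero, nonpos_iff_eq_zero,
      eLpNorm_eq_zero_iff h1.1 (ofReal_ne_zero_of_two_le hm)] at h2
    exact h2
  · intro t₀ s t h0 hts hst ht hlag
    have hs0 : 0 ≤ s := h0.trans hts.le
    exact (LpBound.of_tendsto hm ((hB.mono_left hs0).eventually_lpBound_condExp_gridSum hm hA hα hγ0
      hβ₁ hg₁ hM hTH.le h0 hts hst ht hlag) integrable_condExp.1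
      (tendsto_eLpNorm_condExp hm (fun n => (hmem' n s t hs0 hst.le ht).integrable hp)
        ((hmem s t hs0 hst.le ht).integrable hp) (hlim hs0 hst.le ht))).le
  · intro s t hs hst ht
    -- For `d = 0` the lower bound `1 ≤ κ` is not available, but all values coincide.
    rcases eq_or_ne d 0 with rfl | hd
    · rw [Subsingleton.elim (fun ω => I t ω - I s ω - A s t ω) 0, eLpNorm_zero]
      exact bot_le
    -- On `[s, T]` the weights are at most their values at `s`, and the weighted bound of `δA` also
    -- serves as the unweighted one, with `β₂` for `β₃`. Both exponents `γ` become 0, so the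
    -- constants do not depend on them; `martConst` and `plainConst` add up in front of `g₂`.
    have h1 := LpBound.of_tendsto hm
      ((hB.freeze_weights hs hγ0 hγ'0 hg₁ hg₂).eventually_lpBound_gridSum hm hκ hκ1 hA hα le_rfl
        (by norm_num) le_rfl (by norm_num) hβ₁ hαβ hβ₂ (by linarith) (by positivity)
        (by positivity) (by positivity) hΛ hΛ1 hM hTH.le hs.le hst ht)
      (hmem s t hs.le hst.le ht).1 (hlim hs.le hst.le ht)
    refine (h1.mono (le_of_eq ?_)).le
    rw [hκd hd, sub_zero, sub_zero]
    ring
  · intro s t hs hst ht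
    rcases eq_or_ne d 0 with rfl | hd
    · rw [Subsingleton.elim (fun ω => I t ω - I s ω - A s t ω) 0, eLpNorm_zero]
      exact bot_le
    have h1 := LpBound.of_tendsto hm
      ((hB.mono_left hs).eventually_lpBound_gridSum hm hκ hκ1 hA hα hγ0 hγ hγ'0 hγ' hβ₁ hαβ hβ₂ hβ₃
        hg₁ hg₂ hg₃ hΛ hΛ1 hM hTH.le hs hst ht)
      (hmem s t hs hst.le ht).1 (hlim hs hst.le ht)
    refine (h1.mono (le_of_eq ?_)).le
    rw [hκd hd]
    ring

theorem ae_eq_of_tendsto_eLpNorm {ι : Type*} {l : Filter ι} [l.NeBot] (hm : 2 ≤ m)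
    {F : ι → Ω → EuclideanSpace ℝ (Fin d)} {f g : Ω → EuclideanSpace ℝ (Fin d)}
    (hF : ∀ i, AEStronglyMeasurable (F i) P) (hf : AEStronglyMeasurable f P)
    (hg : AEStronglyMeasurable g P)
    (h1 : Tendsto (fun i => eLpNorm (fun ω => F i ω - f ω) (ENNReal.ofReal m) P) l (𝓝 0))
    (h2 : Tendsto (fun i => eLpNorm (fun ω => F i ω - g ω) (ENNReal.ofReal m) P) l (𝓝 0)) :
    f =ᵐ[P] g := by
  have h3 : eLpNorm (f - g) (ENNReal.ofReal m) P ≤ 0 := by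
    have h4 := h2.add h1
    rw [add_zero] at h4
    refine ge_of_tendsto' h4 fun i => ?_
    have e : f - g = (fun ω => F i ω - g ω) - fun ω => F i ω - f ω := by
      ext1 ω; simp
    rw [e]
    exact eLpNorm_sub_le ((hF i).sub hg) ((hF i).sub hf) (one_le_ofReal_of_two_le hm)
  rw [nonpos_iff_eq_zero, eLpNorm_eq_zero_iff (hf.sub hg) (ofReal_ne_zero_of_two_le hm)] at h3
  filter_upwards [h3] with ω hω
  exact sub_eq_zero.1 hω

theorem IsAdaptedGerm.memLp_riemannSum (hA : IsAdaptedGerm P 𝓕 T m A) {τ : ℝ} (hτ : τ ≤ T)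
    (π : IntervalPartition 0 τ) : MemLp (riemannSum A π) (ENNReal.ofReal m) P :=
  memLp_finsetSum _ fun _ _ => hA.memLp _ _
    (π.left.symm.le.trans (π.strictMono.monotone (Fin.zero_le _)))
    (π.strictMono Fin.castSucc_lt_succ).le
    (((π.strictMono.monotone (Fin.le_last _)).trans π.right.le).trans hτ)

end Main

theorem corollary2p6 :
    ∃ (c₁ : ℝ → ℝ≥0) (c₂ c₃ : ℝ → ℝ → ℝ → ℝ → ℝ≥0) (c₄ : ℝ → ℝ → ℝ → ℝ → ℝ≥0)
      (c₅ : ℝ → ℝ → ℝ → ℝ≥0) (c₆ : ℝ → ℝ → ℝ≥0),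
    ∀ (Ω : Type u) (mΩ : MeasurableSpace Ω) (P : Measure Ω) (_ : IsProbabilityMeasure P)
      (T : ℝ) (_ : 0 ≤ T) (𝓕 : Filtration ℝ mΩ) (d : ℕ)
      (A : ℝ → ℝ → Ω → EuclideanSpace ℝ (Fin d))
      (m Γ₁ Γ₂ Γ₃ M α β₁ β₂ β₃ γ₁ γ₂ : ℝ),
      2 ≤ m → 0 ≤ Γ₁ → 0 ≤ Γ₂ → 0 ≤ Γ₃ → 0 ≤ M → 0 ≤ α → 0 ≤ γ₁ → 0 ≤ γ₂ →
      1 < β₁ → 1 / 2 < β₂ → 1 / 2 < β₁ - α → γ₁ < 1 / 2 → γ₂ < 1 / 2 → 0 < β₃ →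
      (∀ s, 0 ≤ s → s ≤ T → A s s =ᵐ[P] 0) →
      (∀ s t, 0 ≤ s → s ≤ t → t ≤ T → StronglyMeasurable[𝓕 t] (A s t)) →
      (∀ s t, 0 ≤ s → s ≤ t → t ≤ T → MemLp (A s t) (ENNReal.ofReal m) P) →
      (∀ t₀ t₁ t₂ t₃, 0 ≤ t₀ → t₀ < t₁ → t₁ < t₂ → t₂ < t₃ → t₃ ≤ T →
        M * (t₃ - t₁) ≤ t₁ - t₀ →
        eLpNorm (P[germDelta A t₁ t₂ t₃ | 𝓕 t₀]) (ENNReal.ofReal m) P ≤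
          ENNReal.ofReal (Γ₁ * t₁ ^ (-γ₁) * (t₁ - t₀) ^ (-α) * (t₃ - t₁) ^ β₁)) →
      (∀ t₀ t₁ t₂, 0 < t₀ → t₀ < t₁ → t₁ < t₂ → t₂ ≤ T →
        eLpNorm (germDelta A t₀ t₁ t₂) (ENNReal.ofReal m) P ≤
          ENNReal.ofReal (Γ₂ * t₀ ^ (-γ₂) * (t₂ - t₀) ^ β₂)) →
      (∀ t₀ t₁ t₂, 0 ≤ t₀ → t₀ < t₁ → t₁ < t₂ → t₂ ≤ T →
        eLpNorm (germDelta A t₀ t₁ t₂) (ENNReal.ofReal m) P ≤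
          ENNReal.ofReal (Γ₃ * (t₂ - t₀) ^ β₃)) →
      ∃ 𝒜 : ℝ → Ω → EuclideanSpace ℝ (Fin d),
        IsSingularSewing P 𝓕 T m M α β₁ β₂ β₃ γ₁ γ₂ A
          (c₁ β₁ * Γ₁)
          (c₂ α β₁ β₂ M * bdgConst.{u} m d * Γ₁)
          (c₃ α β₁ β₂ M * bdgConst.{u} m d * Γ₂)
          (c₄ α β₁ γ₁ M * bdgConst.{u} m d * Γ₁)
          (c₅ β₂ γ₂ M * bdgConst.{u} m d * Γ₂)
          (c₆ β₃ M * bdgConst.{u} m d * Γ₃) 𝒜 ∧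
        (∀ (𝒜' : ℝ → Ω → EuclideanSpace ℝ (Fin d)) (C₁ C₂ C₃ C₄ C₅ C₆ : ℝ),
          IsSingularSewing P 𝓕 T m M α β₁ β₂ β₃ γ₁ γ₂ A C₁ C₂ C₃ C₄ C₅ C₆ 𝒜' →
          ∀ t, 0 ≤ t → t ≤ T → 𝒜' t =ᵐ[P] 𝒜 t) ∧
        (∀ τ, 0 ≤ τ → τ ≤ T →
          Tendsto
            (fun π : IntervalPartition 0 τ =>
              eLpNorm (fun ω => riemannSum A π ω - 𝒜 τ ω) (ENNReal.ofReal m) P)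
            (comap IntervalPartition.mesh (𝓝 0)) (𝓝 0)) := by
  -- The block size `⌈M⌉₊ + 1` is a natural number that is at least both `M` and 1.
  refine ⟨fun β₁ => (pastConst β₁).toNNReal,
    fun α β₁ _ M => (condConst (⌈M⌉₊ + 1) α β₁ 0).toNNReal,
    fun _ _ β₂ M => (martConst (⌈M⌉₊ + 1) β₂ 0 + plainConst (⌈M⌉₊ + 1) β₂).toNNReal,
    fun α β₁ γ₁ M => (condConst (⌈M⌉₊ + 1) α β₁ γ₁).toNNReal,
    fun β₂ γ₂ M => (martConst (⌈M⌉₊ + 1) β₂ γ₂).toNNReal,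
    fun β₃ M => (plainConst (⌈M⌉₊ + 1) β₃).toNNReal, ?_⟩
  intro Ω mΩ P _ T hT 𝓕 d A m Γ₁ Γ₂ Γ₃ M α β₁ β₂ β₃ γ₁ γ₂ hm hΓ₁ hΓ₂ hΓ₃ hM hα hγ₁0 hγ₂0 hβ₁ hβ₂
    hαβ hγ₁ hγ₂ hβ₃ hdiag hadapted hmem hcond hweighted hplain
  have hA : IsAdaptedGerm P 𝓕 T m A := ⟨hdiag, hadapted, hmem⟩
  have hB := hA.hasGermBound hΓ₁ hΓ₂ hΓ₃ hcond hweighted hplain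
  obtain ⟨𝒜, h𝒜⟩ := hB.exists_isSingularSewing hm hA hT hα hγ₁0 hγ₁ hγ₂0 hγ₂ hβ₁ hαβ hβ₂ hβ₃ hΓ₁ hΓ₂
    hΓ₃ (Λ := ⌈M⌉₊ + 1) (by push_cast; linarith [Nat.le_ceil M]) (by omega) hM
  refine ⟨𝒜, ?_, fun 𝒜' C₁ C₂ C₃ C₄ C₅ C₆ h𝒜' t h0 ht => ?_, fun τ _ hτ =>
    h𝒜.tendsto_riemannSum hm hA hα hγ₁0 hγ₁ hγ₂0 hγ₂ hβ₁ hαβ hβ₂ hβ₃ hM hτ⟩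
  · rw [Real.coe_toNNReal _ (pastConst_nonneg _), Real.coe_toNNReal _ (condConst_nonneg _ _ _ _),
      Real.coe_toNNReal _ (add_nonneg (martConst_nonneg _ _ _) (plainConst_nonneg _ _)),
      Real.coe_toNNReal _ (condConst_nonneg _ _ _ _), Real.coe_toNNReal _ (martConst_nonneg _ _ _),
      Real.coe_toNNReal _ (plainConst_nonneg _ _)]
    exact h𝒜
  -- Uniqueness: both processes are limits of the same Riemann sums along a nontrivial filter.
  · have := neBot_comap_mesh h0
    exact ae_eq_of_tendsto_eLpNorm hm (fun π => (hA.memLp_riemannSum ht π).1)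
      (h𝒜'.memLp t h0 ht).1 (h𝒜.memLp t h0 ht).1
      (h𝒜'.tendsto_riemannSum hm hA hα hγ₁0 hγ₁ hγ₂0 hγ₂ hβ₁ hαβ hβ₂ hβ₃ hM ht)
      (h𝒜.tendsto_riemannSum hm hA hα hγ₁0 hγ₁ hγ₂0 hγ₂ hβ₁ hαβ hβ₂ hβ₃ hM ht)
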